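/- **Theorem (cellularity of the Okada algebra).** Let $N\ge 0$ be an integer, $K$ a field, and $X=(x_1,\dots,x_{N-1})$, $Y=(y_1,\dots,y_{N-2})$ arbitrary sequences in $K$. Let $O_N(X,Y)$ be the unital associative $K$-algebra with generators $E_1,\dots,E_{N-1}$ and relations $E_i^2=x_iE_i$ for $1\le i\le N-1$, $E_iE_j=E_jE_i$ for $|i-j|\ge 2$, and $E_{i+1}E_iE_{i+1}=y_iE_{i+1}$ for $1\le i\le N-2$. *Diagrams.* An Okada arc-diagram of rank $N$ is a non-crossing perfect matching of the nodes $1<2<\dots<N<\overline N<\dots<\overline 2<\overline 1$ (with $|a|=|\overline a|=a$) with a label $h$ on each arc $\{a,b\}$ such that $1\le h(\{a,b\})\le \min(|a|,|b|)$, $h(\{a,b\})\equiv\min(|a|,|b|) \pmod 2$, and $h(\{a,b\})>h(\{c,d\})$ whenever $c<a<b<d$. An arc $\{a,\overline b\}$ is called propagating. The composition $[C\circ D]$ merges the right nodes $\overline a$ of $C$ with the left nodes $a$ of $D$, concatenates the arcs, deletes the loops, and labels each resulting arc by the minimum of the labels of its fragments. The identity diagram has the arcs $\{a,\overline a\}$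 with label $a$ for all $a$; the elementary diagram $G_i$ ($1\le i<N$) has the arcs $\{i,i+1\}$ and $\{\overline i,\overline{i+1}\}$ with label $i$, and $\{j,\overline j\}$ with label $j$ for $j\ne i,i+1$. The mirror $D^\star$ exchanges left and right. *Identification of diagrams with elements of the algebra.* For $\sigma\in S_N$ put $c_i=\#\{j<i:\sigma^{-1}(j)>\sigma^{-1}(i)\}$ and $E_\sigma=\prod_{i=1}^N E_{i-1}E_{i-2}\cdots E_{i-c_i}$ (factors ordered by increasing $i$). Every Okada arc-diagram $D$ is the composition of the elementary diagrams along the word of $E_\sigma$ for exactly one $\sigma\in S_N$, and $D$ is identified with the element $E_\sigma\in O_N(X,Y)$. *Half diagrams.* An Okada half arc-diagram of rank $N$ consists of labelled full arcs $\{a,b\}$ and labelled half arcs at $a$ (propagating arcs, with a free end) such that each node of $\{1,\dots,N\}$ is on exactly one of them, full arcs do not cross, no half arc starts at a node strictly between the two ends of a full arc; labels are $\ge 1$, are at most and have the same parity as the smallest node of their arc, and strictly increase when passing from an arc to an arc nested in it, where an arc is nested in a half arc at $c$ if all its nodes are $>c$. Its propagating label set is the set of labels of its half arcs. For half diagrams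 $L,R$ with the same propagating label set, $L\bowtie R$ is the unique Okada arc-diagram with left half $L$ and with right half (read through the mirror) $R$: it is obtained by joining the half arcs of $L$ and $R$ with equal labels. *The poset.* A Fibonacci set of rank $N$ is a set $S=\{s_1<\dots<s_k\}\subseteq\{1,\dots,N\}$ with $k\equiv N$ and $s_l\equiv l \pmod 2$ for all $l$. For Fibonacci sets $S=\{s_1<\dots<s_k\}$ and $T=\{t_1<\dots<t_\ell\}$ of rank $N$, the dominance order is: $S\preceq T$ if and only if $k\le \ell$ and $s_{k-i}\le t_{\ell-i}$ for $0\le i<k$. *Claim.* $O_N(X,Y)$ is a finite-dimensional cellular algebra in the sense of Graham and Lehrer, with cell poset $\Lambda_N$ the set of Fibonacci sets of rank $N$ under dominance, index sets $M_S$ ($S\in\Lambda_N$) the set of half diagrams of rank $N$ with propagating label set $S$, cellular basis $C^S_{L,R}=L\bowtie R$ ($L,R\in M_S$), and anti-involution the mirror map. That is: 1. each $M_S$ is finite, and $(S,L,R)\mapsto C^S_{L,R}$ is injective with image a $K$-basis of $O_N(X,Y)$; 2. there is a $K$-linear map $\star:O_N(X,Y)\to O_N(X,Y)$ with $(ab)^\star=b^\star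 a^\star$, $(a^\star)^\star=a$, $(C^S_{L,R})^\star=C^S_{R,L}$, and which sends each diagram $D$ to its mirror $D^\star$; 3. for all $S\in\Lambda_N$ and $a\in O_N(X,Y)$ there are scalars $r_a(L',L)\in K$ ($L,L'\in M_S$) such that for all $L,R\in M_S$ $$a\,C^S_{L,R}-\sum_{L'\in M_S} r_a(L',L)\,C^S_{L',R}\ \in\ \operatorname{span}_K\{C^T_{P,Q}: T\prec S,\ P,Q\in M_T\}.$$ -/

import Mathlib

namespace Okada

/-! ### Fibonacci sets and the dominance order -/

/-- `S = {s_1 < ... < s_k} ⊆ {1, ..., N}` is a Fibonacci set of rank `N` if `k ≡ N` and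
`s_l ≡ l` modulo `2`. The enumeration `orderEmbOfFin` is indexed from `0`, so that
`s_l` is its value at `l - 1`. -/
def IsFibonacciSet (N : ℕ) (S : Finset ℕ) : Prop :=
  S ⊆ Finset.Icc 1 N ∧ S.card % 2 = N % 2 ∧
    ∀ i : Fin S.card, (S.orderEmbOfFin rfl i) % 2 = (i.val + 1) % 2

/-- The set of Fibonacci sets of rank `N`. -/
def FibSet (N : ℕ) : Type := {S : Finset ℕ // IsFibonacciSet N S}

/-- Dominance: `S = {s_1 < ... < s_k}` is dominated by `T = {t_1 < ... < t_l}` if `k ≤ l` and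
`s_{k-i} ≤ t_{l-i}` for `0 ≤ i < k`. -/
def Dominated (S T : Finset ℕ) : Prop :=
  ∃ h : S.card ≤ T.card, ∀ i : Fin S.card,
    S.orderEmbOfFin rfl (Fin.rev i) ≤ T.orderEmbOfFin rfl (Fin.rev (Fin.castLE h i))

theorem Dominated.refl (S : Finset ℕ) : Dominated S S :=
  ⟨le_rfl, fun _ => le_rfl⟩

theorem Dominated.trans {S T U : Finset ℕ} (h₁ : Dominated S T) (h₂ : Dominated T U) :
    Dominated S U := by
  obtain ⟨c₁, h₁⟩ := h₁
  obtain ⟨c₂, h₂⟩ := h₂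
  exact ⟨c₁.trans c₂, fun i => (h₁ i).trans (h₂ (Fin.castLE c₁ i))⟩

theorem Dominated.antisymm {S T : Finset ℕ} (h₁ : Dominated S T) (h₂ : Dominated T S) :
    S = T := by
  obtain ⟨c₁, h₁⟩ := h₁
  obtain ⟨c₂, h₂⟩ := h₂
  have hc : S.card = T.card := le_antisymm c₁ c₂
  have key : ∀ i : Fin S.card,
      S.orderEmbOfFin rfl i = T.orderEmbOfFin rfl (Fin.cast hc i) := by
    intro i
    apply le_antisymm
    · have := h₁ (Fin.rev i)
      rw [Fin.rev_rev] at this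
      refine this.trans (le_of_eq (congrArg _ ?_))
      ext; simp [Fin.val_rev]; omega
    · have := h₂ (Fin.cast hc (Fin.rev i))
      refine le_trans (le_of_eq (congrArg _ ?_)) (this.trans (le_of_eq (congrArg _ ?_)))
      · ext; simp [Fin.val_rev]; omega
      · ext; simp [Fin.val_rev]; omega
  have hS := Finset.range_orderEmbOfFin S rfl
  have hT := Finset.range_orderEmbOfFin T rfl
  apply Finset.coe_injective
  rw [← hS, ← hT]
  ext x
  constructor
  · rintro ⟨i, rfl⟩
    exact ⟨_, (key i).symm⟩
  · rintro ⟨i, rfl⟩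
    exact ⟨Fin.cast hc.symm i, key _⟩

/-- The poset of Fibonacci sets of rank `N` under the dominance order. -/
instance (N : ℕ) : PartialOrder (FibSet N) where
  le S T := Dominated S.1 T.1
  le_refl S := Dominated.refl S.1
  le_trans _ _ _ h₁ h₂ := h₁.trans h₂
  le_antisymm _ _ h₁ h₂ := Subtype.ext (h₁.antisymm h₂)

/-! ### Okada arc-diagrams and half arc-diagrams -/

/-- The `2N` boundary nodes: `Sum.inl a` is the left node with number `a + 1`, and `Sum.inr a`
is the right (overlined) node with number `a + 1`. -/
abbrev Node (N : ℕ) : Type := Fin N ⊕ Fin N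

/-- The absolute value `1, ..., N` of a node. -/
def Node.abs {N : ℕ} : Node N → ℕ
  | Sum.inl a => a.val + 1
  | Sum.inr a => a.val + 1

/-- The position (from `1` to `2N`) of a node in the total order
`1 < 2 < ... < N < N̄ < ... < 2̄ < 1̄`. -/
def Node.pos {N : ℕ} : Node N → ℕ
  | Sum.inl a => a.val + 1
  | Sum.inr a => 2 * N - a.val

/-- An Okada arc-diagram of rank `N`: a non-crossing perfect matching of the nodes, given by the
fixed-point-free involution `mate`, with a height label on each arc. The label of the arc
`{u, mate u}` is `height u = height (mate u)`. -/
@[ext]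
structure ArcDiagram (N : ℕ) where
  mate : Node N → Node N
  height : Node N → ℕ
  mate_mate : ∀ u, mate (mate u) = u
  mate_ne : ∀ u, mate u ≠ u
  noncrossing : ∀ u v,
    ¬ (u.pos < v.pos ∧ v.pos < (mate u).pos ∧ (mate u).pos < (mate v).pos)
  height_mate : ∀ u, height (mate u) = height u
  one_le_height : ∀ u, 1 ≤ height u
  height_le : ∀ u, height u ≤ min u.abs (mate u).abs
  height_parity : ∀ u, height u % 2 = min u.abs (mate u).abs % 2
  height_nested : ∀ u v, v.pos < u.pos → u.pos < (mate u).pos → (mate u).pos < (mate v).pos →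
    height v < height u

/-- An Okada half arc-diagram of rank `N` on the nodes `1, ..., N` (node number `a + 1` is
`a : Fin N`). A full arc joins `a` and `mate a ≠ a`; the nodes with `mate a = a` are the ends of
the half arcs (propagating arcs), whose other end is free. A half arc cannot start below a full
arc, and all the arcs above a half arc are nested in it. -/
@[ext]
structure HalfDiagram (N : ℕ) where
  mate : Fin N → Fin N
  height : Fin N → ℕ
  mate_mate : ∀ a, mate (mate a) = a
  noncrossing : ∀ a b, ¬ (a < b ∧ b < mate a ∧ mate a < mate b)
  noncrossing_half : ∀ a c, mate c = c → ¬ (a < c ∧ c < mate a)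
  height_mate : ∀ a, height (mate a) = height a
  one_le_height : ∀ a, 1 ≤ height a
  height_le : ∀ a, height a ≤ min a.val (mate a).val + 1
  height_parity : ∀ a, height a % 2 = (min a.val (mate a).val + 1) % 2
  height_nested : ∀ a c, c < a → a < mate a → mate a < mate c → height c < height a
  height_nested_half : ∀ a c, mate c = c → c < a → height c < height a

/-- The propagating label set: the labels of the propagating arcs. -/
def HalfDiagram.propLab {N : ℕ} (H : HalfDiagram N) : Finset ℕ :=
  (Finset.univ.filter fun a => H.mate a = a).image H.height

/-- The half diagrams of rank `N` with propagating label set `S`. -/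
def HalfDiagramWith {N : ℕ} (S : FibSet N) : Type :=
  {H : HalfDiagram N // H.propLab = S.1}

/-- Propagating arcs of a half diagram with the same label are equal. -/
theorem HalfDiagram.half_unique {N : ℕ} (H : HalfDiagram N) {a b : Fin N}
    (ha : H.mate a = a) (hb : H.mate b = b) (h : H.height a = H.height b) : a = b := by
  rcases lt_trichotomy a b with hab | hab | hab
  · have := H.height_nested_half b a ha hab; omega
  · exact hab
  · have := H.height_nested_half a b hb hab; omega

theorem HalfDiagram.exists_partner {N : ℕ} {L R : HalfDiagram N} (h : L.propLab = R.propLab)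
    {a : Fin N} (ha : L.mate a = a) : ∃ b, R.mate b = b ∧ R.height b = L.height a := by
  have : L.height a ∈ R.propLab := by
    rw [← h]
    exact Finset.mem_image.2 ⟨a, by simpa using ha, rfl⟩
  obtain ⟨b, hb, hb'⟩ := Finset.mem_image.1 this
  exact ⟨b, by simpa using hb, hb'⟩

open Classical in
/-- The node of `R` at the propagating arc with the same label as the propagating arc of `L`
at `a`. -/
noncomputable def HalfDiagram.partner {N : ℕ} (L R : HalfDiagram N) (a : Fin N) : Fin N :=
  if h : ∃ b, R.mate b = b ∧ R.height b = L.height a then h.choose else a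

theorem HalfDiagram.partner_spec {N : ℕ} {L R : HalfDiagram N} (h : L.propLab = R.propLab)
    {a : Fin N} (ha : L.mate a = a) :
    R.mate (L.partner R a) = L.partner R a ∧ R.height (L.partner R a) = L.height a := by
  have := HalfDiagram.exists_partner h ha
  rw [HalfDiagram.partner, dif_pos this]
  exact this.choose_spec

/-- The matching of the glued diagram `L ⋈ R`: full arcs of `L` and of `R` are kept on the left
and on the right, and the propagating arcs with equal labels are joined. -/
noncomputable def glueMate {N : ℕ} (L R : HalfDiagram N) : Node N → Node N
  | Sum.inl a => if L.mate a = a then Sum.inr (L.partner R a) else Sum.inl (L.mate a)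
  | Sum.inr b => if R.mate b = b then Sum.inl (R.partner L b) else Sum.inr (R.mate b)

/-- The labels of the glued diagram `L ⋈ R`. -/
def glueHeight {N : ℕ} (L R : HalfDiagram N) : Node N → ℕ
  | Sum.inl a => L.height a
  | Sum.inr b => R.height b

theorem glueMate_inl_half {N : ℕ} {L : HalfDiagram N} (R : HalfDiagram N) {a : Fin N}
    (ha : L.mate a = a) : glueMate L R (Sum.inl a) = Sum.inr (L.partner R a) := by
  simp [glueMate, ha]

theorem glueMate_inl_full {N : ℕ} {L : HalfDiagram N} (R : HalfDiagram N) {a : Fin N}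
    (ha : L.mate a ≠ a) : glueMate L R (Sum.inl a) = Sum.inl (L.mate a) := by
  simp [glueMate, ha]

theorem glueMate_inr_half {N : ℕ} (L : HalfDiagram N) {R : HalfDiagram N} {a : Fin N}
    (ha : R.mate a = a) : glueMate L R (Sum.inr a) = Sum.inl (R.partner L a) := by
  simp [glueMate, ha]

theorem glueMate_inr_full {N : ℕ} (L : HalfDiagram N) {R : HalfDiagram N} {a : Fin N}
    (ha : R.mate a ≠ a) : glueMate L R (Sum.inr a) = Sum.inr (R.mate a) := by
  simp [glueMate, ha]

/-- The glued diagram `L ⋈ R`: the unique Okada arc-diagram with left half `L` and right half `R`,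
for half diagrams `L` and `R` with the same propagating label set. -/
noncomputable def glue {N : ℕ} (L R : HalfDiagram N) (h : L.propLab = R.propLab) :
    ArcDiagram N where
  mate := glueMate L R
  height := glueHeight L R
  mate_mate := by
    rintro (a | a)
    · by_cases ha : L.mate a = a
      · obtain ⟨p, q⟩ := HalfDiagram.partner_spec h ha
        obtain ⟨p', q'⟩ := HalfDiagram.partner_spec h.symm p
        rw [glueMate_inl_half R ha, glueMate_inr_half L p,
          L.half_unique p' ha (q'.trans q)]
      · have ha' : L.mate (L.mate a) ≠ L.mate a := by rw [L.mate_mate]; exact Ne.symm ha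
        rw [glueMate_inl_full R ha, glueMate_inl_full R ha', L.mate_mate]
    · by_cases ha : R.mate a = a
      · obtain ⟨p, q⟩ := HalfDiagram.partner_spec h.symm ha
        obtain ⟨p', q'⟩ := HalfDiagram.partner_spec h p
        rw [glueMate_inr_half L ha, glueMate_inl_half R p,
          R.half_unique p' ha (q'.trans q)]
      · have ha' : R.mate (R.mate a) ≠ R.mate a := by rw [R.mate_mate]; exact Ne.symm ha
        rw [glueMate_inr_full L ha, glueMate_inr_full L ha', R.mate_mate]
  mate_ne := by
    rintro (a | a) e
    · by_cases ha : L.mate a = a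
      · rw [glueMate_inl_half R ha] at e; cases e
      · rw [glueMate_inl_full R ha] at e; exact ha (Sum.inl.inj e)
    · by_cases ha : R.mate a = a
      · rw [glueMate_inr_half L ha] at e; cases e
      · rw [glueMate_inr_full L ha] at e; exact ha (Sum.inr.inj e)
  noncrossing := by
    rintro (a | a) (b | b) ⟨h1, h2, h3⟩
    · by_cases ha : L.mate a = a <;> by_cases hb : L.mate b = b
      · obtain ⟨p, q⟩ := HalfDiagram.partner_spec h ha
        obtain ⟨p', q'⟩ := HalfDiagram.partner_spec h hb
        rw [glueMate_inl_half R ha, glueMate_inl_half R hb] at h3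
        simp only [Node.pos] at h1 h3
        have l1 := L.height_nested_half b a ha (by rw [Fin.lt_def]; omega)
        have l2 := R.height_nested_half (L.partner R a) (L.partner R b) p'
          (by rw [Fin.lt_def]; omega)
        omega
      · rw [glueMate_inl_half R ha, glueMate_inl_full R hb] at h3
        simp only [Node.pos] at h3
        omega
      · rw [glueMate_inl_full R ha] at h2
        simp only [Node.pos] at h1 h2
        exact L.noncrossing_half a b hb ⟨by rw [Fin.lt_def]; omega, by rw [Fin.lt_def]; omega⟩
      · rw [glueMate_inl_full R ha] at h2 h3
        rw [glueMate_inl_full R hb] at h3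
        simp only [Node.pos] at h1 h2 h3
        exact L.noncrossing a b ⟨by rw [Fin.lt_def]; omega, by rw [Fin.lt_def]; omega,
          by rw [Fin.lt_def]; omega⟩
    · by_cases ha : L.mate a = a <;> by_cases hb : R.mate b = b
      · rw [glueMate_inl_half R ha, glueMate_inr_half L hb] at h3
        simp only [Node.pos] at h3
        omega
      · obtain ⟨p, q⟩ := HalfDiagram.partner_spec h ha
        rw [glueMate_inl_half R ha] at h2 h3
        rw [glueMate_inr_full L hb] at h3
        simp only [Node.pos] at h2 h3
        refine R.noncrossing_half (R.mate b) (L.partner R a) p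
          ⟨by rw [Fin.lt_def]; omega, ?_⟩
        rw [R.mate_mate, Fin.lt_def]; omega
      · rw [glueMate_inl_full R ha] at h2
        simp only [Node.pos] at h2
        omega
      · rw [glueMate_inl_full R ha] at h2
        simp only [Node.pos] at h2
        omega
    · simp only [Node.pos] at h1
      omega
    · by_cases ha : R.mate a = a
      · rw [glueMate_inr_half L ha] at h2
        simp only [Node.pos] at h2
        omega
      · by_cases hb : R.mate b = b
        · rw [glueMate_inr_full L ha, glueMate_inr_half L hb] at h3
          simp only [Node.pos] at h3
          omega
        · rw [glueMate_inr_full L ha] at h2 h3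
          rw [glueMate_inr_full L hb] at h3
          simp only [Node.pos] at h1 h2 h3
          refine R.noncrossing (R.mate b) (R.mate a) ⟨by rw [Fin.lt_def]; omega, ?_, ?_⟩
          · rw [R.mate_mate, Fin.lt_def]; omega
          · rw [R.mate_mate, R.mate_mate, Fin.lt_def]; omega
  height_mate := by
    rintro (a | a)
    · by_cases ha : L.mate a = a
      · rw [glueMate_inl_half R ha]; exact (HalfDiagram.partner_spec h ha).2
      · rw [glueMate_inl_full R ha]; exact L.height_mate a
    · by_cases ha : R.mate a = a
      · rw [glueMate_inr_half L ha]; exact (HalfDiagram.partner_spec h.symm ha).2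
      · rw [glueMate_inr_full L ha]; exact R.height_mate a
  one_le_height := by
    rintro (a | a)
    · exact L.one_le_height a
    · exact R.one_le_height a
  height_le := by
    rintro (a | a)
    · have l := L.height_le a
      by_cases ha : L.mate a = a
      · obtain ⟨p, q⟩ := HalfDiagram.partner_spec h ha
        have r := R.height_le (L.partner R a)
        rw [glueMate_inl_half R ha]
        rw [ha] at l
        rw [p] at r
        simp only [glueHeight, Node.abs]
        omega
      · rw [glueMate_inl_full R ha]
        simp only [glueHeight, Node.abs]
        omega
    · have l := R.height_le a
      by_cases ha : R.mate a = a
      · obtain ⟨p, q⟩ := HalfDiagram.partner_spec h.symm ha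
        have r := L.height_le (R.partner L a)
        rw [glueMate_inr_half L ha]
        rw [ha] at l
        rw [p] at r
        simp only [glueHeight, Node.abs]
        omega
      · rw [glueMate_inr_full L ha]
        simp only [glueHeight, Node.abs]
        omega
  height_parity := by
    rintro (a | a)
    · have l := L.height_parity a
      by_cases ha : L.mate a = a
      · obtain ⟨p, q⟩ := HalfDiagram.partner_spec h ha
        have r := R.height_parity (L.partner R a)
        rw [glueMate_inl_half R ha]
        rw [ha] at l
        rw [p] at r
        simp only [glueHeight, Node.abs]
        omega
      · rw [glueMate_inl_full R ha]
        simp only [glueHeight, Node.abs]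
        omega
    · have l := R.height_parity a
      by_cases ha : R.mate a = a
      · obtain ⟨p, q⟩ := HalfDiagram.partner_spec h.symm ha
        have r := L.height_parity (R.partner L a)
        rw [glueMate_inr_half L ha]
        rw [ha] at l
        rw [p] at r
        simp only [glueHeight, Node.abs]
        omega
      · rw [glueMate_inr_full L ha]
        simp only [glueHeight, Node.abs]
        omega
  height_nested := by
    rintro (a | a) (c | c) h1 h2 h3
    · by_cases hc : L.mate c = c
      · simp only [Node.pos] at h1
        exact L.height_nested_half a c hc (by rw [Fin.lt_def]; omega)
      · rw [glueMate_inl_full R hc] at h3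
        by_cases ha : L.mate a = a
        · rw [glueMate_inl_half R ha] at h3
          simp only [Node.pos] at h3
          omega
        · rw [glueMate_inl_full R ha] at h2 h3
          simp only [Node.pos] at h1 h2 h3
          exact L.height_nested a c (by rw [Fin.lt_def]; omega) (by rw [Fin.lt_def]; omega)
            (by rw [Fin.lt_def]; omega)
    · simp only [Node.pos] at h1
      omega
    · by_cases ha : R.mate a = a
      · rw [glueMate_inr_half L ha] at h2
        simp only [Node.pos] at h2
        omega
      · rw [glueMate_inr_full L ha] at h2 h3
        by_cases hc : L.mate c = c
        · obtain ⟨p, q⟩ := HalfDiagram.partner_spec h hc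
          rw [glueMate_inl_half R hc] at h3
          simp only [Node.pos] at h2 h3
          have := R.height_nested_half a (L.partner R c) p (by rw [Fin.lt_def]; omega)
          simp only [glueHeight]
          omega
        · rw [glueMate_inl_full R hc] at h3
          simp only [Node.pos] at h3
          omega
    · by_cases ha : R.mate a = a
      · rw [glueMate_inr_half L ha] at h2
        simp only [Node.pos] at h2
        omega
      · rw [glueMate_inr_full L ha] at h2 h3
        by_cases hc : R.mate c = c
        · rw [glueMate_inr_half L hc] at h3
          simp only [Node.pos] at h3
          omega
        · rw [glueMate_inr_full L hc] at h3
          simp only [Node.pos] at h1 h2 h3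
          have := R.height_nested (R.mate a) (R.mate c) (by rw [Fin.lt_def]; omega)
            (by rw [R.mate_mate, Fin.lt_def]; omega)
            (by rw [R.mate_mate, R.mate_mate, Fin.lt_def]; omega)
          rw [R.height_mate, R.height_mate] at this
          exact this

theorem Node.abs_swap {N : ℕ} (u : Node N) : Node.abs u.swap = u.abs := by
  cases u <;> rfl

theorem Node.pos_swap {N : ℕ} (u : Node N) : Node.pos u.swap + u.pos = 2 * N + 1 := by
  rcases u with a | a <;> simp only [Sum.swap_inl, Sum.swap_inr, Node.pos] <;> omega

/-- The mirror `D⋆` of an Okada arc-diagram, obtained by exchanging left and right. -/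
def ArcDiagram.mirror {N : ℕ} (D : ArcDiagram N) : ArcDiagram N where
  mate u := (D.mate u.swap).swap
  height u := D.height u.swap
  mate_mate u := by simp [D.mate_mate]
  mate_ne u h := D.mate_ne u.swap (by rw [← Sum.swap_swap (D.mate u.swap), h])
  noncrossing := by
    rintro u v ⟨h1, h2, h3⟩
    have e1 := Node.pos_swap u
    have e2 := Node.pos_swap v
    have e3 := Node.pos_swap (D.mate u.swap)
    have e4 := Node.pos_swap (D.mate v.swap)
    refine D.noncrossing (D.mate v.swap) (D.mate u.swap) ⟨by omega, ?_, ?_⟩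
    · rw [D.mate_mate]; omega
    · rw [D.mate_mate, D.mate_mate]; omega
  height_mate u := by simp [D.height_mate]
  one_le_height u := D.one_le_height _
  height_le u := by
    have := D.height_le u.swap
    rwa [Node.abs_swap, ← Node.abs_swap (D.mate u.swap)] at this
  height_parity u := by
    have := D.height_parity u.swap
    rwa [Node.abs_swap, ← Node.abs_swap (D.mate u.swap)] at this
  height_nested := by
    intro u v h1 h2 h3
    have e1 := Node.pos_swap u
    have e2 := Node.pos_swap v
    have e3 := Node.pos_swap (D.mate u.swap)
    have e4 := Node.pos_swap (D.mate v.swap)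
    have := D.height_nested (D.mate u.swap) (D.mate v.swap) (by omega)
      (by rw [D.mate_mate]; omega) (by rw [D.mate_mate, D.mate_mate]; omega)
    rwa [D.height_mate, D.height_mate] at this

/-! ### Composition of diagrams -/

/-- The indices `1, ..., N - 1` of the generators. -/
abbrev GenIdx (N : ℕ) : Type := {i : ℕ // 1 ≤ i ∧ i < N}

/-- The identity diagram: the arcs `{a, ā}` with label `a`. -/
def ArcDiagram.id (N : ℕ) : ArcDiagram N where
  mate u := u.swap
  height u := u.abs
  mate_mate u := by simp
  mate_ne u := by cases u <;> simp
  noncrossing := by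
    rintro u v ⟨h1, h2, h3⟩
    have e1 := Node.pos_swap u
    have e2 := Node.pos_swap v
    omega
  height_mate u := by cases u <;> simp [Node.abs]
  one_le_height u := by cases u <;> simp [Node.abs]
  height_le u := by cases u <;> simp [Node.abs]
  height_parity u := by cases u <;> simp [Node.abs]
  height_nested := by
    rintro (a | a) (c | c) h1 h2 h3 <;>
      simp only [Node.pos, Node.abs, Sum.swap_inl, Sum.swap_inr] at * <;> omega

/-- The transposition of the consecutive numbers `i` and `i + 1` (in `1, ..., N`). -/
def elemSwap {N : ℕ} (i : GenIdx N) (a : Fin N) : Fin N :=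
  if a.val + 1 = i.1 then ⟨i.1, i.2.2⟩
  else if a.val = i.1 then ⟨i.1 - 1, by have := i.2; omega⟩
  else a

/-- The matching of the elementary diagram `G_i`. -/
def elemMate {N : ℕ} (i : GenIdx N) : Node N → Node N
  | Sum.inl a => if a.val + 1 = i.1 ∨ a.val = i.1 then Sum.inl (elemSwap i a) else Sum.inr a
  | Sum.inr a => if a.val + 1 = i.1 ∨ a.val = i.1 then Sum.inr (elemSwap i a) else Sum.inl a

/-- The arcs of the elementary diagram, case by case. -/
theorem elemMate_cases {N : ℕ} (i : GenIdx N) (u : Node N) :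
    (u.abs = i.1 ∧ (elemMate i u).abs = i.1 + 1 ∧ (elemMate i u).isLeft = u.isLeft) ∨
    (u.abs = i.1 + 1 ∧ (elemMate i u).abs = i.1 ∧ (elemMate i u).isLeft = u.isLeft) ∨
    (u.abs ≠ i.1 ∧ u.abs ≠ i.1 + 1 ∧ (elemMate i u).abs = u.abs ∧
      (elemMate i u).isLeft = !u.isLeft) := by
  have hi := i.2
  rcases u with a | a
  all_goals
    by_cases h1 : a.val + 1 = i.1
    · left; simp [elemMate, elemSwap, Node.abs, h1]
    · by_cases h2 : a.val = i.1
      · right; left; simp [elemMate, elemSwap, Node.abs, h2]; omega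
      · right; right; simp [elemMate, Node.abs, h1, h2]

theorem Node.pos_cases {N : ℕ} (u : Node N) : 1 ≤ u.abs ∧ u.abs ≤ N ∧
    ((u.isLeft = true ∧ u.pos = u.abs) ∨ (u.isLeft = false ∧ u.pos + u.abs = 2 * N + 1)) := by
  rcases u with a | a
  · simp [Node.abs, Node.pos]
  · simp [Node.abs, Node.pos]
    omega

theorem Node.ext_abs {N : ℕ} {u v : Node N} (h : u.abs = v.abs) (h' : u.isLeft = v.isLeft) :
    u = v := by
  rcases u with a | a <;> rcases v with b | b <;> simp_all [Node.abs, Fin.ext_iff]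

/-- The elementary diagram `G_i`: the arcs `{i, i+1}` and its mirror with label `i`, and the arcs
`{j, j̄}` with label `j` for `j ≠ i, i + 1`. -/
def ArcDiagram.elem {N : ℕ} (i : GenIdx N) : ArcDiagram N where
  mate := elemMate i
  height u := if u.abs = i.1 + 1 then i.1 else u.abs
  mate_mate u := by
    have h1 := elemMate_cases i u
    have h2 := elemMate_cases i (elemMate i u)
    apply Node.ext_abs
    · grind
    · grind
  mate_ne u h := by
    have h1 := elemMate_cases i u
    rw [h] at h1
    grind
  noncrossing := by
    rintro u v ⟨h1, h2, h3⟩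
    have a1 := elemMate_cases i u
    have a2 := elemMate_cases i v
    have b1 := Node.pos_cases u
    have b2 := Node.pos_cases v
    have b3 := Node.pos_cases (elemMate i u)
    have b4 := Node.pos_cases (elemMate i v)
    grind
  height_mate u := by
    have h1 := elemMate_cases i u
    grind
  one_le_height u := by
    have := Node.pos_cases u
    have := i.2
    grind
  height_le u := by
    have h1 := elemMate_cases i u
    grind
  height_parity u := by
    have h1 := elemMate_cases i u
    grind
  height_nested := by
    intro u v h1 h2 h3
    have a1 := elemMate_cases i u
    have a2 := elemMate_cases i v
    have b1 := Node.pos_cases u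
    have b2 := Node.pos_cases v
    have b3 := Node.pos_cases (elemMate i u)
    have b4 := Node.pos_cases (elemMate i v)
    grind

/-- Nodes of the concatenation of two diagrams, in a left, a middle and a right column
(`0`, `1` and `2`). -/
abbrev CNode (N : ℕ) : Type := Fin 3 × Fin N

/-- Nodes of the first diagram: its right boundary is the middle column. -/
def firstNode {N : ℕ} : Node N → CNode N
  | Sum.inl a => (0, a)
  | Sum.inr a => (1, a)

/-- Nodes of the second diagram: its left boundary is the middle column. -/
def secondNode {N : ℕ} : Node N → CNode N
  | Sum.inl a => (1, a)
  | Sum.inr a => (2, a)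

/-- Nodes of the composition: the outer columns. -/
def outerNode {N : ℕ} : Node N → CNode N
  | Sum.inl a => (0, a)
  | Sum.inr a => (2, a)

/-- `p` and `q` are the ends of an arc of `C` or of `D` in the concatenation. -/
def ArcStep {N : ℕ} (C D : ArcDiagram N) (p q : CNode N) : Prop :=
  (∃ u, p = firstNode u ∧ q = firstNode (C.mate u)) ∨
    (∃ u, p = secondNode u ∧ q = secondNode (D.mate u))

/-- `p` and `q` lie on the same concatenated arc. -/
def Joined {N : ℕ} (C D : ArcDiagram N) : CNode N → CNode N → Prop :=
  Relation.ReflTransGen (ArcStep C D)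

/-- `E = [C ∘ D]`: the arcs of `E` are the arcs of the concatenation that end on the outer
boundary (so that loops are removed), and the label of an arc is the minimum of the labels
of the arc fragments of `C` and `D` which comprise it. -/
def IsComposition {N : ℕ} (C D E : ArcDiagram N) : Prop :=
  (∀ u, Joined C D (outerNode u) (outerNode (E.mate u))) ∧
    ∀ u, IsLeast
      ({h | ∃ v, Joined C D (outerNode u) (firstNode v) ∧ h = C.height v} ∪
        {h | ∃ v, Joined C D (outerNode u) (secondNode v) ∧ h = D.height v})
      (E.height u)

/-- `D` is the composition `[G_{i_1} ∘ (G_{i_2} ∘ (... ∘ G_{i_l}))]` of elementary diagrams along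
the word `i_1 i_2 ... i_l`. -/
inductive IsWordDiagram {N : ℕ} : List (GenIdx N) → ArcDiagram N → Prop
  | nil : IsWordDiagram [] (ArcDiagram.id N)
  | cons (i : GenIdx N) (w : List (GenIdx N)) (D E : ArcDiagram N) :
      IsWordDiagram w D → IsComposition (ArcDiagram.elem i) D E → IsWordDiagram (i :: w) E

/-! ### The Okada algebra and its basis -/

section Algebra

variable (K : Type*) [Field K] (N : ℕ) (X Y : ℕ → K)

/-- The defining relations of the Okada algebra on the free algebra with generators
`E_1, ..., E_{N-1}`. Only the values `X i` for `1 ≤ i ≤ N - 1` and `Y i` for `1 ≤ i ≤ N - 2`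
are used. -/
inductive OkadaRel : FreeAlgebra K (GenIdx N) → FreeAlgebra K (GenIdx N) → Prop
  | idem (i : GenIdx N) :
      OkadaRel (FreeAlgebra.ι K i * FreeAlgebra.ι K i) (X i.1 • FreeAlgebra.ι K i)
  | comm (i j : GenIdx N) (h : i.1 + 2 ≤ j.1 ∨ j.1 + 2 ≤ i.1) :
      OkadaRel (FreeAlgebra.ι K i * FreeAlgebra.ι K j) (FreeAlgebra.ι K j * FreeAlgebra.ι K i)
  | succ (i j : GenIdx N) (h : j.1 = i.1 + 1) :
      OkadaRel (FreeAlgebra.ι K j * FreeAlgebra.ι K i * FreeAlgebra.ι K j)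
        (Y i.1 • FreeAlgebra.ι K j)

/-- The Okada algebra `O_N(X, Y)`. -/
abbrev OkadaAlgebra : Type _ := RingQuot (OkadaRel K N X Y)

end Algebra

/-- The entry of the code of `σ` at `i`: the number of `j < i` with `σ⁻¹ j > σ⁻¹ i`. -/
def codeAt {N : ℕ} (σ : Equiv.Perm (Fin N)) (i : Fin N) : ℕ :=
  (Finset.univ.filter fun j : Fin N => j < i ∧ σ⁻¹ i < σ⁻¹ j).card

theorem codeAt_le {N : ℕ} (σ : Equiv.Perm (Fin N)) (i : Fin N) : codeAt σ i ≤ i.val := by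
  calc codeAt σ i ≤ (Finset.Iio i).card := by
        apply Finset.card_le_card
        intro j hj
        simp only [Finset.mem_filter] at hj
        exact Finset.mem_Iio.2 hj.2.1
    _ = i.val := Fin.card_Iio i

/-- The factor `(i-1), (i-2), ..., (i-c_i)` of the word of `σ`; here `i : Fin N` has
number `i + 1`. -/
def codeBlock {N : ℕ} (σ : Equiv.Perm (Fin N)) (i : Fin N) : List (GenIdx N) :=
  List.ofFn fun t : Fin (codeAt σ i) =>
    (⟨i.val - t.val, by have := codeAt_le σ i; have := t.2; have := i.2; omega⟩ : GenIdx N)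

/-- The word `∏_{i=1}^N (i-1)(i-2)...(i-c_i)` of `σ`, where `(c_1, ..., c_N)` is the code of `σ`. -/
def permWord {N : ℕ} (σ : Equiv.Perm (Fin N)) : List (GenIdx N) :=
  (List.finRange N).flatMap (codeBlock σ)

/-- The element `E_σ` of the Okada algebra. -/
def permElt {K : Type*} [Field K] {N : ℕ} (X Y : ℕ → K) (σ : Equiv.Perm (Fin N)) :
    OkadaAlgebra K N X Y :=
  ((permWord σ).map fun i => RingQuot.mkAlgHom K (OkadaRel K N X Y) (FreeAlgebra.ι K i)).prod

open Classical in
/-- The element of `O_N(X, Y)` identified with the arc-diagram `D`: it is `E_σ`, where `σ` is the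
(unique) permutation for which the composition of elementary diagrams along the word of `σ`
is `D`. -/
noncomputable def diagramElt {K : Type*} [Field K] {N : ℕ} (X Y : ℕ → K) (D : ArcDiagram N) :
    OkadaAlgebra K N X Y :=
  if h : ∃ σ : Equiv.Perm (Fin N), IsWordDiagram (permWord σ) D then permElt X Y h.choose else 0

/-! ### Cellular algebras -/

/-- `(Λ, M, C, star)` is a cell datum, in the sense of Graham and Lehrer, of the
finite-dimensional associative unital algebra `A`. -/
structure IsCellDatum {K A Λ : Type*} [CommRing K] [Ring A] [Algebra K A] [PartialOrder Λ]
    (M : Λ → Type*) (C : ∀ S : Λ, M S → M S → A) (star : A →ₗ[K] A) : Prop where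
  finite_dimensional : Module.Finite K A
  finite_index : ∀ S, Finite (M S)
  injective : Function.Injective fun p : (Σ S : Λ, M S × M S) => C p.1 p.2.1 p.2.2
  linearIndependent : LinearIndependent K fun p : (Σ S : Λ, M S × M S) => C p.1 p.2.1 p.2.2
  span_eq_top :
    Submodule.span K (Set.range fun p : (Σ S : Λ, M S × M S) => C p.1 p.2.1 p.2.2) = ⊤
  star_mul : ∀ a b, star (a * b) = star b * star a
  star_star : ∀ a, star (star a) = a
  star_basis : ∀ (S : Λ) (L R : M S), star (C S L R) = C S R L
  mul_basis : ∀ (S : Λ) (a : A), ∃ r : M S → M S → K, ∀ L R : M S,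
    a * C S L R - ∑ᶠ L' : M S, r L' L • C S L' R ∈
      Submodule.span K {c : A | ∃ T : Λ, T < S ∧ ∃ P Q : M T, c = C T P Q}

end Okada

/-!
On the formal combinations of diagrams, let `E_i` join the left nodes `i` and `i + 1`, as in the
composition with the elementary diagram `G_i`, and multiply by a scalar read off the labels of the
two arcs at these nodes. This is a representation of the Okada algebra. If each letter of a word
lowers the sum of all the labels by `2`, then no scalar occurs and the product of the word sends the
identity diagram to the composition of the word. The words of the `E_σ` have this property, and
their letters can be recovered one by one from their compositions. Every diagram other than the
identity can be obtained in this way from one with a larger sum of labels: remove its first arc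
`{i, i + 1}` on the left and reconnect these nodes with the first arc beyond them whose label is at
most `i`. On the other hand the `E_σ` span the algebra, because the elements
`E_s E_{s - 1} ⋯ E_{s - c + 1}` with `c ≤ s` generate the subalgebra of `E_1, …, E_s` as a left
module over the subalgebra of `E_1, …, E_{s - 1}`. So the `E_σ` are a basis, indexed bijectively by
the diagrams.

Multiplication by `E_i` changes the left half of a diagram, and produces a scalar, in a way that
depends on the left half alone. It keeps the right half unless a propagating arc is lost or the
label of one decreases, and then the set of these labels becomes strictly smaller in dominance.
-/

namespace Okada

/-! ### Labelled matchings -/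

/-- A perfect matching of the points of `α`, given by the fixed-point-free involution `mate`,
with a label on each pair. It is an arc-diagram without its planarity and label conditions. -/
@[ext]
structure LabelledMatching (α : Type*) where
  mate : α → α
  height : α → ℕ
  mate_mate : ∀ u, mate (mate u) = u
  mate_ne : ∀ u, mate u ≠ u
  height_mate : ∀ u, height (mate u) = height u

namespace LabelledMatching

variable {α β : Type*} (M : LabelledMatching α)

theorem mate_involutive : Function.Involutive M.mate := M.mate_mate

theorem mate_injective : Function.Injective M.mate := M.mate_involutive.injective

/-- The matching transported along a bijection of the points. -/
def map (e : α ≃ β) : LabelledMatching β where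
  mate u := e (M.mate (e.symm u))
  height u := M.height (e.symm u)
  mate_mate u := by simp [M.mate_mate]
  mate_ne u h := M.mate_ne (e.symm u) (by simpa using congrArg e.symm h)
  height_mate u := by simp [M.height_mate]

variable [DecidableEq α] [DecidableEq β]

/-- The involution which matches `p` with `q` and `mate p` with `mate q`: the conjugate of `mate`
by the transposition of `q` and `mate p`. -/
def joinMate (p q u : α) : α :=
  Equiv.swap q (M.mate p) (M.mate (Equiv.swap q (M.mate p) u))

theorem joinMate_joinMate (p q u : α) : M.joinMate p q (M.joinMate p q u) = u := by
  simp [joinMate, M.mate_mate]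

theorem joinMate_cases {p q : α} (hpq : p ≠ q) (u : α) :
    (u = p ∧ M.joinMate p q u = q) ∨ (u = q ∧ M.joinMate p q u = p) ∨
      (u = M.mate p ∧ M.joinMate p q u = M.mate q) ∨
      (u = M.mate q ∧ M.joinMate p q u = M.mate p) ∨
      (u ≠ p ∧ u ≠ q ∧ u ≠ M.mate p ∧ u ≠ M.mate q ∧ M.joinMate p q u = M.mate u) := by
  rcases eq_or_ne u p with rfl | hup
  · exact .inl ⟨rfl, by
      rw [joinMate, Equiv.swap_apply_of_ne_of_ne hpq (M.mate_ne u).symm, Equiv.swap_apply_right]⟩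
  rcases eq_or_ne u q with rfl | huq
  · exact .inr (.inl ⟨rfl, by
      rw [joinMate, Equiv.swap_apply_left, M.mate_mate,
        Equiv.swap_apply_of_ne_of_ne hpq (M.mate_ne p).symm]⟩)
  rcases eq_or_ne u (M.mate p) with rfl | hup'
  · exact .inr (.inr (.inl ⟨rfl, by
      rw [joinMate, Equiv.swap_apply_right,
        Equiv.swap_apply_of_ne_of_ne (M.mate_ne q) (M.mate_injective.ne hpq.symm)]⟩))
  have hswap : Equiv.swap q (M.mate p) u = u := Equiv.swap_apply_of_ne_of_ne huq hup'
  rcases eq_or_ne u (M.mate q) with rfl | huq'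
  · exact .inr (.inr (.inr (.inl ⟨rfl, by
      rw [joinMate, hswap, M.mate_mate, Equiv.swap_apply_left]⟩)))
  · refine .inr (.inr (.inr (.inr ⟨hup, huq, hup', huq', ?_⟩)))
    rw [joinMate, hswap, Equiv.swap_apply_of_ne_of_ne _ (M.mate_injective.ne hup)]
    exact fun h => huq' (by rw [← h, M.mate_mate])

/-- Replace the pairs `{p, mate p}` and `{q, mate q}` by the pair `{p, q}` with label `k` and the
pair `{mate p, mate q}` with label `l`. If `q = mate p`, the result is one pair with label `k`. -/
def join (p q : α) (k l : ℕ) : LabelledMatching α where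
  mate := M.joinMate p q
  height u :=
    if u = p ∨ M.joinMate p q u = p then k
    else if u = M.mate p ∨ M.joinMate p q u = M.mate p then l
    else M.height u
  mate_mate := M.joinMate_joinMate p q
  mate_ne u h := M.mate_ne (Equiv.swap q (M.mate p) u)
    (by simpa [joinMate] using congrArg (Equiv.swap q (M.mate p)) h)
  height_mate u := by
    rcases eq_or_ne p q with rfl | hpq
    · simp only [joinMate, Equiv.swap_apply_def]
      grind [M.mate_mate, M.mate_ne, M.height_mate]
    · have hu := M.joinMate_joinMate p q u
      have hh := M.height_mate u
      have hc := M.joinMate_cases hpq u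
      grind

theorem join_cases {p q : α} (hpq : p ≠ q) (k l : ℕ) (u : α) :
    (u = p ∧ (M.join p q k l).mate u = q ∧ (M.join p q k l).height u = k) ∨
    (u = q ∧ (M.join p q k l).mate u = p ∧ (M.join p q k l).height u = k) ∨
    (u = M.mate p ∧ u ≠ q ∧ (M.join p q k l).mate u = M.mate q ∧
      (M.join p q k l).height u = l) ∨
    (u = M.mate q ∧ u ≠ p ∧ (M.join p q k l).mate u = M.mate p ∧
      (M.join p q k l).height u = l) ∨
    (u ≠ p ∧ u ≠ q ∧ u ≠ M.mate p ∧ u ≠ M.mate q ∧ (M.join p q k l).mate u = M.mate u ∧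
      (M.join p q k l).height u = M.height u) := by
  have hp := M.mate_mate p
  have hq := M.mate_mate q
  have hp' := M.mate_ne p
  have hq' := M.mate_ne q
  have hu' := M.mate_mate u
  simp only [join]
  rcases M.joinMate_cases hpq u with ⟨rfl, h⟩ | ⟨rfl, h⟩ | ⟨rfl, h⟩ | ⟨rfl, h⟩ | h <;>
    simp only [h] <;> grind

theorem join_mate_left {p q : α} (hpq : p ≠ q) (k l : ℕ) : (M.join p q k l).mate p = q := by
  have hp := M.mate_ne p
  have hc := M.join_cases hpq k l p
  grind

theorem join_height_left (p q : α) (k l : ℕ) : (M.join p q k l).height p = k := by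
  simp [join]

theorem join_comm {p q : α} (hpq : p ≠ q) (k l : ℕ) : M.join p q k l = M.join q p k l := by
  have hp' := M.mate_ne p
  have hq' := M.mate_ne q
  ext u <;> have c := M.join_cases hpq k l u <;> have c' := M.join_cases hpq.symm k l u <;> grind

theorem join_mate_mate {p q : α} (hpq : p ≠ q) (k : ℕ) :
    M.join (M.mate p) (M.mate q) k k = M.join p q k k := by
  have hp := M.mate_mate p
  have hq := M.mate_mate q
  have hp' := M.mate_ne p
  have hq' := M.mate_ne q
  ext u <;> have c := M.join_cases hpq k k u <;>
    have c' := M.join_cases (M.mate_injective.ne hpq) k k u <;> grind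

theorem join_join_mate {p q : α} (hpq : p ≠ q) (hq : q ≠ M.mate p) (k l : ℕ) :
    (M.join p q k l).join p (M.mate p) (M.height p) (M.height q) = M := by
  have hp := M.mate_mate p
  have hq := M.mate_mate q
  have hp' := M.mate_ne p
  have hq' := M.mate_ne q
  have hhp := M.height_mate p
  have hhq := M.height_mate q
  have cp := M.join_cases hpq k l p
  have cm := M.join_cases hpq k l (M.mate p)
  ext u <;> have c := M.join_cases hpq k l u <;>
    have c' := (M.join p q k l).join_cases hp'.symm (M.height p) (M.height q) u <;> grind

theorem join_eq_self (p : α) : M.join p (M.mate p) (M.height p) (M.height p) = M := by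
  have hp' := M.mate_ne p
  have hp := M.mate_mate p
  have hhp := M.height_mate p
  ext u <;> have c := M.join_cases hp'.symm (M.height p) (M.height p) u <;> grind

theorem map_join (e : α ≃ β) (p q : α) (k l : ℕ) :
    (M.join p q k l).map e = (M.map e).join (e p) (e q) k l := by
  have hmate (u : β) : (M.map e).joinMate (e p) (e q) u = e (M.joinMate p q (e.symm u)) := by
    simp [map, joinMate, e.injective.map_swap, e.symm.injective.map_swap]
  ext u
  · exact (hmate u).symm
  · simp only [join, hmate]
    simp [map, Equiv.symm_apply_eq]

/-- Composing fragments of arcs: after `p` and `q` are joined, the arc between their former mates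
gets the minimum of the former labels. -/
def joinMin (p q : α) (k : ℕ) : LabelledMatching α :=
  M.join p q k (min (M.height p) (M.height q))

theorem joinMin_comm {p q r s : α} (hpq : p ≠ q) (hrs : r ≠ s) (hpr : p ≠ r) (hps : p ≠ s)
    (hqr : q ≠ r) (hqs : q ≠ s) (k l : ℕ) :
    (M.joinMin p q k).joinMin r s l = (M.joinMin r s l).joinMin p q k := by
  have hh := M.height_mate
  have hm := M.mate_mate
  have hne := M.mate_ne
  have hpq_r := M.join_cases hpq k (min (M.height p) (M.height q)) r
  have hpq_s := M.join_cases hpq k (min (M.height p) (M.height q)) s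
  have hrs_p := M.join_cases hrs l (min (M.height r) (M.height s)) p
  have hrs_q := M.join_cases hrs l (min (M.height r) (M.height s)) q
  set A := M.joinMin p q k
  set B := M.joinMin r s l
  ext u <;>
  · have hpq_u := M.join_cases hpq k (min (M.height p) (M.height q)) u
    have hrs_u := M.join_cases hrs l (min (M.height r) (M.height s)) u
    have hA_u := A.join_cases hrs l (min (A.height r) (A.height s)) u
    have hB_u := B.join_cases hpq k (min (B.height p) (B.height q)) u
    rcases hA_u with h | h | h | h | h <;> rcases hB_u with h' | h' | h' | h' | h' <;>
      grind [joinMin]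

theorem joinMin_joinMin_self {p q : α} (hpq : p ≠ q) (k : ℕ) :
    (M.joinMin p q k).joinMin p q k = M.joinMin p q k := by
  set A := M.joinMin p q k
  have hmate : A.mate p = q := M.join_mate_left hpq ..
  have hp : A.height p = k := M.join_height_left ..
  have hq : A.height q = k := by rw [← hmate, A.height_mate, hp]
  rw [joinMin, hp, hq, min_self]
  simpa only [hmate, hp] using A.join_eq_self p

theorem joinMin_joinMin_of_mate {p q r : α} (hqr : M.mate q = r) (hpq : p ≠ q) (hpr : p ≠ r)
    {k : ℕ} (hk : M.height p ≤ k) (hq : M.height p ≤ M.height q) :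
    (M.joinMin p q k).joinMin q r (M.height q) = M := by
  subst hqr
  have hrestore := M.join_join_mate hpq.symm hpr k (min (M.height p) (M.height q))
  rw [← M.join_comm hpq] at hrestore
  have hcq := M.join_cases hpq k (min (M.height p) (M.height q)) q
  have hcr := M.join_cases hpq k (min (M.height p) (M.height q)) (M.mate q)
  have hne := M.mate_ne q
  grind [joinMin]

theorem map_joinMin (e : α ≃ β) (p q : α) (k : ℕ) :
    (M.joinMin p q k).map e = (M.map e).joinMin (e p) (e q) k := by
  rw [joinMin, map_join, joinMin]
  simp only [map, Equiv.symm_apply_apply]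

end LabelledMatching

/-! ### Planarity -/

section

variable {N : ℕ}

theorem Node.pos_injective : Function.Injective (Node.pos : Node N → ℕ) := by
  intro u v h
  have hu := Node.pos_cases u
  have hv := Node.pos_cases v
  apply Node.ext_abs <;> grind

theorem Node.pos_bounds (u : Node N) : 1 ≤ u.pos ∧ u.pos ≤ 2 * N ∧
    ((u.pos ≤ N ∧ u.abs = u.pos) ∨ (N < u.pos ∧ u.abs + u.pos = 2 * N + 1)) := by
  have := Node.pos_cases u
  omega

theorem Node.exists_pos_eq {k : ℕ} (h1 : 1 ≤ k) (h2 : k ≤ 2 * N) :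
    ∃ u : Node N, u.pos = k := by
  by_cases h : k ≤ N
  · exact ⟨Sum.inl ⟨k - 1, by omega⟩, by simp only [Node.pos]; omega⟩
  · exact ⟨Sum.inr ⟨2 * N - k, by omega⟩, by simp only [Node.pos]; omega⟩

/-- `w` lies strictly between `u` and `v` on the boundary, in either order. -/
def Node.Between (u v w : Node N) : Prop :=
  (u.pos < w.pos ∧ w.pos < v.pos) ∨ (v.pos < w.pos ∧ w.pos < u.pos)

theorem Node.Between.symm {u v w : Node N} (h : Node.Between u v w) : Node.Between v u w :=
  Or.symm h

theorem even_card_of_fixedPointFree_involution {α : Type*} (s : Finset α) (f : α → α)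
    (hmaps : ∀ v ∈ s, f v ∈ s) (hinv : ∀ v ∈ s, f (f v) = v) (hne : ∀ v ∈ s, f v ≠ v) :
    Even s.card := by
  have hsum : ∑ _v ∈ s, (1 : ZMod 2) = 0 :=
    Finset.sum_involution (fun v _ => f v) (fun _ _ => by decide) (fun v hv _ => hne v hv)
      hmaps hinv
  rw [Finset.sum_const, nsmul_eq_mul, mul_one] at hsum
  exact (ZMod.natCast_eq_zero_iff_even).1 hsum

namespace LabelledMatching

variable {M : LabelledMatching (Node N)} {u v w p q : Node N} {k l : ℕ}

/-- The arc at `u` covers `w`: the node `w` lies strictly between the ends of that arc. -/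
def Covers (M : LabelledMatching (Node N)) (u w : Node N) : Prop :=
  Node.Between u (M.mate u) w

/-- No two arcs cross: an arc which covers a node covers both ends of the arc of that node. -/
def Noncrossing (M : LabelledMatching (Node N)) : Prop :=
  ∀ u w, M.Covers u w → M.Covers u (M.mate w)

theorem Noncrossing.covers_mate_iff (hM : M.Noncrossing) :
    M.Covers u (M.mate w) ↔ M.Covers u w :=
  ⟨fun h => by simpa only [M.mate_mate] using hM u _ h, hM u w⟩

theorem covers_mate_left_iff : M.Covers (M.mate u) w ↔ M.Covers u w := by
  simp only [Covers, Node.Between, M.mate_mate]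
  omega

theorem even_card_of_mate_closed (M : LabelledMatching (Node N)) {s t : ℕ} (hst : s < t)
    (ht : t ≤ 2 * N + 1)
    (h : ∀ u, s < u.pos → u.pos < t → s < (M.mate u).pos ∧ (M.mate u).pos < t) :
    (s + t) % 2 = 1 := by
  set S := Finset.univ.filter fun v : Node N => s < v.pos ∧ v.pos < t with hS
  have hmem (v : Node N) : v ∈ S ↔ s < v.pos ∧ v.pos < t := by simp [hS]
  have heven : Even S.card :=
    even_card_of_fixedPointFree_involution S M.mate
      (fun v hv => (hmem _).2 (h v ((hmem v).1 hv).1 ((hmem v).1 hv).2))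
      (fun v _ => M.mate_mate v) (fun v _ => M.mate_ne v)
  have himage : S.image Node.pos = Finset.Ioo s t := by
    ext k
    simp only [Finset.mem_image, hmem, Finset.mem_Ioo]
    refine ⟨fun ⟨_, hv, hk⟩ => hk ▸ hv, fun hk => ?_⟩
    obtain ⟨v, rfl⟩ := Node.exists_pos_eq (N := N) (k := k) (by omega) (by omega)
    exact ⟨v, hk, rfl⟩
  have hcard : S.card = t - s - 1 := by
    rw [← Nat.card_Ioo, ← himage, Finset.card_image_of_injective S Node.pos_injective]
  have := Nat.even_iff.1 heven
  omega

theorem Noncrossing.odd_pos_add_pos_mate (hM : M.Noncrossing) (u : Node N) :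
    (u.pos + (M.mate u).pos) % 2 = 1 := by
  wlog h : u.pos < (M.mate u).pos generalizing u
  · have := this (M.mate u)
    have := Node.pos_injective.ne (M.mate_ne u)
    rw [M.mate_mate] at *
    omega
  refine M.even_card_of_mate_closed h (by have := Node.pos_bounds (M.mate u); omega) ?_
  intro v h1 h2
  have := hM u v (.inl ⟨h1, h2⟩)
  simp only [Covers, Node.Between] at this
  omega

theorem pos_ne_of_ne_arc (M : LabelledMatching (Node N)) (h : u ≠ v) (h' : u ≠ M.mate v) :
    u.pos ≠ v.pos ∧ u.pos ≠ (M.mate v).pos ∧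
      (M.mate u).pos ≠ v.pos ∧ (M.mate u).pos ≠ (M.mate v).pos :=
  ⟨Node.pos_injective.ne h, Node.pos_injective.ne h',
    Node.pos_injective.ne fun e => h' (by rw [← e, M.mate_mate]),
    Node.pos_injective.ne (M.mate_injective.ne h)⟩

theorem covers_iff_of_between_iff (hp : u ≠ p) (hp' : u ≠ M.mate p) (hq : u ≠ q)
    (hq' : u ≠ M.mate q) (h : Node.Between p q u ↔ Node.Between p q (M.mate u)) :
    M.Covers u p ↔ M.Covers u q := by
  have := M.pos_ne_of_ne_arc hp hp'
  have := M.pos_ne_of_ne_arc hq hq'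
  simp only [Covers, Node.Between] at *
  omega

theorem between_mate_iff (hp : w ≠ p) (hp' : w ≠ M.mate p) (hq : w ≠ q) (hq' : w ≠ M.mate q) :
    Node.Between (M.mate p) (M.mate q) w ↔
      ((M.Covers p w ↔ M.Covers q w) ↔ Node.Between p q w) := by
  have := M.pos_ne_of_ne_arc hp hp'
  have := M.pos_ne_of_ne_arc hq hq'
  simp only [Covers, Node.Between] at *
  omega

theorem Noncrossing.between_mate_join (hM : M.Noncrossing) (hpq : p ≠ q)
    (hseg : ∀ w, Node.Between p q ((M.join p q k l).mate w) ↔ Node.Between p q w)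
    (h : Node.Between (M.mate p) (M.mate q) w) :
    Node.Between (M.mate p) (M.mate q) ((M.join p q k l).mate w) := by
  rcases eq_or_ne q (M.mate p) with rfl | hqp
  · rw [M.mate_mate] at h ⊢
    exact ((hseg w).2 h.symm).symm
  have hends : Node.Between p q (M.mate q) ↔ Node.Between p q (M.mate p) := by
    have hmp := hseg (M.mate p)
    have hc := M.join_cases hpq k l (M.mate p)
    have := M.mate_ne p
    grind [M.mate_injective.ne hpq]
  have hpos := M.pos_ne_of_ne_arc hpq.symm hqp
  have hp := Node.pos_injective.ne (M.mate_ne p)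
  have hq := Node.pos_injective.ne (M.mate_ne q)
  rcases M.join_cases hpq k l w with ⟨rfl, e, -⟩ | ⟨rfl, e, -⟩ | ⟨rfl, -⟩ | ⟨rfl, -⟩ |
    ⟨hwp, hwq, hwp', hwq', e, -⟩
  · rw [e]
    simp only [Node.Between] at *
    omega
  · rw [e]
    simp only [Node.Between] at *
    omega
  · simp only [Node.Between] at h
    omega
  · simp only [Node.Between] at h
    omega
  · have hsegw := hseg w
    rw [e] at hsegw ⊢
    have hinv := M.mate_involutive
    rw [between_mate_iff hwp hwp' hwq hwq'] at h
    rwa [between_mate_iff (mt hinv.eq_iff.1 hwp') (M.mate_injective.ne hwp) (mt hinv.eq_iff.1 hwq')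
      (M.mate_injective.ne hwq), hM.covers_mate_iff, hM.covers_mate_iff, hsegw]

theorem Noncrossing.join (hM : M.Noncrossing) (hpq : p ≠ q)
    (hseg : ∀ w, Node.Between p q w → Node.Between p q ((M.join p q k l).mate w)) :
    (M.join p q k l).Noncrossing := by
  have hseg' (w) : Node.Between p q ((M.join p q k l).mate w) ↔ Node.Between p q w :=
    ⟨fun h => by simpa only [mate_mate] using hseg _ h, hseg w⟩
  have hbetween := fun w => hM.between_mate_join (w := w) hpq hseg'
  intro u w h
  rw [Covers] at h ⊢
  rcases M.join_cases hpq k l u with ⟨rfl, e, -⟩ | ⟨rfl, e, -⟩ | ⟨rfl, -, e, -⟩ | ⟨rfl, -, e, -⟩ |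
    ⟨hup, huq, hup', huq', e, -⟩ <;> rw [e] at h ⊢
  · exact hseg w h
  · exact (hseg w h.symm).symm
  · exact hbetween w h
  · exact (hbetween w h.symm).symm
  · have hsegu := hseg' u
    rw [e] at hsegu
    have hiff := covers_iff_of_between_iff hup hup' huq huq' hsegu.symm
    have hcov := fun w => hM.covers_mate_iff (u := u) (w := w)
    have hw := M.join_cases hpq k l w
    simp only [Covers] at hiff hcov
    grind

end LabelledMatching

end

/-! ### Okada labellings and the action of the generators on diagrams -/

section

variable {N : ℕ}

namespace LabelledMatching

variable {M : LabelledMatching (Node N)} {u v w p q : Node N} {k l : ℕ}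

/-- The conditions on a labelled matching of the boundary to be an Okada arc-diagram. As the ends
of an arc have positions of different parity, the parity of the label can be compared with the
smaller position instead of the smaller absolute value. -/
structure IsOkada (M : LabelledMatching (Node N)) : Prop where
  noncrossing : M.Noncrossing
  one_le_height : ∀ u, 1 ≤ M.height u
  height_le_abs : ∀ u, M.height u ≤ u.abs
  height_parity : ∀ u, M.height u % 2 = min u.pos (M.mate u).pos % 2
  height_lt : ∀ u w, M.Covers u w → M.height u < M.height w

namespace IsOkada

theorem height_le_pos (hM : M.IsOkada) (u : Node N) : M.height u ≤ u.pos := by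
  have := hM.height_le_abs u
  have := u.pos_bounds
  omega

theorem height_lt_pos_of_covers (hM : M.IsOkada) (h : M.Covers u w) : M.height u < w.pos := by
  have hu := hM.height_le_pos u
  have hu' := hM.height_le_pos (M.mate u)
  rw [M.height_mate] at hu'
  rw [Covers, Node.Between] at h
  omega

theorem min_height_lt_of_between (hM : M.IsOkada) (hadj : q.pos = p.pos + 1) (hpw : w ≠ p)
    (hqw : w ≠ q) (h : Node.Between (M.mate p) (M.mate q) w) :
    min (M.height p) (M.height q) < M.height w := by
  have hpw' : w ≠ M.mate p := by rintro rfl; simp only [Node.Between] at h; omega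
  have hqw' : w ≠ M.mate q := by rintro rfl; simp only [Node.Between] at h; omega
  have hnot : ¬ Node.Between p q w := by simp only [Node.Between]; omega
  rw [between_mate_iff hpw hpw' hqw hqw', iff_false_right hnot] at h
  rcases em (M.Covers p w) with hp | hp
  · exact min_lt_of_left_lt (hM.height_lt p w hp)
  · exact min_lt_of_right_lt (hM.height_lt q w (by grind))

theorem min_height_lt_pos (hM : M.IsOkada) (h : Node.Between (M.mate p) (M.mate q) w) :
    min (M.height p) (M.height q) < w.pos := by
  have hp := hM.height_le_pos (M.mate p)
  have hq := hM.height_le_pos (M.mate q)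
  rw [M.height_mate] at hp hq
  rw [Node.Between] at h
  omega

theorem adjacent_arcs_cases (hM : M.IsOkada) (hadj : q.pos = p.pos + 1) (hqp : q ≠ M.mate p) :
    ((M.mate q).pos < (M.mate p).pos ∧ (M.mate p).pos < p.pos ∧ M.height q < M.height p) ∨
    (q.pos < (M.mate q).pos ∧ (M.mate q).pos < (M.mate p).pos ∧ M.height p < M.height q) ∨
    ((M.mate p).pos < p.pos ∧ q.pos < (M.mate q).pos) := by
  have hpos := M.pos_ne_of_ne_arc (by rintro rfl; omega) hqp
  have hcov := hM.noncrossing.covers_mate_iff (u := p) (w := q)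
  have hcov' := hM.noncrossing.covers_mate_iff (u := q) (w := p)
  have hlt := hM.height_lt p q
  have hlt' := hM.height_lt q p
  have hne := Node.pos_injective.ne (M.mate_ne p)
  have hne' := Node.pos_injective.ne (M.mate_ne q)
  simp only [Covers, Node.Between] at hcov hcov' hlt hlt'
  omega

theorem min_height_parity (hM : M.IsOkada) (hadj : q.pos = p.pos + 1) (hqp : q ≠ M.mate p) :
    min (M.height p) (M.height q) % 2 = min (M.mate p).pos (M.mate q).pos % 2 := by
  have hp := hM.height_parity p
  have hq := hM.height_parity q
  have hp' := hM.noncrossing.odd_pos_add_pos_mate p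
  have hq' := hM.noncrossing.odd_pos_add_pos_mate q
  rcases hM.adjacent_arcs_cases hadj hqp with h | h | h <;> omega

theorem max_height_parity (hM : M.IsOkada) (hadj : q.pos = p.pos + 1) (hqp : q ≠ M.mate p) :
    max (M.height p) (M.height q) % 2 = q.pos % 2 := by
  have hp := hM.height_parity p
  have hq := hM.height_parity q
  have hp' := hM.noncrossing.odd_pos_add_pos_mate p
  have hq' := hM.noncrossing.odd_pos_add_pos_mate q
  rcases hM.adjacent_arcs_cases hadj hqp with h | h | h <;> omega

theorem height_lt_joinMin_height (hM : M.IsOkada) (hadj : q.pos = p.pos + 1) (hup : u ≠ p)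
    (huq : u ≠ q) (hup' : u ≠ M.mate p) (huq' : u ≠ M.mate q) (h : M.Covers u w) :
    M.height u < (M.joinMin p q p.pos).height w := by
  have hpq : p ≠ q := by rintro rfl; omega
  have hiff : M.Covers u p ↔ M.Covers u q :=
    covers_iff_of_between_iff hup hup' huq huq' (by simp only [Node.Between]; omega)
  have hmin (h : M.Covers u p) : M.height u < min (M.height p) (M.height q) :=
    lt_min (hM.height_lt u p h) (hM.height_lt u q (hiff.1 h))
  rw [LabelledMatching.joinMin]
  rcases M.join_cases hpq p.pos (min (M.height p) (M.height q)) w with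
    ⟨rfl, -, e⟩ | ⟨rfl, -, e⟩ | ⟨rfl, -, -, e⟩ | ⟨rfl, -, -, e⟩ | ⟨-, -, -, -, -, e⟩ <;> rw [e]
  · exact hM.height_lt_pos_of_covers h
  · exact hM.height_lt_pos_of_covers (hiff.2 h)
  · exact hmin (hM.noncrossing.covers_mate_iff.1 h)
  · exact hmin (hiff.2 (hM.noncrossing.covers_mate_iff.1 h))
  · exact hM.height_lt u w h

theorem min_height_lt_joinMin_height (hM : M.IsOkada) (hadj : q.pos = p.pos + 1)
    (h : Node.Between (M.mate p) (M.mate q) w) :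
    min (M.height p) (M.height q) < (M.joinMin p q p.pos).height w := by
  have hpq : p ≠ q := by rintro rfl; omega
  rw [LabelledMatching.joinMin]
  rcases M.join_cases hpq p.pos (min (M.height p) (M.height q)) w with
    ⟨rfl, -, e⟩ | ⟨rfl, -, e⟩ | ⟨rfl, -⟩ | ⟨rfl, -⟩ | ⟨hwp, hwq, -, -, -, e⟩
  · rw [e]
    exact hM.min_height_lt_pos h
  · have hp := Node.pos_injective.ne (M.mate_ne p)
    have hp' : (M.mate w).pos ≠ p.pos := Node.pos_injective.ne fun e => by
      rw [← e, M.mate_mate, Node.Between] at h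
      omega
    rw [e]
    refine hM.min_height_lt_pos ?_
    simp only [Node.Between] at h ⊢
    omega
  · simp only [Node.Between] at h
    omega
  · simp only [Node.Between] at h
    omega
  · rw [e]
    exact hM.min_height_lt_of_between hadj hwp hwq h

theorem joinMin_height_lt (hM : M.IsOkada) (hadj : q.pos = p.pos + 1)
    (h : (M.joinMin p q p.pos).Covers u w) :
    (M.joinMin p q p.pos).height u < (M.joinMin p q p.pos).height w := by
  have hpq : p ≠ q := by rintro rfl; omega
  have hnot (w : Node N) : ¬ Node.Between p q w := by simp only [Node.Between]; omega
  have hcases := M.join_cases hpq p.pos (min (M.height p) (M.height q)) u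
  rw [← LabelledMatching.joinMin] at hcases
  rw [Covers] at h
  rcases hcases with ⟨rfl, e, -⟩ | ⟨rfl, e, -⟩ | ⟨rfl, -, e, e'⟩ | ⟨rfl, -, e, e'⟩ |
    ⟨hup, huq, hup', huq', e, e'⟩ <;> rw [e] at h
  · exact absurd h (hnot w)
  · exact absurd h.symm (hnot w)
  · rw [e']
    exact hM.min_height_lt_joinMin_height hadj h
  · rw [e']
    exact hM.min_height_lt_joinMin_height hadj h.symm
  · rw [e']
    exact hM.height_lt_joinMin_height hadj hup huq hup' huq' h

theorem joinMin (hM : M.IsOkada) (hadj : q.pos = p.pos + 1) (hq : q.pos ≤ N) :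
    (M.joinMin p q p.pos).IsOkada where
  noncrossing := hM.noncrossing.join (by rintro rfl; omega) fun w h => by
    simp only [Node.Between] at h
    omega
  one_le_height u := by
    have := p.pos_bounds
    have := hM.one_le_height p
    have := hM.one_le_height q
    have := hM.one_le_height u
    have := M.join_cases (p := p) (q := q) (by rintro rfl; omega) p.pos
      (min (M.height p) (M.height q)) u
    simp only [LabelledMatching.joinMin]
    omega
  height_le_abs u := by
    have := p.pos_bounds
    have := q.pos_bounds
    have hmp := hM.height_le_abs (M.mate p)
    have hmq := hM.height_le_abs (M.mate q)
    rw [M.height_mate] at hmp hmq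
    have := hM.height_le_abs u
    rw [LabelledMatching.joinMin]
    rcases M.join_cases (p := p) (q := q) (by rintro rfl; omega) p.pos
      (min (M.height p) (M.height q)) u with
      ⟨rfl, -, e⟩ | ⟨rfl, -, e⟩ | ⟨rfl, -, -, e⟩ | ⟨rfl, -, -, e⟩ | ⟨-, -, -, -, -, e⟩ <;>
    rw [e] <;> omega
  height_parity u := by
    rw [LabelledMatching.joinMin]
    rcases M.join_cases (p := p) (q := q) (by rintro rfl; omega) p.pos
      (min (M.height p) (M.height q)) u with
      ⟨rfl, e, e'⟩ | ⟨rfl, e, e'⟩ | ⟨rfl, h, e, e'⟩ | ⟨rfl, h, e, e'⟩ | ⟨-, -, -, -, e, e'⟩ <;>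
    rw [e, e']
    · omega
    · omega
    · exact hM.min_height_parity hadj h.symm
    · rw [min_comm (M.mate q).pos]
      exact hM.min_height_parity hadj fun e => h (by rw [e, M.mate_mate])
    · exact hM.height_parity u
  height_lt _ _ := hM.joinMin_height_lt hadj

end IsOkada

end LabelledMatching

/-- The left node with number `i`. -/
def GenIdx.lo (i : GenIdx N) : Node N := Sum.inl ⟨i.1 - 1, by have := i.2; omega⟩

/-- The left node with number `i + 1`. -/
def GenIdx.hi (i : GenIdx N) : Node N := Sum.inl ⟨i.1, i.2.2⟩

theorem GenIdx.pos_lo (i : GenIdx N) : i.lo.pos = i.1 := by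
  have := i.2
  simp only [GenIdx.lo, Node.pos]
  omega

theorem GenIdx.pos_hi (i : GenIdx N) : i.hi.pos = i.1 + 1 := by
  simp only [GenIdx.hi, Node.pos]

theorem GenIdx.lo_ne_hi (i : GenIdx N) : i.lo ≠ i.hi := fun e => by
  have := congrArg Node.pos e
  rw [GenIdx.pos_lo, GenIdx.pos_hi] at this
  omega

namespace ArcDiagram

open LabelledMatching

/-- The labelled matching underlying an arc-diagram. -/
def toMatching (D : ArcDiagram N) : LabelledMatching (Node N) where
  mate := D.mate
  height := D.height
  mate_mate := D.mate_mate
  mate_ne := D.mate_ne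
  height_mate := D.height_mate

theorem toMatching_injective :
    Function.Injective (toMatching : ArcDiagram N → LabelledMatching (Node N)) := fun _ _ h =>
  ArcDiagram.ext (congrArg LabelledMatching.mate h) (congrArg LabelledMatching.height h)

theorem noncrossing_toMatching (D : ArcDiagram N) : D.toMatching.Noncrossing := by
  intro u w h
  wlog hu : u.pos < (D.mate u).pos generalizing u with H
  · have := Node.pos_injective.ne (D.mate_ne u)
    have := H (D.mate u) (covers_mate_left_iff.2 h) (by rw [D.mate_mate]; omega)
    exact covers_mate_left_iff.1 this
  have hne : (D.mate w).pos ≠ u.pos := Node.pos_injective.ne fun e => by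
    rw [← e] at h
    simp only [Covers, Node.Between, toMatching, D.mate_mate] at h
    omega
  have hne' : (D.mate w).pos ≠ (D.mate u).pos := Node.pos_injective.ne fun e => by
    rw [D.toMatching.mate_injective e] at h
    simp only [Covers, Node.Between] at h
    omega
  have h1 := D.noncrossing u w
  have h2 := D.noncrossing (D.mate w) u
  rw [D.mate_mate] at h2
  simp only [Covers, Node.Between, toMatching] at h ⊢
  omega

theorem isOkada_toMatching (D : ArcDiagram N) : D.toMatching.IsOkada where
  noncrossing := D.noncrossing_toMatching
  one_le_height := D.one_le_height
  height_le_abs u := (D.height_le u).trans (min_le_left _ _)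
  height_parity u := by
    have := D.height_parity u
    have := u.pos_bounds
    have := (D.mate u).pos_bounds
    have := D.noncrossing_toMatching.odd_pos_add_pos_mate u
    simp only [toMatching] at *
    omega
  height_lt u w h := by
    wlog hu : u.pos < (D.mate u).pos generalizing u with H
    · have := Node.pos_injective.ne (D.mate_ne u)
      have := H (D.mate u) (covers_mate_left_iff.2 h) (by rw [D.mate_mate]; omega)
      exact (D.height_mate u).symm.trans_lt this
    wlog hw : w.pos < (D.mate w).pos generalizing w with H
    · have := Node.pos_injective.ne (D.mate_ne w)
      have := H (D.mate w) (D.noncrossing_toMatching u w h) (by rw [D.mate_mate]; omega)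
      exact this.trans_eq (D.height_mate w)
    have h' := D.noncrossing_toMatching u w h
    simp only [Covers, Node.Between, toMatching] at h h'
    exact D.height_nested w u (by omega) hw (by omega)

/-- The arc-diagram with a given underlying labelled matching. -/
def ofMatching (M : LabelledMatching (Node N)) (hM : M.IsOkada) : ArcDiagram N where
  mate := M.mate
  height := M.height
  mate_mate := M.mate_mate
  mate_ne := M.mate_ne
  noncrossing u v h := by
    have := hM.noncrossing u v (.inl ⟨h.1, h.2.1⟩)
    simp only [Covers, Node.Between] at this
    omega
  height_mate := M.height_mate
  one_le_height := hM.one_le_height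
  height_le u := le_min (hM.height_le_abs u) (M.height_mate u ▸ hM.height_le_abs (M.mate u))
  height_parity u := by
    have := hM.height_parity u
    have := u.pos_bounds
    have := (M.mate u).pos_bounds
    have := hM.noncrossing.odd_pos_add_pos_mate u
    omega
  height_nested u v h1 h2 h3 := hM.height_lt v u (.inl ⟨h1, h2.trans h3⟩)

/-- The composition of the elementary diagram `G_i` and the diagram `D`, obtained by joining the
left nodes `i` and `i + 1` of `D`. -/
def act (i : GenIdx N) (D : ArcDiagram N) : ArcDiagram N :=
  ofMatching (D.toMatching.joinMin i.lo i.hi i.1) <| by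
    rw [← i.pos_lo]
    exact D.isOkada_toMatching.joinMin (by rw [i.pos_lo, i.pos_hi])
      (by have := i.2; rw [i.pos_hi]; omega)

theorem toMatching_act (i : GenIdx N) (D : ArcDiagram N) :
    (act i D).toMatching = D.toMatching.joinMin i.lo i.hi i.1 := rfl

end ArcDiagram

end

/-! ### Composition with an elementary diagram -/

section

variable {N : ℕ}

theorem Joined.symm {C D : ArcDiagram N} {x y : CNode N} (h : Joined C D x y) : Joined C D y x := by
  have : Std.Symm (ArcStep C D) := by
    constructor
    rintro p q (⟨u, rfl, rfl⟩ | ⟨u, rfl, rfl⟩)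
    · exact Or.inl ⟨C.mate u, rfl, by rw [C.mate_mate]⟩
    · exact Or.inr ⟨D.mate u, rfl, by rw [D.mate_mate]⟩
  exact Relation.ReflTransGen.stdSymm.symm _ _ h

namespace ArcDiagram

theorem mate_involutive (D : ArcDiagram N) : Function.Involutive D.mate := D.mate_mate

variable (i : GenIdx N) (C D : ArcDiagram N) {u v : Node N} {x : CNode N}

theorem act_cases (u : Node N) :
    (u = i.lo ∧ (act i D).mate u = i.hi ∧ (act i D).height u = i.1) ∨
    (u = i.hi ∧ (act i D).mate u = i.lo ∧ (act i D).height u = i.1) ∨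
    (u = D.mate i.lo ∧ u ≠ i.hi ∧ (act i D).mate u = D.mate i.hi ∧
      (act i D).height u = min (D.height i.lo) (D.height i.hi)) ∨
    (u = D.mate i.hi ∧ u ≠ i.lo ∧ (act i D).mate u = D.mate i.lo ∧
      (act i D).height u = min (D.height i.lo) (D.height i.hi)) ∨
    (u ≠ i.lo ∧ u ≠ i.hi ∧ u ≠ D.mate i.lo ∧ u ≠ D.mate i.hi ∧
      (act i D).mate u = D.mate u ∧ (act i D).height u = D.height u) :=
  D.toMatching.join_cases i.lo_ne_hi i.1 (min (D.height i.lo) (D.height i.hi)) u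

theorem elem_mate_lo : (elem i).mate i.lo = i.hi := by
  have hi : i.1 - 1 + 1 = i.1 := by have := i.2; omega
  simp [elem, elemMate, GenIdx.lo, GenIdx.hi, elemSwap, hi]

theorem elem_mate_hi : (elem i).mate i.hi = i.lo := by
  rw [← elem_mate_lo, (elem i).mate_mate]

theorem elem_mate_swap (u : Node N) : (elem i).mate u.swap = ((elem i).mate u).swap := by
  rcases u with u | u <;> simp only [elem, elemMate, Sum.swap_inl, Sum.swap_inr] <;>
    split_ifs <;> rfl

variable {i} in
theorem elem_mate_inl {a : Fin N} (hlo : Sum.inl a ≠ i.lo) (hhi : Sum.inl a ≠ i.hi) :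
    (elem i).mate (Sum.inl a) = Sum.inr a := by
  have hlo' : a.val + 1 ≠ i.1 := fun e => hlo (by simp [GenIdx.lo, Fin.ext_iff]; omega)
  have hhi' : a.val ≠ i.1 := fun e => hhi (by simp [GenIdx.hi, Fin.ext_iff]; omega)
  simp [elem, elemMate, hlo', hhi']

theorem elem_height_lo : (elem i).height i.lo = i.1 := by
  have hi : i.1 - 1 + 1 = i.1 := by have := i.2; omega
  simp [elem, GenIdx.lo, Node.abs, hi]

theorem elem_height_hi : (elem i).height i.hi = i.1 := if_pos rfl

theorem elem_height_of_ne_hi {a : Fin N} (h : Sum.inl a ≠ i.hi) :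
    (elem i).height (Sum.inl a) = a.val + 1 := by
  refine if_neg fun e => h (Node.pos_injective ?_)
  rw [i.pos_hi, ← e]
  rfl

theorem joined_firstNode_mate (u : Node N) :
    Joined C D (firstNode u) (firstNode (C.mate u)) :=
  .single (.inl ⟨u, rfl, rfl⟩)

theorem joined_secondNode_mate (u : Node N) :
    Joined C D (secondNode u) (secondNode (D.mate u)) :=
  .single (.inr ⟨u, rfl, rfl⟩)

variable {i} in
theorem joined_outerNode_secondNode (hlo : u ≠ i.lo) (hhi : u ≠ i.hi) :
    Joined (elem i) D (outerNode u) (secondNode u) := by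
  rcases u with a | a
  · refine .single (.inl ⟨Sum.inl a, rfl, ?_⟩)
    rw [elem_mate_inl hlo hhi]
    rfl
  · exact .refl

theorem joined_lo_hi : Joined (elem i) D (secondNode i.lo) (secondNode i.hi) := by
  have := joined_firstNode_mate (elem i) D i.lo.swap
  rwa [elem_mate_swap, elem_mate_lo] at this

variable {i D} in
theorem joined_mate_lo (h : D.mate i.lo ≠ i.hi) :
    Joined (elem i) D (outerNode (D.mate i.lo)) (secondNode i.lo) :=
  (joined_outerNode_secondNode D (D.mate_ne _) h).trans (joined_secondNode_mate _ D _).symm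

variable {i D} in
theorem joined_mate_hi (h : D.mate i.hi ≠ i.lo) :
    Joined (elem i) D (outerNode (D.mate i.hi)) (secondNode i.hi) :=
  (joined_outerNode_secondNode D h (D.mate_ne _)).trans (joined_secondNode_mate _ D _).symm

theorem joined_act_mate (u : Node N) :
    Joined (elem i) D (outerNode u) (outerNode ((act i D).mate u)) := by
  have hlohi : Joined (elem i) D (outerNode i.lo) (outerNode i.hi) := by
    have := joined_firstNode_mate (elem i) D i.lo
    rwa [elem_mate_lo] at this
  have hmates (h : D.mate i.lo ≠ i.hi) :
      Joined (elem i) D (outerNode (D.mate i.lo)) (outerNode (D.mate i.hi)) :=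
    (joined_mate_lo h).trans ((joined_lo_hi i D).trans
      (joined_mate_hi (mt D.mate_involutive.eq_iff.1 h.symm)).symm)
  rcases act_cases i D u with ⟨rfl, e, -⟩ | ⟨rfl, e, -⟩ | ⟨rfl, h, e, -⟩ | ⟨rfl, h, e, -⟩ |
    ⟨hlo, hhi, hlo', hhi', e, -⟩ <;> rw [e]
  · exact hlohi
  · exact hlohi.symm
  · exact hmates h
  · exact (hmates (mt D.mate_involutive.eq_iff.1 h.symm)).symm
  · exact (joined_outerNode_secondNode D hlo hhi).trans ((joined_secondNode_mate _ D u).trans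
      (joined_outerNode_secondNode D (mt D.mate_involutive.eq_iff.1 hlo')
        (mt D.mate_involutive.eq_iff.1 hhi')).symm)

/-- The ends of the arc of `[G_i ∘ D]` through the node `u` of `D`; there are none if `u` lies on
a loop. -/
def strandEnds (u : Node N) : Set (Node N) :=
  if u = i.lo ∨ u = i.hi then if D.mate i.lo = i.hi then ∅ else {D.mate i.lo, D.mate i.hi}
  else {u, (act i D).mate u}

/-- The ends of the arc of `[G_i ∘ D]` through a node of the concatenation. -/
def concatEnds (x : CNode N) : Set (Node N) :=
  if x.1 = 0 then {Sum.inl x.2, (act i D).mate (Sum.inl x.2)}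
  else strandEnds i D (if x.1 = 1 then Sum.inl x.2 else Sum.inr x.2)

theorem strandEnds_inr (a : Fin N) :
    strandEnds i D (Sum.inr a) = {Sum.inr a, (act i D).mate (Sum.inr a)} :=
  if_neg (by simp [GenIdx.lo, GenIdx.hi])

theorem concatEnds_outerNode (u : Node N) :
    concatEnds i D (outerNode u) = {u, (act i D).mate u} := by
  cases u
  · rfl
  · exact strandEnds_inr i D _

theorem concatEnds_secondNode (u : Node N) : concatEnds i D (secondNode u) = strandEnds i D u := by
  cases u <;> rfl

theorem strandEnds_lo : strandEnds i D i.lo = strandEnds i D i.hi := by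
  simp [strandEnds]

theorem strandEnds_mate (u : Node N) : strandEnds i D (D.mate u) = strandEnds i D u := by
  have hlo : strandEnds i D (D.mate i.lo) = strandEnds i D i.lo := by
    by_cases h : D.mate i.lo = i.hi
    · rw [h, strandEnds_lo]
    · have hact := act_cases i D (D.mate i.lo)
      have := D.mate_ne i.lo
      simp only [strandEnds, this, h, or_self, if_false, true_or, if_true]
      grind
  have hhi : strandEnds i D (D.mate i.hi) = strandEnds i D i.hi := by
    by_cases h : D.mate i.hi = i.lo
    · rw [h, strandEnds_lo]
    · have hact := act_cases i D (D.mate i.hi)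
      have := D.mate_ne i.hi
      simp only [strandEnds, this, h, mt D.mate_involutive.eq_iff.1 (Ne.symm h), or_self, if_false,
        or_true, if_true]
      grind [Set.pair_comm]
  rcases act_cases i D u with ⟨rfl, -⟩ | ⟨rfl, -⟩ | ⟨rfl, -⟩ | ⟨rfl, -⟩ |
    ⟨hulo, huhi, hulo', huhi', e, -⟩
  · exact hlo
  · exact hhi
  · rw [D.mate_mate, hlo]
  · rw [D.mate_mate, hhi]
  · have e' : (act i D).mate (D.mate u) = u := by rw [← e, (act i D).mate_mate]
    have h1 : D.mate u ≠ i.lo := mt D.mate_involutive.eq_iff.1 hulo'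
    have h2 : D.mate u ≠ i.hi := mt D.mate_involutive.eq_iff.1 huhi'
    simp only [strandEnds, hulo, huhi, h1, h2, or_self, if_false, e, e']
    exact Set.pair_comm _ _

theorem concatEnds_firstNode_elem_mate (u : Node N) :
    concatEnds i D (firstNode ((elem i).mate u)) = concatEnds i D (firstNode u) := by
  have houter : concatEnds i D (firstNode i.hi) = concatEnds i D (firstNode i.lo) := by
    have hlo : (act i D).mate i.lo = i.hi :=
      D.toMatching.join_mate_left i.lo_ne_hi i.1 (min (D.height i.lo) (D.height i.hi))
    change concatEnds i D (outerNode i.hi) = concatEnds i D (outerNode i.lo)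
    rw [concatEnds_outerNode, concatEnds_outerNode, hlo, ← hlo, (act i D).mate_mate]
    exact Set.pair_comm _ _
  have hinner : concatEnds i D (firstNode i.hi.swap) = concatEnds i D (firstNode i.lo.swap) := by
    change concatEnds i D (secondNode i.hi) = concatEnds i D (secondNode i.lo)
    rw [concatEnds_secondNode, concatEnds_secondNode, strandEnds_lo]
  have hstrand (a : Fin N) (hlo : Sum.inl a ≠ i.lo) (hhi : Sum.inl a ≠ i.hi) :
      concatEnds i D (firstNode (Sum.inr a)) = concatEnds i D (firstNode (Sum.inl a)) := by
    change concatEnds i D (secondNode (Sum.inl a)) = concatEnds i D (outerNode (Sum.inl a))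
    rw [concatEnds_secondNode, concatEnds_outerNode, strandEnds, if_neg (by tauto)]
  obtain ⟨a, rfl | rfl⟩ : ∃ a, u = Sum.inl a ∨ u = (Sum.inl a : Node N).swap := by
    cases u <;> simp
  · rcases eq_or_ne (Sum.inl a) i.lo with h | hlo
    · rw [h, elem_mate_lo, houter]
    rcases eq_or_ne (Sum.inl a) i.hi with h | hhi
    · rw [h, elem_mate_hi, houter]
    · rw [elem_mate_inl hlo hhi, hstrand a hlo hhi]
  · rw [elem_mate_swap]
    rcases eq_or_ne (Sum.inl a) i.lo with h | hlo
    · rw [h, elem_mate_lo, hinner]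
    rcases eq_or_ne (Sum.inl a) i.hi with h | hhi
    · rw [h, elem_mate_hi, hinner]
    · rw [elem_mate_inl hlo hhi]
      exact (hstrand a hlo hhi).symm

variable {i D} in
theorem concatEnds_eq_of_joined {y : CNode N} (h : Joined (elem i) D x y) :
    concatEnds i D y = concatEnds i D x := by
  induction h with
  | refl => rfl
  | tail _ h ih =>
    rw [← ih]
    rcases h with ⟨u, rfl, rfl⟩ | ⟨u, rfl, rfl⟩
    · exact concatEnds_firstNode_elem_mate i D u
    · rw [concatEnds_secondNode, concatEnds_secondNode, strandEnds_mate]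

variable {i D} in
theorem act_height_of_mem_strandEnds (h : v ∈ strandEnds i D u) :
    (act i D).height v = if u = i.lo ∨ u = i.hi then min (D.height i.lo) (D.height i.hi)
      else (act i D).height u := by
  unfold strandEnds at h
  split_ifs at h ⊢ with h1 h2
  · exact absurd h (Set.notMem_empty v)
  · have hlo := act_cases i D (D.mate i.lo)
    have hhi := act_cases i D (D.mate i.hi)
    have := D.mate_ne i.lo
    have := D.mate_ne i.hi
    have := D.mate_mate i.hi
    rcases h with rfl | rfl <;> grind
  · rcases h with rfl | rfl
    · rfl
    · rw [(act i D).height_mate]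

variable {i D} in
theorem act_height_le_of_mem_strandEnds (h : v ∈ strandEnds i D u) :
    (act i D).height v ≤ D.height u := by
  rw [act_height_of_mem_strandEnds h]
  have hu := act_cases i D u
  have hlo := D.height_mate i.lo
  have hhi := D.height_mate i.hi
  grind

theorem act_height_inl_le_elem_height (a : Fin N) :
    (act i D).height (Sum.inl a) ≤ (elem i).height (Sum.inl a) := by
  rcases eq_or_ne (Sum.inl a) i.hi with h | h
  · have hact := act_cases i D i.hi
    have hne := i.lo_ne_hi
    have hhi := D.mate_ne i.hi
    rw [h, elem_height_hi]
    grind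
  · rw [elem_height_of_ne_hi i h]
    exact ((act i D).height_le _).trans (min_le_left _ _)

variable {i D} in
theorem act_height_le_elem_height_of_mem {a : Fin N} (h : v ∈ strandEnds i D (Sum.inl a)) :
    (act i D).height v ≤ (elem i).height (Sum.inl a) := by
  rcases eq_or_ne (Sum.inl a) i.hi with e | e
  · rw [act_height_of_mem_strandEnds h, if_pos (.inr e), e, elem_height_hi, ← i.pos_lo]
    exact (min_le_left _ _).trans (D.isOkada_toMatching.height_le_pos i.lo)
  · rw [elem_height_of_ne_hi i e]
    exact (act_height_le_of_mem_strandEnds h).trans ((D.height_le _).trans (min_le_left _ _))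

variable {i D} in
theorem mem_concatEnds_of_joined (h : Joined (elem i) D (outerNode u) x) :
    u ∈ concatEnds i D x := by
  rw [concatEnds_eq_of_joined h, concatEnds_outerNode]
  exact Set.mem_insert _ _

theorem exists_fragment_height (u : Node N) :
    (∃ v, Joined (elem i) D (outerNode u) (firstNode v) ∧
      (act i D).height u = (elem i).height v) ∨
    ∃ v, Joined (elem i) D (outerNode u) (secondNode v) ∧ (act i D).height u = D.height v := by
  rcases act_cases i D u with ⟨rfl, -, e⟩ | ⟨rfl, -, e⟩ | ⟨rfl, h, -, e⟩ | ⟨rfl, h, -, e⟩ |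
    ⟨hlo, hhi, -, -, -, e⟩ <;> rw [e]
  · exact .inl ⟨i.lo, .refl, (elem_height_lo i).symm⟩
  · exact .inl ⟨i.hi, .refl, (elem_height_hi i).symm⟩
  · rcases min_choice (D.height i.lo) (D.height i.hi) with e' | e'
    · exact .inr ⟨_, joined_mate_lo h, e'⟩
    · exact .inr ⟨_, (joined_mate_lo h).trans (joined_lo_hi i D), e'⟩
  · rcases min_choice (D.height i.lo) (D.height i.hi) with e' | e'
    · exact .inr ⟨_, (joined_mate_hi h).trans (joined_lo_hi i D).symm, e'⟩
    · exact .inr ⟨_, joined_mate_hi h, e'⟩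
  · exact .inr ⟨u, joined_outerNode_secondNode D hlo hhi, rfl⟩

theorem isComposition_act : IsComposition (elem i) D (act i D) := by
  refine ⟨joined_act_mate i D, fun u => ⟨exists_fragment_height i D u, ?_⟩⟩
  rintro k (⟨v, hv, rfl⟩ | ⟨v, hv, rfl⟩)
  · have hu := mem_concatEnds_of_joined hv
    rcases v with a | a
    · have hend : u = Sum.inl a ∨ u = (act i D).mate (Sum.inl a) := by
        rwa [show firstNode (Sum.inl a) = outerNode (Sum.inl a) from rfl,
          concatEnds_outerNode] at hu
      refine le_trans ?_ (act_height_inl_le_elem_height i D a)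
      rcases hend with rfl | rfl
      · rfl
      · rw [(act i D).height_mate]
    · exact act_height_le_elem_height_of_mem hu
  · have hu := mem_concatEnds_of_joined hv
    rw [concatEnds_secondNode] at hu
    exact act_height_le_of_mem_strandEnds hu

variable {i D} in
theorem isComposition_elem_iff {E : ArcDiagram N} :
    IsComposition (elem i) D E ↔ E = act i D := by
  refine ⟨fun ⟨hmate, hheight⟩ => ?_, fun h => h ▸ isComposition_act i D⟩
  have hmate' : E.mate = (act i D).mate := funext fun u => by
    have hu : E.mate u ∈ concatEnds i D (outerNode u) :=
      concatEnds_eq_of_joined (hmate u) ▸ mem_concatEnds_of_joined .refl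
    rw [concatEnds_outerNode] at hu
    exact hu.resolve_left (E.mate_ne u)
  exact ArcDiagram.ext hmate'
    (funext fun u => (hheight u).unique ((isComposition_act i D).2 u))

/-- The composition of the elementary diagrams along a word. -/
def ofWord (w : List (GenIdx N)) : ArcDiagram N := w.foldr act (ArcDiagram.id N)

theorem isWordDiagram_iff {w : List (GenIdx N)} {D : ArcDiagram N} :
    IsWordDiagram w D ↔ D = ofWord w := by
  constructor
  · intro h
    induction h with
    | nil => rfl
    | cons i w D E _ h ih => rw [isComposition_elem_iff.1 h, ih, ofWord, ofWord, List.foldr_cons]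
  · rintro rfl
    induction w with
    | nil => exact .nil
    | cons i w ih => exact .cons i w _ _ ih (isComposition_act i _)

end ArcDiagram

end

namespace ArcDiagram

variable {N : ℕ} {i j : GenIdx N}

/-! ### Relations between the elementary diagrams -/

theorem disjoint_nodes_of_far (h : i.1 + 2 ≤ j.1 ∨ j.1 + 2 ≤ i.1) :
    i.lo ≠ j.lo ∧ i.lo ≠ j.hi ∧ i.hi ≠ j.lo ∧ i.hi ≠ j.hi := by
  refine ⟨?_, ?_, ?_, ?_⟩ <;> intro e <;> have := congrArg Node.pos e <;>
    simp only [GenIdx.pos_lo, GenIdx.pos_hi] at this <;> omega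

theorem act_comm (h : i.1 + 2 ≤ j.1 ∨ j.1 + 2 ≤ i.1) (D : ArcDiagram N) :
    act i (act j D) = act j (act i D) := by
  obtain ⟨hll, hlh, hhl, hhh⟩ := disjoint_nodes_of_far h
  exact toMatching_injective
    (D.toMatching.joinMin_comm j.lo_ne_hi i.lo_ne_hi hll.symm hhl.symm hlh.symm hhh.symm j.1 i.1)

theorem act_mate_lo (i : GenIdx N) (D : ArcDiagram N) : (act i D).mate i.lo = i.hi :=
  D.toMatching.join_mate_left i.lo_ne_hi i.1 (min (D.height i.lo) (D.height i.hi))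

theorem act_height_lo (i : GenIdx N) (D : ArcDiagram N) : (act i D).height i.lo = i.1 :=
  D.toMatching.join_height_left i.lo i.hi i.1 (min (D.height i.lo) (D.height i.hi))

theorem act_act_self (i : GenIdx N) (D : ArcDiagram N) : act i (act i D) = act i D :=
  toMatching_injective (D.toMatching.joinMin_joinMin_self i.lo_ne_hi i.1)

theorem height_lo_le (i : GenIdx N) (D : ArcDiagram N) : D.height i.lo ≤ i.1 :=
  (D.isOkada_toMatching.height_le_pos i.lo).trans_eq i.pos_lo

theorem height_hi_le (i : GenIdx N) (D : ArcDiagram N) : D.height i.hi ≤ i.1 + 1 :=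
  (D.isOkada_toMatching.height_le_pos i.hi).trans_eq i.pos_hi

theorem hi_eq_lo (h : j.1 = i.1 + 1) : i.hi = j.lo :=
  Node.pos_injective (by rw [GenIdx.pos_lo, GenIdx.pos_hi, h])

theorem lo_ne_hi_succ (h : j.1 = i.1 + 1) : i.lo ≠ j.hi := fun e => by
  have := congrArg Node.pos e
  simp only [GenIdx.pos_lo, GenIdx.pos_hi] at this
  omega

theorem act_act_act (h : j.1 = i.1 + 1) (D : ArcDiagram N) :
    act j (act i (act j D)) = act j D := by
  have hij := hi_eq_lo h
  have hheight : (act j D).height i.hi = j.1 := by rw [hij, act_height_lo]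
  have hlo := height_lo_le i (act j D)
  apply toMatching_injective
  have key := (act j D).toMatching.joinMin_joinMin_of_mate (q := i.hi) (k := i.1)
    (hij ▸ act_mate_lo j D) i.lo_ne_hi (lo_ne_hi_succ h) hlo
    (hlo.trans (by change _ ≤ (act j D).height i.hi; omega))
  rw [show (act j D).toMatching.height i.hi = j.1 from hheight, hij] at key
  rw [toMatching_act, toMatching_act, hij]
  exact key

/-! ### The mirror -/

theorem mirror_mirror (D : ArcDiagram N) : D.mirror.mirror = D := by
  apply ArcDiagram.ext <;> funext u <;> simp only [mirror, Sum.swap_swap]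

theorem mirror_id : (ArcDiagram.id N).mirror = ArcDiagram.id N := by
  apply ArcDiagram.ext <;> funext u <;> simp [mirror, ArcDiagram.id, Node.abs_swap]

theorem toMatching_mirror_act (i : GenIdx N) (D : ArcDiagram N) :
    (act i D).mirror.toMatching = D.mirror.toMatching.joinMin i.lo.swap i.hi.swap i.1 :=
  D.toMatching.map_joinMin (Equiv.sumComm (Fin N) (Fin N)) i.lo i.hi i.1

theorem act_mirror_act_mirror (i j : GenIdx N) (D : ArcDiagram N) :
    act i (mirror (act j D.mirror)) = mirror (act j (mirror (act i D))) := by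
  have hswap : (j.lo).swap ≠ j.hi.swap := Sum.swap_leftInverse.injective.ne j.lo_ne_hi
  apply toMatching_injective
  rw [toMatching_mirror_act, mirror_mirror, toMatching_act, toMatching_act, toMatching_mirror_act,
    mirror_mirror]
  apply LabelledMatching.joinMin_comm _ hswap i.lo_ne_hi <;> exact Sum.inr_ne_inl

theorem mirror_act_id (i : GenIdx N) :
    mirror (act i (ArcDiagram.id N)) = act i (ArcDiagram.id N) := by
  apply toMatching_injective
  rw [toMatching_mirror_act, mirror_id, toMatching_act]
  have hlo : (ArcDiagram.id N).toMatching.height i.lo = i.1 :=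
    i.pos_lo
  have hheight : min ((ArcDiagram.id N).toMatching.height i.lo)
      ((ArcDiagram.id N).toMatching.height i.hi) = i.1 := by
    rw [hlo]
    exact min_eq_left (Nat.le_succ _)
  have hheight' : min ((ArcDiagram.id N).toMatching.height i.lo.swap)
      ((ArcDiagram.id N).toMatching.height i.hi.swap) = i.1 := hheight
  rw [LabelledMatching.joinMin, LabelledMatching.joinMin, hheight, hheight']
  exact (ArcDiagram.id N).toMatching.join_mate_mate i.lo_ne_hi i.1

theorem ofWord_append_singleton (w : List (GenIdx N)) (j : GenIdx N) :
    ofWord (w ++ [j]) = mirror (act j (mirror (ofWord w))) := by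
  induction w with
  | nil =>
    change act j (ArcDiagram.id N) = mirror (act j (ArcDiagram.id N).mirror)
    rw [mirror_id, mirror_act_id]
  | cons i w ih =>
    change act i (ofWord (w ++ [j])) = mirror (act j (mirror (act i (ofWord w))))
    rw [ih, act_mirror_act_mirror]

theorem ofWord_reverse (w : List (GenIdx N)) : ofWord w.reverse = (ofWord w).mirror := by
  induction w with
  | nil => exact mirror_id.symm
  | cons i w ih =>
    rw [List.reverse_cons, ofWord_append_singleton, ih, mirror_mirror]
    rfl

end ArcDiagram

/-! ### Structure constants -/

section StepProd

variable {K : Type*} [CommMonoid K] (Y : ℕ → K)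

/-- The product of the `Y m` for `s ≤ m < t` with `m ≡ t` modulo `2`. -/
def stepProd (s t : ℕ) : K :=
  ∏ m ∈ Finset.range t with s ≤ m ∧ m % 2 = t % 2, Y m

theorem stepProd_mul {s r t : ℕ} (hsr : s ≤ r) (hrt : r ≤ t) (h : r % 2 = t % 2) :
    stepProd Y s r * stepProd Y r t = stepProd Y s t := by
  unfold stepProd
  rw [← Finset.prod_union]
  · congr 1
    ext m
    simp only [Finset.mem_union, Finset.mem_filter, Finset.mem_range]
    omega
  · rw [Finset.disjoint_left]
    intro m
    simp only [Finset.mem_filter, Finset.mem_range]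
    omega

theorem stepProd_self (t : ℕ) : stepProd Y t t = 1 := by
  refine Finset.prod_eq_one fun m => ?_
  simp only [Finset.mem_filter, Finset.mem_range]
  omega

theorem stepProd_add_two (t : ℕ) : stepProd Y t (t + 2) = Y t := by
  have : ({m ∈ Finset.range (t + 2) | t ≤ m ∧ m % 2 = (t + 2) % 2}) = {t} := by
    ext m
    simp only [Finset.mem_singleton, Finset.mem_filter, Finset.mem_range]
    omega
  rw [stepProd, this, Finset.prod_singleton]

theorem stepProd_exchange {s r t u : ℕ} (hsr : s ≤ r) (hrt : r ≤ t) (hru : r ≤ u)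
    (ht : r % 2 = t % 2) (hu : r % 2 = u % 2) :
    stepProd Y r t * stepProd Y s u = stepProd Y r u * stepProd Y s t := by
  rw [← stepProd_mul Y hsr hrt ht, ← stepProd_mul Y hsr hru hu]
  ac_rfl

theorem stepProd_max {a b c t u : ℕ} (ht : max a b % 2 = t % 2) (hu : max b c % 2 = u % 2)
    (hbt : b ≤ t) (hbu : b ≤ u) :
    stepProd Y (max a b) t * stepProd Y (max (min a b) c) u =
      stepProd Y (max b c) u * stepProd Y (max a (min b c)) t := by
  rcases le_or_gt b a with hab | hab
  · rw [min_eq_right hab, max_eq_left hab, max_eq_left (a := a) (min_le_of_left_le hab), mul_comm]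
  · rcases le_or_gt b c with hbc | hbc
    · rw [min_eq_left hab.le, max_eq_right hab.le, min_eq_left hbc, max_eq_right hab.le,
        max_eq_right (hab.le.trans hbc), max_eq_right hbc, mul_comm]
    · rw [max_eq_right hab.le] at ht ⊢
      rw [max_eq_left hbc.le] at hu ⊢
      rw [min_eq_left hab.le, min_eq_right hbc.le]
      exact stepProd_exchange Y (max_le hab.le hbc.le) hbt hbu ht hu

end StepProd

namespace LabelledMatching

variable {K : Type*} [CommMonoid K] (X Y : ℕ → K) {α : Type*} [DecidableEq α]
  (M : LabelledMatching α) {p q r s : α} {k l t u : ℕ}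

/-- The scalar produced when the points `p` and `q` are joined by an elementary diagram with arcs
of label `t - 1`: a loop contributes an entry of `X`, and lowering a label from `t` to the larger
label at `p` and `q` contributes an entry of `Y` for each step of two. -/
def joinWeight (p q : α) (t : ℕ) : K :=
  if M.mate p = q then X (M.height p) * stepProd Y (M.height p + 1) t
  else stepProd Y (max (M.height p) (M.height q)) t

theorem joinWeight_symm (p q : α) (t : ℕ) : M.joinWeight X Y p q t = M.joinWeight X Y q p t := by
  have hiff : M.mate p = q ↔ M.mate q = p := M.mate_involutive.eq_iff.trans eq_comm
  simp only [joinWeight, hiff, max_comm (M.height p)]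
  split_ifs with h
  · rw [← h, M.height_mate]
  · rfl

theorem joinMin_symm (hpq : p ≠ q) (k : ℕ) : M.joinMin p q k = M.joinMin q p k := by
  rw [joinMin, joinMin, M.join_comm hpq, min_comm]

theorem joinWeight_joinMin_of_unlinked (hpq : p ≠ q) (hrp : r ≠ p) (hrq : r ≠ q) (hsp : s ≠ p)
    (hsq : s ≠ q) (hrp' : r ≠ M.mate p) (hrq' : r ≠ M.mate q) (hsp' : s ≠ M.mate p)
    (hsq' : s ≠ M.mate q) :
    (M.joinMin p q k).joinWeight X Y r s u = M.joinWeight X Y r s u := by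
  have hr := M.join_cases hpq k (min (M.height p) (M.height q)) r
  have hs := M.join_cases hpq k (min (M.height p) (M.height q)) s
  rw [← joinMin] at hr hs
  simp only [hrp, hrq, hrp', hrq', hsp, hsq, hsp', hsq', false_and, false_or, ne_eq,
    not_false_eq_true, true_and] at hr hs
  rw [joinWeight, joinWeight, hr.1, hr.2, hs.2]

theorem joinWeight_joinMin_of_mate (hpq : p ≠ q) (hsp : s ≠ p) (hrp : r ≠ p) (hrq : r ≠ q)
    (hsq : s ≠ q) (hrs : r ≠ s) (hqr : M.mate q = r) (hps : M.mate p ≠ s) :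
    (M.joinMin p q k).joinWeight X Y r s u =
      stepProd Y (max (min (M.height p) (M.height q)) (M.height s)) u := by
  have hr := M.join_cases hpq k (min (M.height p) (M.height q)) r
  have hs := M.join_cases hpq k (min (M.height p) (M.height q)) s
  rw [← joinMin] at hr hs
  have hrp' : r ≠ M.mate p := fun e => hpq (M.mate_injective (e.symm.trans hqr.symm))
  simp only [hrp, hrq, hrp', hqr, hsp, hsq, hps.symm, hrs.symm, false_and, false_or, ne_eq,
    not_false_eq_true, true_and, not_true_eq_false, or_false] at hr hs
  rw [joinWeight, if_neg (hr.1 ▸ hps), hr.2, hs.2]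

theorem joinWeight_joinMin_of_mate_of_mate (hpq : p ≠ q) (hrp : r ≠ p) (hrq : r ≠ q)
    (hqr : M.mate q = r) (hps : M.mate p = s) :
    (M.joinMin p q k).joinWeight X Y r s u =
      X (min (M.height p) (M.height q)) *
        stepProd Y (min (M.height p) (M.height q) + 1) u := by
  have hr := M.join_cases hpq k (min (M.height p) (M.height q)) r
  rw [← joinMin] at hr
  have hrs : r ≠ s := fun e => hpq (M.mate_injective (hps.trans (hqr.trans e).symm))
  simp only [hrp, hrq, hqr, hps, hrs, false_and, false_or, ne_eq, not_false_eq_true, true_and,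
    not_true_eq_false, or_false] at hr
  rw [joinWeight, if_pos hr.1, hr.2]

variable {M}

theorem joinWeight_mul_comm_of_unlinked (hpq : p ≠ q) (hrs : r ≠ s) (hpr : p ≠ r) (hps : p ≠ s)
    (hqr : q ≠ r) (hqs : q ≠ s) (hpr' : M.mate p ≠ r) (hps' : M.mate p ≠ s)
    (hqr' : M.mate q ≠ r) (hqs' : M.mate q ≠ s) :
    M.joinWeight X Y p q t * (M.joinMin p q k).joinWeight X Y r s u =
      M.joinWeight X Y r s u * (M.joinMin r s l).joinWeight X Y p q t := by
  rw [joinWeight_joinMin_of_unlinked X Y M hpq hpr.symm hqr.symm hps.symm hqs.symm hpr'.symm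
      hqr'.symm hps'.symm hqs'.symm,
    joinWeight_joinMin_of_unlinked X Y M hrs hpr hps hqr hqs
      (mt M.mate_involutive.eq_iff.2 hpr') (mt M.mate_involutive.eq_iff.2 hps')
      (mt M.mate_involutive.eq_iff.2 hqr') (mt M.mate_involutive.eq_iff.2 hqs'), mul_comm]

theorem joinWeight_mul_comm_of_mate (hpq : p ≠ q) (hrs : r ≠ s) (hpr : p ≠ r) (hps : p ≠ s)
    (hqr : q ≠ r) (hqs : q ≠ s) (ht : max (M.height p) (M.height q) % 2 = t % 2)
    (hu : max (M.height r) (M.height s) % 2 = u % 2) (hpt : M.height p ≤ t)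
    (hqt : M.height q ≤ t) (hru : M.height r ≤ u) (hsu : M.height s ≤ u)
    (hne : M.mate p = s → M.height p ≠ M.height q) (hmate : M.mate q = r) :
    M.joinWeight X Y p q t * (M.joinMin p q k).joinWeight X Y r s u =
      M.joinWeight X Y r s u * (M.joinMin r s l).joinWeight X Y p q t := by
  have hmate' : M.mate r = q := by rw [← hmate, M.mate_mate]
  have hheight : M.height r = M.height q := by rw [← hmate, M.height_mate]
  have hpq' : M.mate p ≠ q := fun e => hpr (M.mate_injective (e.trans hmate'.symm))
  have hrs' : M.mate r ≠ s := fun e => hqs (hmate'.symm.trans e)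
  rw [(M.joinMin r s l).joinWeight_symm X Y p q, M.joinMin_symm hrs,
    joinWeight.eq_def X Y M p q, if_neg hpq', joinWeight.eq_def X Y M r s, if_neg hrs']
  by_cases hps' : M.mate p = s
  · have hsp' : M.mate s = p := by rw [← hps', M.mate_mate]
    have hheight' : M.height s = M.height p := by rw [← hps', M.height_mate]
    have := hne hps'
    rw [joinWeight_joinMin_of_mate_of_mate X Y M hpq hpr.symm hqr.symm hmate hps',
      joinWeight_joinMin_of_mate_of_mate X Y M hrs.symm hqs hqr hmate' hsp', hheight, hheight',
      mul_left_comm, mul_left_comm (stepProd Y _ u), max_comm (M.height q)]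
    rw [hheight, hheight', max_comm] at hu
    rw [stepProd_exchange Y (by omega) (by omega) (by omega) ht hu]
  · have hsp' : M.mate s ≠ p := mt M.mate_involutive.eq_iff.1 (Ne.symm hps')
    rw [joinWeight_joinMin_of_mate X Y M hpq hps.symm hpr.symm hqr.symm hqs.symm hrs hmate hps',
      joinWeight_joinMin_of_mate X Y M hrs.symm hps hqs hqr hpr hpq.symm hmate' hsp', hheight,
      min_comm (M.height s), max_comm (min _ (M.height s))]
    rw [hheight] at hu
    exact stepProd_max Y ht hu hqt (hheight ▸ hru)

theorem joinWeight_mul_comm (hpq : p ≠ q) (hrs : r ≠ s) (hpr : p ≠ r) (hps : p ≠ s)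
    (hqr : q ≠ r) (hqs : q ≠ s)
    (ht : M.mate p ≠ q → max (M.height p) (M.height q) % 2 = t % 2)
    (hu : M.mate r ≠ s → max (M.height r) (M.height s) % 2 = u % 2) (hpt : M.height p ≤ t)
    (hqt : M.height q ≤ t) (hru : M.height r ≤ u) (hsu : M.height s ≤ u)
    (hne : (M.mate p = r ∨ M.mate p = s) → (M.mate q = r ∨ M.mate q = s) →
      M.height p ≠ M.height q) :
    M.joinWeight X Y p q t * (M.joinMin p q k).joinWeight X Y r s u =
      M.joinWeight X Y r s u * (M.joinMin r s l).joinWeight X Y p q t := by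
  have hlink {a b c : α} (h : M.mate a = c) (hbc : b ≠ c) : M.mate b ≠ a := fun e =>
    hbc (M.mate_injective (e.trans (by rw [← h, M.mate_mate])))
  have hinv {a b : α} (h : M.mate a = b) : M.mate b = a := by rw [← h, M.mate_mate]
  by_cases hqr' : M.mate q = r
  · exact joinWeight_mul_comm_of_mate X Y hpq hrs hpr hps hqr hqs (ht (hlink hqr' hpr))
      (hu fun e => hqs ((hinv hqr').symm.trans e)) hpt hqt hru hsu
      (fun h => hne (.inr h) (.inl hqr')) hqr'
  by_cases hqs' : M.mate q = s
  · rw [M.joinWeight_symm X Y r s, M.joinMin_symm hrs, (M.joinMin p q k).joinWeight_symm X Y r s]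
    exact joinWeight_mul_comm_of_mate X Y hpq hrs.symm hps hpr hqs hqr (ht (hlink hqs' hps))
      (max_comm (M.height r) _ ▸ hu (hlink (hinv hqs') hqr.symm)) hpt hqt hsu hru
      (fun h => hne (.inl h) (.inr hqs')) hqs'
  rw [M.joinWeight_symm X Y p q, M.joinMin_symm hpq, (M.joinMin r s l).joinWeight_symm X Y p q]
  by_cases hpr' : M.mate p = r
  · exact joinWeight_mul_comm_of_mate X Y hpq.symm hrs hqr hqs hpr hps
      (max_comm (M.height p) _ ▸ ht fun e => hqr (e.symm.trans hpr'))
      (hu fun e => hps ((hinv hpr').symm.trans e)) hqt hpt hru hsu (fun h => absurd h hqs') hpr'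
  by_cases hps' : M.mate p = s
  · rw [M.joinWeight_symm X Y r s, M.joinMin_symm hrs, (M.joinMin q p k).joinWeight_symm X Y r s]
    exact joinWeight_mul_comm_of_mate X Y hpq.symm hrs.symm hqs hqr hps hpr
      (max_comm (M.height p) _ ▸ ht fun e => hqs (e.symm.trans hps'))
      (max_comm (M.height r) _ ▸ hu (hlink (hinv hps') hpr.symm)) hqt hpt hsu hru
      (fun h => absurd h hqr') hps'
  · exact joinWeight_mul_comm_of_unlinked X Y hpq.symm hrs hqr hqs hpr hps hqr' hqs' hpr' hps'

end LabelledMatching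

namespace ArcDiagram

variable {K : Type*} [CommMonoid K] (X Y : ℕ → K) {N : ℕ} {i j : GenIdx N}

/-- The coefficient of the diagram `act i D` in the product of `E_i` and the diagram `D`. -/
def weight (i : GenIdx N) (D : ArcDiagram N) : K :=
  D.toMatching.joinWeight X Y i.lo i.hi (i.1 + 1)

variable {X Y}

theorem weight_of_mate {D : ArcDiagram N} (h : D.mate i.lo = i.hi) :
    weight X Y i D = X (D.height i.lo) * stepProd Y (D.height i.lo + 1) (i.1 + 1) :=
  if_pos h

theorem weight_of_not_mate {D : ArcDiagram N} (h : D.mate i.lo ≠ i.hi) :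
    weight X Y i D = stepProd Y (max (D.height i.lo) (D.height i.hi)) (i.1 + 1) :=
  if_neg h

theorem weight_act_self (i : GenIdx N) (D : ArcDiagram N) : weight X Y i (act i D) = X i.1 := by
  rw [weight_of_mate (act_mate_lo i D), act_height_lo, stepProd_self, mul_one]

theorem act_mate_hi (i : GenIdx N) (D : ArcDiagram N) : (act i D).mate i.hi = i.lo := by
  rw [← act_mate_lo i D, (act i D).mate_mate]

theorem act_height_hi (i : GenIdx N) (D : ArcDiagram N) : (act i D).height i.hi = i.1 := by
  rw [← act_mate_lo i D, (act i D).height_mate, act_height_lo]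

theorem weight_act_succ (h : j.1 = i.1 + 1) (D : ArcDiagram N) : weight X Y i (act j D) = 1 := by
  have hne : (act j D).mate i.lo ≠ i.hi := fun e => by
    have hlo : (act j D).mate i.hi = i.lo := by rw [← e, (act j D).mate_mate]
    rw [hi_eq_lo h, act_mate_lo] at hlo
    exact lo_ne_hi_succ h hlo.symm
  have hlo := height_lo_le i (act j D)
  rw [weight_of_not_mate hne, hi_eq_lo h, act_height_lo, max_eq_right (by omega), h, stepProd_self]

theorem weight_act_act (h : j.1 = i.1 + 1) (D : ArcDiagram N) :
    weight X Y j (act i (act j D)) = Y i.1 := by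
  have hlo : (act i (act j D)).height j.lo = i.1 := by rw [← hi_eq_lo h, act_height_hi]
  have hmate : (act i (act j D)).mate j.lo = i.lo := by rw [← hi_eq_lo h, act_mate_hi]
  have hle : (act i (act j D)).height j.hi ≤ i.1 := by
    have hhi := act_cases i (act j D) j.hi
    have hmin := height_lo_le i (act j D)
    have hj := act_mate_lo j D
    have hne := lo_ne_hi_succ h
    have hne' := j.lo_ne_hi
    have heq := hi_eq_lo h
    grind
  rw [weight_of_not_mate (hmate ▸ lo_ne_hi_succ h), hlo, max_eq_left hle, h, stepProd_add_two]

theorem max_height_parity {D : ArcDiagram N} (h : D.mate i.lo ≠ i.hi) :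
    max (D.height i.lo) (D.height i.hi) % 2 = (i.1 + 1) % 2 := by
  rw [← i.pos_hi]
  exact D.isOkada_toMatching.max_height_parity (by rw [i.pos_lo, i.pos_hi]) h.symm

theorem height_lo_ne_height_hi (h : i.1 + 2 ≤ j.1 ∨ j.1 + 2 ≤ i.1) {D : ArcDiagram N}
    (hlo : D.mate i.lo = j.lo ∨ D.mate i.lo = j.hi)
    (hhi : D.mate i.hi = j.lo ∨ D.mate i.hi = j.hi) : D.height i.lo ≠ D.height i.hi := by
  have hlt := D.isOkada_toMatching.height_lt i.lo i.hi
  have hlt' := D.isOkada_toMatching.height_lt i.hi i.lo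
  simp only [LabelledMatching.Covers, Node.Between, toMatching, i.pos_lo, i.pos_hi] at hlt hlt'
  have hlo' : (D.mate i.lo).pos = j.1 ∨ (D.mate i.lo).pos = j.1 + 1 := by
    rw [← j.pos_hi, ← j.pos_lo]
    exact hlo.imp (congrArg _) (congrArg _)
  have hhi' : (D.mate i.hi).pos = j.1 ∨ (D.mate i.hi).pos = j.1 + 1 := by
    rw [← j.pos_hi, ← j.pos_lo]
    exact hhi.imp (congrArg _) (congrArg _)
  omega

theorem weight_comm (h : i.1 + 2 ≤ j.1 ∨ j.1 + 2 ≤ i.1) (D : ArcDiagram N) :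
    weight X Y i D * weight X Y j (act i D) = weight X Y j D * weight X Y i (act j D) := by
  obtain ⟨hll, hlh, hhl, hhh⟩ := disjoint_nodes_of_far h
  exact LabelledMatching.joinWeight_mul_comm X Y i.lo_ne_hi j.lo_ne_hi hll hlh hhl hhh
    max_height_parity max_height_parity ((height_lo_le i D).trans (Nat.le_succ _))
    (height_hi_le i D) ((height_lo_le j D).trans (Nat.le_succ _)) (height_hi_le j D)
    (height_lo_ne_height_hi h)

end ArcDiagram

/-! ### Reduced words -/

namespace LabelledMatching

variable {α : Type*} [Fintype α] [DecidableEq α] (M : LabelledMatching α) {p q : α}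

theorem sum_height_join_mate (p : α) (k l : ℕ) :
    ∑ u, (M.join p (M.mate p) k l).height u + 2 * M.height p = ∑ u, M.height u + 2 * k := by
  have hp := M.mate_ne p
  have hcompl : ∀ u ∈ ({p, M.mate p} : Finset α)ᶜ,
      (M.join p (M.mate p) k l).height u = M.height u := fun u hu => by
    have hpp := M.mate_mate p
    have hc := M.join_cases hp.symm k l u
    simp only [Finset.mem_compl, Finset.mem_insert, Finset.mem_singleton] at hu
    grind
  have hmate : (M.join p (M.mate p) k l).height (M.mate p) = k := by
    rw [M.join_comm hp.symm, join_height_left]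
  have hrest := Finset.sum_congr rfl hcompl
  have hjoin := Finset.sum_add_sum_compl {p, M.mate p} (M.join p (M.mate p) k l).height
  have hold := Finset.sum_add_sum_compl {p, M.mate p} M.height
  rw [Finset.sum_pair hp.symm, hmate, join_height_left] at hjoin
  rw [Finset.sum_pair hp.symm, M.height_mate] at hold
  linarith

theorem sum_height_join (hpq : p ≠ q) (hqp : q ≠ M.mate p) (k l : ℕ) :
    ∑ u, (M.join p q k l).height u + 2 * (M.height p + M.height q) =
      ∑ u, M.height u + 2 * (k + l) := by
  have hp := M.mate_ne p
  have hq := M.mate_ne q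
  have hpq' := M.mate_injective.ne hpq
  have hqq := M.mate_mate q
  have hcompl : ∀ u ∈ ({p, q, M.mate p, M.mate q} : Finset α)ᶜ,
      (M.join p q k l).height u = M.height u := fun u hu => by
    have hc := M.join_cases hpq k l u
    simp only [Finset.mem_compl, Finset.mem_insert, Finset.mem_singleton] at hu
    grind
  have hsum (f : α → ℕ) : ∑ u ∈ {p, q, M.mate p, M.mate q}, f u =
      f p + (f q + (f (M.mate p) + f (M.mate q))) := by
    have hpq'' : p ≠ M.mate q := fun e => hqp (by rw [e, hqq])
    simp [hpq, hp.symm, hq.symm, hpq', hqp, hpq'']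
  have hpl : (M.join p q k l).height p = k := M.join_height_left p q k l
  have hql : (M.join p q k l).height q = k := by
    rw [M.join_comm hpq, join_height_left]
  have hc := M.join_cases hpq k l (M.mate p)
  have hc' := M.join_cases hpq k l (M.mate q)
  have hpl' : (M.join p q k l).height (M.mate p) = l := by grind
  have hql' : (M.join p q k l).height (M.mate q) = l := by grind
  have hrest := Finset.sum_congr rfl hcompl
  have hjoin := Finset.sum_add_sum_compl {p, q, M.mate p, M.mate q} (M.join p q k l).height
  have hold := Finset.sum_add_sum_compl {p, q, M.mate p, M.mate q} M.height
  rw [hsum, hpl, hql, hpl', hql'] at hjoin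
  rw [hsum, M.height_mate, M.height_mate] at hold
  linarith

end LabelledMatching

namespace ArcDiagram

variable {N : ℕ} {i : GenIdx N} {D : ArcDiagram N}

/-- The sum of the labels over all the nodes. Composing with an elementary diagram lowers it by at
most `2`, and by exactly `2` when the length of the diagram grows by one. -/
def heightSum (D : ArcDiagram N) : ℕ := ∑ u, D.height u

theorem heightSum_mirror (D : ArcDiagram N) : D.mirror.heightSum = D.heightSum :=
  Equiv.sum_comp (Equiv.sumComm (Fin N) (Fin N)) D.height

theorem heightSum_act_of_mate (h : D.mate i.lo = i.hi) :
    (act i D).heightSum + 2 * D.height i.lo = D.heightSum + 2 * i.1 := by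
  have key := D.toMatching.sum_height_join_mate i.lo i.1 (min (D.height i.lo) (D.height i.hi))
  rwa [show D.toMatching.mate i.lo = i.hi from h] at key

theorem heightSum_act_of_not_mate (h : D.mate i.lo ≠ i.hi) :
    (act i D).heightSum + 2 * max (D.height i.lo) (D.height i.hi) = D.heightSum + 2 * i.1 := by
  have key : (act i D).heightSum + 2 * (D.height i.lo + D.height i.hi) =
      D.heightSum + 2 * (i.1 + min (D.height i.lo) (D.height i.hi)) :=
    D.toMatching.sum_height_join i.lo_ne_hi h.symm i.1 (min (D.height i.lo) (D.height i.hi))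
  omega

theorem heightSum_le_act (i : GenIdx N) (D : ArcDiagram N) :
    D.heightSum ≤ (act i D).heightSum + 2 := by
  have hlo := height_lo_le i D
  by_cases h : D.mate i.lo = i.hi
  · have := heightSum_act_of_mate h
    omega
  · have hhi := height_hi_le i D
    have := heightSum_act_of_not_mate h
    omega

theorem weight_eq_one {K : Type*} [CommMonoid K] (X Y : ℕ → K)
    (h : D.heightSum = (act i D).heightSum + 2) : weight X Y i D = 1 := by
  by_cases h' : D.mate i.lo = i.hi
  · have hlo := height_lo_le i D
    have := heightSum_act_of_mate h'
    omega
  · have := heightSum_act_of_not_mate h'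
    rw [weight_of_not_mate h', show max (D.height i.lo) (D.height i.hi) = i.1 + 1 by omega,
      stepProd_self]

theorem ofWord_cons (i : GenIdx N) (w : List (GenIdx N)) : ofWord (i :: w) = act i (ofWord w) := rfl

theorem heightSum_id_le (w : List (GenIdx N)) :
    (ArcDiagram.id N).heightSum ≤ (ofWord w).heightSum + 2 * w.length := by
  induction w with
  | nil => exact le_rfl
  | cons i w ih =>
    have := heightSum_le_act i (ofWord w)
    rw [ofWord_cons, List.length_cons]
    omega

/-- A word is reduced if each of its letters lowers the sum of the labels by `2`. -/
def IsReduced (w : List (GenIdx N)) : Prop :=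
  (ArcDiagram.id N).heightSum = (ofWord w).heightSum + 2 * w.length

theorem IsReduced.cons_iff {w : List (GenIdx N)} :
    IsReduced (i :: w) ↔ IsReduced w ∧ (ofWord w).heightSum = (act i (ofWord w)).heightSum + 2 := by
  have hw := heightSum_id_le w
  have hi := heightSum_le_act i (ofWord w)
  rw [IsReduced, IsReduced, ofWord_cons, List.length_cons]
  omega

theorem IsReduced.reverse {w : List (GenIdx N)} (h : IsReduced w) : IsReduced w.reverse := by
  rw [IsReduced, ofWord_reverse, heightSum_mirror, List.length_reverse]
  exact h

end ArcDiagram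

/-! ### The representation on formal combinations of diagrams -/

section Representation

open ArcDiagram

variable {K : Type*} [Field K] {N : ℕ} (X Y : ℕ → K) {i j : GenIdx N}

/-- The operator of the generator `E_i` on the formal combinations of diagrams. -/
noncomputable def genOp (i : GenIdx N) : (ArcDiagram N →₀ K) →ₗ[K] (ArcDiagram N →₀ K) :=
  Finsupp.linearCombination K fun D => Finsupp.single (act i D) (weight X Y i D)

theorem genOp_single (i : GenIdx N) (D : ArcDiagram N) (c : K) :
    genOp X Y i (Finsupp.single D c) = Finsupp.single (act i D) (c * weight X Y i D) := by
  rw [genOp, Finsupp.linearCombination_single, Finsupp.smul_single, smul_eq_mul]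

theorem genOp_mul_self (i : GenIdx N) : genOp X Y i * genOp X Y i = X i.1 • genOp X Y i :=
  Finsupp.lhom_ext fun D c => by
    rw [Module.End.mul_apply, LinearMap.smul_apply]
    simp only [genOp_single]
    rw [act_act_self, weight_act_self, Finsupp.smul_single, smul_eq_mul, mul_comm]

theorem genOp_comm (h : i.1 + 2 ≤ j.1 ∨ j.1 + 2 ≤ i.1) :
    genOp X Y i * genOp X Y j = genOp X Y j * genOp X Y i :=
  Finsupp.lhom_ext fun D c => by
    rw [Module.End.mul_apply, Module.End.mul_apply]
    simp only [genOp_single]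
    rw [act_comm h, mul_assoc, mul_assoc, weight_comm h]

theorem genOp_braid (h : j.1 = i.1 + 1) :
    genOp X Y j * genOp X Y i * genOp X Y j = Y i.1 • genOp X Y j :=
  Finsupp.lhom_ext fun D c => by
    rw [Module.End.mul_apply, Module.End.mul_apply, LinearMap.smul_apply]
    simp only [genOp_single]
    rw [act_act_act h, weight_act_succ h, weight_act_act h, Finsupp.smul_single, smul_eq_mul,
      mul_one, mul_comm]

/-- The generator `E_i` of the Okada algebra. -/
def gen (i : GenIdx N) : OkadaAlgebra K N X Y :=
  RingQuot.mkAlgHom K (OkadaRel K N X Y) (FreeAlgebra.ι K i)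

/-- The product of generators along a word. -/
def wordProd (w : List (GenIdx N)) : OkadaAlgebra K N X Y := (w.map (gen X Y)).prod

theorem wordProd_cons (i : GenIdx N) (w : List (GenIdx N)) :
    wordProd X Y (i :: w) = gen X Y i * wordProd X Y w := List.prod_cons

theorem gen_mul_self (i : GenIdx N) : gen X Y i * gen X Y i = X i.1 • gen X Y i := by
  have h := RingQuot.mkAlgHom_rel K (OkadaRel.idem (K := K) (X := X) (Y := Y) i)
  rwa [map_mul, map_smul] at h

theorem gen_comm (h : i.1 + 2 ≤ j.1 ∨ j.1 + 2 ≤ i.1) :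
    gen X Y i * gen X Y j = gen X Y j * gen X Y i := by
  have h := RingQuot.mkAlgHom_rel K (OkadaRel.comm (K := K) (X := X) (Y := Y) i j h)
  rwa [map_mul, map_mul] at h

theorem gen_braid (h : j.1 = i.1 + 1) :
    gen X Y j * gen X Y i * gen X Y j = Y i.1 • gen X Y j := by
  have h := RingQuot.mkAlgHom_rel K (OkadaRel.succ (K := K) (X := X) (Y := Y) i j h)
  rwa [map_mul, map_mul, map_smul] at h

/-- The universal property of the Okada algebra. -/
noncomputable def okadaLift {A : Type*} [Ring A] [Algebra K A] (f : GenIdx N → A)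
    (hself : ∀ i, f i * f i = X i.1 • f i)
    (hcomm : ∀ i j : GenIdx N, i.1 + 2 ≤ j.1 ∨ j.1 + 2 ≤ i.1 → f i * f j = f j * f i)
    (hbraid : ∀ i j : GenIdx N, j.1 = i.1 + 1 → f j * f i * f j = Y i.1 • f j) :
    OkadaAlgebra K N X Y →ₐ[K] A :=
  RingQuot.liftAlgHom K ⟨FreeAlgebra.lift K f, by
    intro a b h
    induction h with
    | idem i => simpa using hself i
    | comm i j h => simpa using hcomm i j h
    | succ i j h => simpa using hbraid i j h⟩

theorem okadaLift_gen {A : Type*} [Ring A] [Algebra K A] (f : GenIdx N → A)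
    (hself : ∀ i, f i * f i = X i.1 • f i)
    (hcomm : ∀ i j : GenIdx N, i.1 + 2 ≤ j.1 ∨ j.1 + 2 ≤ i.1 → f i * f j = f j * f i)
    (hbraid : ∀ i j : GenIdx N, j.1 = i.1 + 1 → f j * f i * f j = Y i.1 • f j) (i : GenIdx N) :
    okadaLift X Y f hself hcomm hbraid (gen X Y i) = f i := by
  simp [okadaLift, gen]

theorem adjoin_range_gen : Algebra.adjoin K (Set.range (gen (N := N) X Y)) = ⊤ := by
  have h : Set.range (gen (N := N) X Y) =
      RingQuot.mkAlgHom K (OkadaRel K N X Y) '' Set.range (FreeAlgebra.ι K) :=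
    Set.range_comp _ _
  rw [h, ← AlgHom.map_adjoin, FreeAlgebra.adjoin_range_ι, Algebra.map_top,
    AlgHom.range_eq_top]
  exact RingQuot.mkAlgHom_surjective K (OkadaRel K N X Y)

/-- The action of the Okada algebra on the formal combinations of diagrams. -/
noncomputable def rep : OkadaAlgebra K N X Y →ₐ[K] Module.End K (ArcDiagram N →₀ K) :=
  okadaLift X Y (genOp X Y) (genOp_mul_self X Y) (fun _ _ => genOp_comm X Y)
    (fun _ _ => genOp_braid X Y)

/-- The image of the identity diagram under the action of an element. -/
noncomputable def vec : OkadaAlgebra K N X Y →ₗ[K] (ArcDiagram N →₀ K) :=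
  (LinearMap.applyₗ (Finsupp.single (ArcDiagram.id N) 1)).comp (rep X Y).toLinearMap

theorem vec_one : vec X Y (1 : OkadaAlgebra K N X Y) = Finsupp.single (ArcDiagram.id N) 1 := by
  simp [vec]

theorem vec_gen_mul (i : GenIdx N) (a : OkadaAlgebra K N X Y) :
    vec X Y (gen X Y i * a) = genOp X Y i (vec X Y a) := by
  simp [vec, rep, okadaLift_gen]

theorem vec_wordProd_of_isReduced {w : List (GenIdx N)} (h : IsReduced w) :
    vec X Y (wordProd X Y w) = Finsupp.single (ofWord w) 1 := by
  induction w with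
  | nil => exact vec_one X Y
  | cons i w ih =>
    obtain ⟨hw, hi⟩ := IsReduced.cons_iff.1 h
    rw [wordProd_cons, vec_gen_mul, ih hw, genOp_single, weight_eq_one X Y hi, mul_one,
      ofWord_cons]

end Representation

/-! ### Every diagram has a reduced word -/

section Cut

variable {N : ℕ} {M : LabelledMatching (Node N)} {p q u v w : Node N}

namespace LabelledMatching

/-- The situation in which an elementary diagram can be split off: `{p, q}` is the first arc with
both ends on the left, all the labels up to `p` are as large as possible, and `v` is the first node
after `q` whose label is at most the position of `p`. -/
structure IsCut (M : LabelledMatching (Node N)) (p q v : Node N) : Prop where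
  pos_right : q.pos = p.pos + 1
  right_le : q.pos ≤ N
  mate_left : M.mate p = q
  height_eq_pos : ∀ u, u.pos ≤ p.pos → M.height u = u.pos
  right_lt_pos : q.pos < v.pos
  height_le : M.height v ≤ p.pos
  lt_height : ∀ u, q.pos < u.pos → u.pos < v.pos → p.pos < M.height u

/-- Removing the arcs `{p, q}` and `{v, mate v}` and adding `{q, v}` and `{p, mate v}`. -/
def cut (M : LabelledMatching (Node N)) (q v : Node N) : LabelledMatching (Node N) :=
  M.join q v q.pos (M.height v)

namespace IsCut

theorem mate_right (h : M.IsCut p q v) : M.mate q = p := by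
  rw [← h.mate_left, M.mate_mate]

theorem ne_mate_right (h : M.IsCut p q v) : v ≠ M.mate q := by
  rintro rfl
  have := h.right_lt_pos
  have := h.pos_right
  rw [h.mate_right] at *
  omega

theorem right_ne (h : M.IsCut p q v) : q ≠ v := by
  rintro rfl
  exact lt_irrefl _ h.right_lt_pos

theorem mate_ne_ends (h : M.IsCut p q v) (hp : u.pos ≠ p.pos) (hq : u.pos ≠ q.pos) :
    (M.mate u).pos ≠ p.pos ∧ (M.mate u).pos ≠ q.pos :=
  ⟨Node.pos_injective.ne fun e => hq (by rw [← h.mate_left, ← e, M.mate_mate]),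
    Node.pos_injective.ne fun e => hp (by rw [← h.mate_right, ← e, M.mate_mate])⟩

theorem le_pos_mate (h : M.IsCut p q v) (hw : w.pos < p.pos) : v.pos ≤ (M.mate w).pos := by
  by_contra! hlt
  have := h.pos_right
  have hw' := h.height_eq_pos w hw.le
  have hne := h.mate_ne_ends (u := w) (by omega) (by omega)
  have hmate := M.height_mate w
  rcases lt_or_gt_of_ne hne.1 with hp | hp
  · have := h.height_eq_pos (M.mate w) hp.le
    have := Node.pos_injective.ne (M.mate_ne w)
    omega
  · have := h.lt_height (M.mate w) (by omega) hlt
    omega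

theorem mate_lt_left (h : M.IsCut p q v) (hv : (M.mate v).pos < v.pos) :
    (M.mate v).pos < p.pos := by
  by_contra! hle
  have := h.right_lt_pos
  have := h.pos_right
  have := h.height_le
  have := h.mate_ne_ends (u := v) (by omega) (by omega)
  have := h.lt_height (M.mate v) (by omega) hv
  rw [M.height_mate] at this
  omega

theorem height_cases (hM : M.IsOkada) (h : M.IsCut p q v) :
    (v.pos < (M.mate v).pos ∧ M.height v = p.pos) ∨
      ((M.mate v).pos + 1 = p.pos ∧ M.height v + 1 = p.pos) := by
  have hlt := h.right_lt_pos
  have hadj := h.pos_right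
  have hle := h.height_le
  have hone := hM.one_le_height v
  have hbounds := p.pos_bounds
  rcases lt_or_gt_of_ne (Node.pos_injective.ne (M.mate_ne v)) with hv | hv
  · right
    have hmate := h.mate_lt_left hv
    have hheight := h.height_eq_pos (M.mate v) hmate.le
    rw [M.height_mate] at hheight
    obtain ⟨w, hw⟩ := Node.exists_pos_eq (N := N) (k := p.pos - 1)
      (by have := (M.mate v).pos_bounds; omega) (by omega)
    have hw' := h.le_pos_mate (w := w) (by omega)
    have hcov := hM.noncrossing v w
    simp only [Covers, Node.Between] at hcov
    omega
  · left
    refine ⟨hv, ?_⟩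
    rcases eq_or_ne p.pos 1 with hp | hp
    · omega
    obtain ⟨w, hw⟩ := Node.exists_pos_eq (N := N) (k := p.pos - 1) (by omega) (by omega)
    have hw' := h.le_pos_mate (w := w) (by omega)
    have hne : (M.mate w).pos ≠ v.pos := Node.pos_injective.ne fun e => by
      rw [← e, M.mate_mate] at hv
      omega
    have hcov := hM.height_lt w v (.inl ⟨by omega, by omega⟩)
    rw [h.height_eq_pos w (by omega)] at hcov
    omega

theorem between_mate (hM : M.IsOkada) (h : M.IsCut p q v) (hu : Node.Between q v u) :
    Node.Between q v (M.mate u) := by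
  have hlt := h.right_lt_pos
  have hadj := h.pos_right
  have hle := h.height_le
  simp only [Node.Between] at hu ⊢
  have hheight := h.lt_height u (by omega) (by omega)
  have hne := h.mate_ne_ends (u := u) (by omega) (by omega)
  have hnev : (M.mate u).pos ≠ v.pos := Node.pos_injective.ne fun e => by
    rw [← M.height_mate, e] at hheight
    omega
  have hpos := hM.height_le_pos (M.mate u)
  rw [M.height_mate] at hpos
  have hcov := hM.height_lt u v
  simp only [Covers, Node.Between] at hcov
  omega

theorem right_lt_height (hM : M.IsOkada) (h : M.IsCut p q v) (hu : Node.Between q v u) :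
    q.pos < M.height u := by
  have hlt := h.right_lt_pos
  have hadj := h.pos_right
  induction hk : u.pos using Nat.strong_induction_on generalizing u with | _ k ih
  by_contra! hle
  have hmate := h.between_mate hM hu
  simp only [Node.Between] at hu hmate
  have hheight := h.lt_height u (by omega) (by omega)
  have hfirst : ∀ x : Node N, q.pos < x.pos → x.pos < u.pos → q.pos < M.height x :=
    fun x hx hx' => ih x.pos (by omega) (.inl ⟨hx, by omega⟩) rfl
  have hsource : u.pos < (M.mate u).pos := by
    have := Node.pos_injective.ne (M.mate_ne u)
    have := hfirst (M.mate u)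
    rw [M.height_mate] at this
    omega
  have heven : (q.pos + u.pos) % 2 = 1 := by
    refine M.even_card_of_mate_closed (by omega) (by have := u.pos_bounds; omega)
      fun x hx hx' => ?_
    have hxmate := h.between_mate hM (u := x) (.inl ⟨hx, by omega⟩)
    simp only [Node.Between] at hxmate
    have := hfirst x hx hx'
    have hne : (M.mate x).pos ≠ u.pos := Node.pos_injective.ne fun e => by
      rw [← e, M.height_mate] at hle
      omega
    have hcov := hM.height_lt x u
    simp only [Covers, Node.Between] at hcov
    omega
  have := hM.height_parity u
  omega

theorem right_le_abs (hM : M.IsOkada) (h : M.IsCut p q v) : q.pos ≤ v.abs := by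
  have hlt := h.right_lt_pos
  have := v.pos_bounds
  have := h.right_le
  by_contra! hle
  obtain ⟨w, hw⟩ := Node.exists_pos_eq (N := N) (k := v.pos - 1) (by omega) (by omega)
  have := w.pos_bounds
  have := h.right_lt_height hM (u := w) (.inl ⟨by omega, by omega⟩)
  have := hM.height_le_abs w
  omega

theorem cut_cases (h : M.IsCut p q v) (u : Node N) :
    (u = q ∧ (M.cut q v).mate u = v ∧ (M.cut q v).height u = q.pos) ∨
    (u = v ∧ (M.cut q v).mate u = q ∧ (M.cut q v).height u = q.pos) ∨
    (u = p ∧ (M.cut q v).mate u = M.mate v ∧ (M.cut q v).height u = M.height v) ∨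
    (u = M.mate v ∧ (M.cut q v).mate u = p ∧ (M.cut q v).height u = M.height v) ∨
    (u ≠ q ∧ u ≠ v ∧ u ≠ p ∧ u ≠ M.mate v ∧
      (M.cut q v).mate u = M.mate u ∧ (M.cut q v).height u = M.height u) := by
  have hcases := M.join_cases h.right_ne q.pos (M.height v) u
  rw [h.mate_right] at hcases
  unfold cut
  tauto

theorem noncrossing_cut (hM : M.IsOkada) (h : M.IsCut p q v) : (M.cut q v).Noncrossing := by
  refine hM.noncrossing.join h.right_ne fun w hw => ?_
  have hmate := h.between_mate hM hw
  have hlt := h.right_lt_pos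
  have hadj := h.pos_right
  rcases h.cut_cases w with ⟨rfl, -⟩ | ⟨rfl, -⟩ | ⟨rfl, -⟩ | ⟨rfl, -⟩ | ⟨-, -, -, -, e, -⟩
  · simp only [Node.Between] at hw; omega
  · simp only [Node.Between] at hw; omega
  · simp only [Node.Between] at hw; omega
  · rw [M.mate_mate] at hmate
    simp only [Node.Between] at hmate; omega
  · rwa [← e] at hmate

theorem height_lt_cut (hM : M.IsOkada) (h : M.IsCut p q v) (huq : u ≠ q) (huv : u ≠ v)
    (hup : u ≠ p) (huv' : u ≠ M.mate v) (huw : M.Covers u w) :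
    M.height u < (M.cut q v).height w := by
  have hadj := h.pos_right
  have hle := h.height_le
  have hup' : u ≠ M.mate q := by rwa [h.mate_right]
  have hiff : M.Covers u q ↔ M.Covers u v := covers_iff_of_between_iff huq hup' huv huv'
    ⟨h.between_mate hM, fun hu => by simpa only [M.mate_mate] using h.between_mate hM hu⟩
  have hmin (hcov : M.Covers u v) : M.height u < M.height v := hM.height_lt u v hcov
  have hlt := hM.height_lt u w huw
  rcases h.cut_cases w with ⟨rfl, -, e⟩ | ⟨rfl, -, e⟩ | ⟨rfl, -, e⟩ | ⟨rfl, -, e⟩ |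
    ⟨-, -, -, -, -, e⟩ <;> rw [e]
  · have := hmin (hiff.1 huw)
    omega
  · omega
  · rw [← h.mate_right, hM.noncrossing.covers_mate_iff] at huw
    exact hmin (hiff.1 huw)
  · rwa [M.height_mate] at hlt
  · exact hlt

theorem height_lt_cut_of_between (hM : M.IsOkada) (h : M.IsCut p q v)
    (hw : Node.Between p (M.mate v) w) : M.height v < (M.cut q v).height w := by
  have hadj := h.pos_right
  have hle := h.height_le
  have hpos := h.right_lt_pos
  simp only [Node.Between] at hw
  rcases h.height_cases hM with ⟨hv, hheight⟩ | ⟨hv, -⟩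
  · rcases h.cut_cases w with ⟨rfl, -, e⟩ | ⟨rfl, -, e⟩ | ⟨rfl, -, e⟩ | ⟨rfl, -, e⟩ |
      ⟨hwq, hwv, -, -, -, e⟩ <;> rw [e]
    · omega
    · omega
    · omega
    · omega
    · have := Node.pos_injective.ne hwq
      have := Node.pos_injective.ne hwv
      rcases lt_or_ge w.pos v.pos with hwv | hwv
      · have := h.lt_height w (by omega) hwv
        omega
      · exact hM.height_lt v w (.inl ⟨by omega, by omega⟩)
  · omega

theorem right_lt_cut_of_between (hM : M.IsOkada) (h : M.IsCut p q v) (hw : Node.Between q v w) :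
    q.pos < (M.cut q v).height w := by
  have hadj := h.pos_right
  have hpos := h.right_lt_pos
  have hlt := h.right_lt_height hM hw
  have hmate := h.between_mate hM hw
  rcases h.cut_cases w with ⟨rfl, -⟩ | ⟨rfl, -⟩ | ⟨rfl, -⟩ | ⟨rfl, -⟩ | ⟨-, -, -, -, -, e⟩
  · simp only [Node.Between] at hw; omega
  · simp only [Node.Between] at hw; omega
  · simp only [Node.Between] at hw; omega
  · rw [M.mate_mate] at hmate
    simp only [Node.Between] at hmate; omega
  · rwa [e]

theorem cut_height_lt (h : M.IsCut p q v) (hM : M.IsOkada) (huw : (M.cut q v).Covers u w) :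
    (M.cut q v).height u < (M.cut q v).height w := by
  rw [Covers] at huw
  rcases h.cut_cases u with ⟨rfl, e, e'⟩ | ⟨rfl, e, e'⟩ | ⟨rfl, e, e'⟩ | ⟨rfl, e, e'⟩ |
    ⟨huq, huv, hup, huv', e, e'⟩ <;> rw [e] at huw <;> rw [e']
  · exact h.right_lt_cut_of_between hM huw
  · exact h.right_lt_cut_of_between hM huw.symm
  · exact h.height_lt_cut_of_between hM huw
  · exact h.height_lt_cut_of_between hM huw.symm
  · exact h.height_lt_cut hM huq huv hup huv' huw

theorem isOkada_cut (hM : M.IsOkada) (h : M.IsCut p q v) : (M.cut q v).IsOkada where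
  noncrossing := h.noncrossing_cut hM
  one_le_height u := by
    have := q.pos_bounds
    have := hM.one_le_height u
    have := hM.one_le_height v
    rcases h.cut_cases u with ⟨-, -, e⟩ | ⟨-, -, e⟩ | ⟨-, -, e⟩ | ⟨-, -, e⟩ |
      ⟨-, -, -, -, -, e⟩ <;> omega
  height_le_abs u := by
    have hle := h.height_le
    have hright := h.right_le
    have hadj := h.pos_right
    rcases h.cut_cases u with ⟨rfl, -, e⟩ | ⟨rfl, -, e⟩ | ⟨rfl, -, e⟩ | ⟨rfl, -, e⟩ |
      ⟨-, -, -, -, -, e⟩ <;> rw [e]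
    · have := u.pos_bounds
      omega
    · exact h.right_le_abs hM
    · have := u.pos_bounds
      omega
    · rw [← M.height_mate]
      exact hM.height_le_abs _
    · exact hM.height_le_abs u
  height_parity u := by
    have hadj := h.pos_right
    have hpos := h.right_lt_pos
    have hcases := h.height_cases hM
    rcases h.cut_cases u with ⟨rfl, e, e'⟩ | ⟨rfl, e, e'⟩ | ⟨rfl, e, e'⟩ | ⟨rfl, e, e'⟩ |
      ⟨-, -, -, -, e, e'⟩ <;> rw [e, e']
    · omega
    · omega
    · omega
    · omega
    · exact hM.height_parity u
  height_lt _ _ := h.cut_height_lt hM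

theorem joinMin_cut (h : M.IsCut p q v) : (M.cut q v).joinMin p q p.pos = M := by
  have hpq : p ≠ q := h.mate_right ▸ M.mate_ne q
  have hp : (M.cut q v).height p = M.height v := by
    have := h.pos_right
    have := h.right_lt_pos
    rcases h.cut_cases p with ⟨rfl, -⟩ | ⟨rfl, -⟩ | ⟨-, -, e⟩ | ⟨-, -, e⟩ | ⟨-, -, hne, -⟩
    · omega
    · omega
    · exact e
    · exact e
    · exact (hne rfl).elim
  have hq : (M.cut q v).height q = q.pos := M.join_height_left q v q.pos _
  have hle := h.height_le
  have hadj := h.pos_right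
  have hheight : M.height q = p.pos := by
    rw [← h.mate_left, M.height_mate, h.height_eq_pos p le_rfl]
  have hjoin := M.join_join_mate h.right_ne h.ne_mate_right q.pos (M.height v)
  rw [h.mate_right, hheight] at hjoin
  rw [joinMin, hp, hq, min_eq_left (by omega), join_comm _ hpq]
  exact hjoin

theorem sum_height_cut (h : M.IsCut p q v) :
    ∑ u, (M.cut q v).height u = ∑ u, M.height u + 2 := by
  have hsum := M.sum_height_join h.right_ne h.ne_mate_right q.pos (M.height v)
  have hadj := h.pos_right
  have hheight : M.height q = p.pos := by
    rw [← h.mate_left, M.height_mate, h.height_eq_pos p le_rfl]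
  rw [hheight] at hsum
  unfold cut
  linarith

end IsCut

end LabelledMatching

end Cut

namespace ArcDiagram

variable {N : ℕ} {D : ArcDiagram N}

theorem lt_pos_mate_of_height_eq {u : Node N} (h : D.height u = u.pos) :
    u.pos < (D.mate u).pos := by
  have hle := D.isOkada_toMatching.height_le_pos (D.mate u)
  have hne := Node.pos_injective.ne (D.mate_ne u)
  have hmate : D.toMatching.height (D.mate u) = D.height u := D.height_mate u
  omega

theorem mate_inl_eq_inr (h : ∀ u : Node N, u.pos ≤ N → D.height u = u.pos) (a : Fin N) :
    D.mate (Sum.inl a) = Sum.inr a := by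
  have hlt (a : Fin N) := lt_pos_mate_of_height_eq
    (h (Sum.inl a) (by simp only [Node.pos]; omega))
  have hright (a : Fin N) : ∃ b, D.mate (Sum.inl a) = Sum.inr b := by
    cases e : D.mate (Sum.inl a) with
    | inr b => exact ⟨b, rfl⟩
    | inl b =>
      have ha := hlt a
      have hb := hlt b
      rw [← e, D.mate_mate] at hb
      omega
  choose f hf using hright
  have hmono : StrictMono f := fun a b hab => by
    have hcov := D.noncrossing_toMatching (Sum.inl a) (Sum.inl b)
    simp only [LabelledMatching.Covers, Node.Between, toMatching, hf, Node.pos] at hcov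
    rw [Fin.lt_def] at hab ⊢
    omega
  have hid : f = _root_.id := by
    refine (hmono.range_inj strictMono_id).1 ?_
    rw [Set.range_id, (Finite.injective_iff_surjective.1 hmono.injective).range_eq]
  rw [hf, hid]
  rfl

theorem eq_id_of_height_eq_pos (h : ∀ u : Node N, u.pos ≤ N → D.height u = u.pos) :
    D = ArcDiagram.id N := by
  have hmate := mate_inl_eq_inr h
  have hheight (a : Fin N) : D.height (Sum.inl a) = a + 1 :=
    h (Sum.inl a) (by simp only [Node.pos]; omega)
  apply ArcDiagram.ext <;> funext u <;> rcases u with a | a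
  · exact hmate a
  · exact (D.mate_involutive.eq_iff.1 (hmate a)).symm
  · exact hheight a
  · exact (congrArg D.height (hmate a)).symm.trans ((D.height_mate _).trans (hheight a))

theorem exists_mate_lo_eq_hi (h : D ≠ ArcDiagram.id N) :
    ∃ i : GenIdx N, (∀ u : Node N, u.pos ≤ i.lo.pos → D.height u = u.pos) ∧
      D.mate i.lo = i.hi := by
  by_contra! hnone
  suffices hopen : ∀ k ≤ N, ∀ u : Node N, u.pos ≤ k → D.height u = u.pos from
    h (eq_id_of_height_eq_pos (hopen N le_rfl))
  intro k
  induction k with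
  | zero =>
    intro _ u hu
    have := u.pos_bounds
    omega
  | succ k ih =>
    intro hk u hu
    have hopen := ih (by omega)
    rcases Nat.lt_or_ge k u.pos with hku | hku
    · have hone := D.one_le_height u
      have hle : D.height u ≤ u.pos := D.isOkada_toMatching.height_le_pos u
      rcases Nat.eq_zero_or_pos k with rfl | hkpos
      · omega
      let i : GenIdx N := ⟨k, hkpos, by omega⟩
      have hlo : i.lo.pos = k := i.pos_lo
      have hhi : i.hi.pos = k + 1 := i.pos_hi
      have hlt := lt_pos_mate_of_height_eq (hopen i.lo hlo.le)
      have hne := Node.pos_injective.ne (hnone i (hlo ▸ hopen))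
      have hcov : D.height i.lo < D.height i.hi :=
        D.isOkada_toMatching.height_lt i.lo i.hi (.inl ⟨by omega, by
          change i.hi.pos < (D.mate i.lo).pos
          omega⟩)
      rw [hopen i.lo hlo.le, show i.hi = u from Node.pos_injective (by omega)] at hcov
      omega
    · exact hopen u hku

theorem exists_isCut (h : D ≠ ArcDiagram.id N) :
    ∃ (i : GenIdx N) (v : Node N), D.toMatching.IsCut i.lo i.hi v := by
  obtain ⟨i, hopen, hmate⟩ := exists_mate_lo_eq_hi h
  have hlo := i.pos_lo
  have hhi := i.pos_hi
  obtain ⟨v, hv, hmin⟩ := Finset.exists_min_image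
    (Finset.univ.filter fun v : Node N => i.hi.pos < v.pos ∧ D.height v ≤ i.lo.pos) Node.pos <| by
      obtain ⟨v, hv⟩ := Node.exists_pos_eq (N := N) (k := 2 * N) (by omega) le_rfl
      refine ⟨v, Finset.mem_filter.2 ⟨Finset.mem_univ v, by omega, ?_⟩⟩
      have := D.height_le v
      have := v.pos_bounds
      omega
  rw [Finset.mem_filter] at hv
  refine ⟨i, v, by omega, by omega, hmate, hopen, hv.2.1, hv.2.2, fun u hu huv => ?_⟩
  by_contra! hle
  exact huv.not_ge (hmin u (Finset.mem_filter.2 ⟨Finset.mem_univ u, hu, hle⟩))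

theorem exists_act_eq (h : D ≠ ArcDiagram.id N) :
    ∃ i D', act i D' = D ∧ D'.heightSum = D.heightSum + 2 := by
  obtain ⟨i, v, hcut⟩ := exists_isCut h
  refine ⟨i, ofMatching _ (hcut.isOkada_cut D.isOkada_toMatching), toMatching_injective ?_,
    hcut.sum_height_cut⟩
  have := hcut.joinMin_cut
  rwa [i.pos_lo] at this

theorem heightSum_le_heightSum_id (D : ArcDiagram N) : D.heightSum ≤ (ArcDiagram.id N).heightSum :=
  Finset.sum_le_sum fun u _ => (D.height_le u).trans (min_le_left _ _)

theorem exists_isReduced_ofWord_eq (D : ArcDiagram N) : ∃ w, IsReduced w ∧ ofWord w = D := by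
  induction hn : (ArcDiagram.id N).heightSum - D.heightSum using Nat.strong_induction_on
    generalizing D with | _ n ih
  rcases eq_or_ne D (ArcDiagram.id N) with rfl | h
  · exact ⟨[], rfl, rfl⟩
  obtain ⟨i, D', hact, hsum⟩ := exists_act_eq h
  have hle := heightSum_le_heightSum_id D'
  obtain ⟨w, hw, rfl⟩ := ih _ (by omega) D' rfl
  exact ⟨i :: w, IsReduced.cons_iff.2 ⟨hw, by rw [hact]; exact hsum⟩, hact⟩

end ArcDiagram

/-! ### Permutations and their codes -/

section Code

variable {N : ℕ}

theorem lt_of_card_filter_lt_eq {ι α : Type*} [LinearOrder α] {s : Finset ι} {f g : ι → α}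
    (hfg : ∀ j ∈ s, ∀ k ∈ s, (f j < f k ↔ g j < g k)) {m : ι}
    (hcard : (s.filter fun k => f m < f k).card = (s.filter fun k => g m < g k).card)
    {j : ι} (hj : j ∈ s) (hlt : f m < f j) : g m < g j := by
  by_contra! hle
  have hsub : (s.filter fun k => g m < g k) ⊂ s.filter fun k => f m < f k := by
    refine (Finset.ssubset_iff_of_subset fun k hk => ?_).2
      ⟨j, Finset.mem_filter.2 ⟨hj, hlt⟩, fun h => hle.not_gt (Finset.mem_filter.1 h).2⟩
    obtain ⟨hks, hk⟩ := Finset.mem_filter.1 hk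
    exact Finset.mem_filter.2 ⟨hks, hlt.trans ((hfg j hj k hks).2 (hle.trans_lt hk))⟩
  exact (Finset.card_lt_card hsub).ne hcard.symm

theorem equiv_fin_eq_of_lt_iff {ι : Type*} {f g : ι ≃ Fin N}
    (h : ∀ a b, f a < f b ↔ g a < g b) : f = g := by
  have hmono : StrictMono (f.symm.trans g) := fun a b hab => by
    simpa using (h (f.symm a) (f.symm b)).1 (by simpa using hab)
  have hid : ⇑(f.symm.trans g) = id := (hmono.range_inj strictMono_id).1 <| by
    rw [(f.symm.trans g).range_eq_univ, Set.range_id]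
  ext a
  simpa using (congrArg Fin.val (congrFun hid (f a))).symm

theorem codeAt_eq_card (σ : Equiv.Perm (Fin N)) (i : Fin N) :
    codeAt σ i = ((Finset.Iio i).filter fun j => σ⁻¹ i < σ⁻¹ j).card := by
  rw [codeAt]
  congr 1
  ext j
  simp

theorem inv_lt_inv_iff_of_codeAt_eq {σ τ : Equiv.Perm (Fin N)}
    (h : ∀ i, codeAt σ i = codeAt τ i) (i : ℕ) {j k : Fin N} (hj : j.1 < i) (hk : k.1 < i) :
    σ⁻¹ j < σ⁻¹ k ↔ τ⁻¹ j < τ⁻¹ k := by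
  induction i generalizing j k with
  | zero => omega
  | succ i ih =>
    have hbelow {j m : Fin N} (hm : m.1 = i) (hj : j < m) : σ⁻¹ m < σ⁻¹ j ↔ τ⁻¹ m < τ⁻¹ j := by
      have hcode := h m
      rw [codeAt_eq_card, codeAt_eq_card] at hcode
      have hord : ∀ a ∈ Finset.Iio m, ∀ b ∈ Finset.Iio m, (σ⁻¹ a < σ⁻¹ b ↔ τ⁻¹ a < τ⁻¹ b) :=
        fun a ha b hb => ih (hm ▸ Fin.lt_def.1 (Finset.mem_Iio.1 ha))
          (hm ▸ Fin.lt_def.1 (Finset.mem_Iio.1 hb))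
      exact ⟨lt_of_card_filter_lt_eq hord hcode (Finset.mem_Iio.2 hj),
        lt_of_card_filter_lt_eq (fun a ha b hb => (hord a ha b hb).symm) hcode.symm
          (Finset.mem_Iio.2 hj)⟩
    rcases Nat.lt_succ_iff_lt_or_eq.1 hj with hj | hj <;>
      rcases Nat.lt_succ_iff_lt_or_eq.1 hk with hk | hk
    · exact ih hj hk
    · have hjk : j < k := Fin.lt_def.2 (by omega)
      have hσ := σ⁻¹.injective.ne hjk.ne
      have hτ := τ⁻¹.injective.ne hjk.ne
      rw [← not_iff_not, not_lt, not_lt, le_iff_lt_or_eq, le_iff_lt_or_eq, or_iff_left hσ.symm,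
        or_iff_left hτ.symm]
      exact hbelow hk hjk
    · exact hbelow hj (Fin.lt_def.2 (by omega))
    · obtain rfl : j = k := Fin.ext (by omega)
      simp only [lt_self_iff_false]

theorem codeAt_injective : Function.Injective (codeAt (N := N)) := fun _ _ h =>
  inv_injective <| equiv_fin_eq_of_lt_iff fun a b =>
    inv_lt_inv_iff_of_codeAt_eq (congrFun h) N a.2 b.2

theorem exists_codeAt_eq (c : Fin N → ℕ) (hc : ∀ i, c i ≤ i) :
    ∃ σ : Equiv.Perm (Fin N), codeAt σ = c := by
  let code : Equiv.Perm (Fin N) → ∀ i : Fin N, Fin (i + 1) :=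
    fun σ i => ⟨codeAt σ i, Nat.lt_succ_of_le (codeAt_le σ i)⟩
  have hinj : Function.Injective code := fun σ τ h =>
    codeAt_injective <| funext fun i => congrArg Fin.val (congrFun h i)
  have hcard : Fintype.card (Equiv.Perm (Fin N)) = Fintype.card (∀ i : Fin N, Fin (i + 1)) := by
    rw [Fintype.card_perm, Fintype.card_pi, Fintype.card_fin]
    simp only [Fintype.card_fin]
    rw [Fin.prod_univ_eq_prod_range (fun i => i + 1) N, Finset.prod_range_add_one_eq_factorial]
  obtain ⟨σ, hσ⟩ := ((Fintype.bijective_iff_injective_and_card code).2 ⟨hinj, hcard⟩).2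
    fun i => ⟨c i, Nat.lt_succ_of_le (hc i)⟩
  exact ⟨σ, funext fun i => congrArg Fin.val (congrFun hσ i)⟩

/-- The word `s (s - 1) ⋯ (s - c + 1)`, in which the numbers that are not the index of a generator
are left out. -/
def descWord : ℕ → ℕ → List (GenIdx N)
  | 0, _ => []
  | c + 1, s => if h : 1 ≤ s ∧ s < N then ⟨s, h⟩ :: descWord c (s - 1) else descWord c (s - 1)

theorem descWord_succ (c : ℕ) (i : GenIdx N) :
    descWord (c + 1) i.1 = i :: descWord c (i.1 - 1) := by
  rw [descWord, dif_pos i.2]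

/-- The product of the descending words with the numbers `k, …, k + m - 1`. With `k = 0` and `m = N`
it is the word of the permutation with code `c`. -/
def towerWord (c : ℕ → ℕ) (k m : ℕ) : List (GenIdx N) :=
  (List.range' k m).flatMap fun n => descWord (c n) n

theorem towerWord_succ (c : ℕ → ℕ) (k m : ℕ) :
    towerWord (N := N) c k (m + 1) = descWord (c k) k ++ towerWord c (k + 1) m := by
  rw [towerWord, List.range'_succ, List.flatMap_cons, towerWord]

theorem towerWord_zero_succ (c : ℕ → ℕ) (m : ℕ) :
    towerWord (N := N) c 0 (m + 1) = towerWord c 0 m ++ descWord (c m) m := by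
  rw [towerWord, List.range'_1_concat, List.flatMap_append, List.flatMap_singleton, zero_add,
    towerWord]

theorem towerWord_congr {c d : ℕ → ℕ} {k m : ℕ} (h : ∀ n < k + m, c n = d n) :
    towerWord (N := N) c k m = towerWord d k m :=
  List.flatMap_congr fun n hn => by rw [h n (List.mem_range'_1.1 hn).2]

theorem ofFn_eq_descWord {c s : ℕ} (hc : c ≤ s) (hs : s < N) :
    (List.ofFn fun t : Fin c => (⟨s - t, by omega⟩ : GenIdx N)) = descWord c s := by
  induction c generalizing s with
  | zero => rfl
  | succ c ih =>
    rw [List.ofFn_succ, descWord, dif_pos ⟨by omega, hs⟩, ← ih (by omega) (by omega)]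
    congr! 4 with t
    rw [Fin.val_succ]
    omega

/-- The code of a permutation, extended by zero to all natural numbers. -/
def codeSeq (σ : Equiv.Perm (Fin N)) (n : ℕ) : ℕ :=
  if h : n < N then codeAt σ ⟨n, h⟩ else 0

theorem codeSeq_val (σ : Equiv.Perm (Fin N)) (i : Fin N) : codeSeq σ i = codeAt σ i :=
  dif_pos i.2

theorem codeSeq_le (σ : Equiv.Perm (Fin N)) (n : ℕ) : codeSeq σ n ≤ n := by
  unfold codeSeq
  split_ifs with h
  exacts [codeAt_le σ ⟨n, h⟩, n.zero_le]

theorem permWord_eq_towerWord (σ : Equiv.Perm (Fin N)) :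
    permWord σ = towerWord (codeSeq σ) 0 N := by
  have hblock : codeBlock σ = fun i : Fin N => descWord (codeSeq σ i) i := funext fun i => by
    rw [codeSeq_val, ← ofFn_eq_descWord (codeAt_le σ i) i.2, codeBlock]
  rw [permWord, hblock, towerWord, ← List.range_eq_range', ← List.map_coe_finRange_eq_range,
    List.flatMap_map]

end Code

namespace ArcDiagram

variable {N : ℕ} {i : GenIdx N} {D E : ArcDiagram N}

theorem mate_lo_ne_hi_of_height_hi (h : D.height i.hi = i.1 + 1) : D.mate i.lo ≠ i.hi := fun e => by
  have hlo := height_lo_le i D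
  rw [← D.height_mate, e] at hlo
  omega

theorem heightSum_act_of_height_hi (h : D.height i.hi = i.1 + 1) :
    D.heightSum = (act i D).heightSum + 2 := by
  have hlo := height_lo_le i D
  have hact := heightSum_act_of_not_mate (mate_lo_ne_hi_of_height_hi h)
  omega

theorem height_act_mate_hi (h : D.height i.hi = i.1 + 1) :
    (act i D).height (D.mate i.hi) = D.height i.lo := by
  have hlo := height_lo_le i D
  have hne := mate_lo_ne_hi_of_height_hi h
  have hne' := D.mate_ne i.hi
  have hcases := act_cases i D (D.mate i.hi)
  rw [Ne, D.mate_involutive.eq_iff] at hne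
  grind

theorem lt_height_act_of_height_hi (h : D.height i.hi = i.1 + 1) {u : Node N}
    (hu : i.1 + 1 < u.pos) (hu' : u.pos < (D.mate i.hi).pos) : i.1 < (act i D).height u := by
  have hcov : D.toMatching.Covers i.hi u := by
    have := i.pos_hi
    simp only [LabelledMatching.Covers, Node.Between]
    exact Or.inl ⟨by omega, hu'⟩
  have hmate : Node.Between i.hi (D.mate i.hi) (D.mate u) :=
    D.isOkada_toMatching.noncrossing i.hi u hcov
  have hlt : D.height i.hi < D.height u := D.isOkada_toMatching.height_lt i.hi u hcov
  have hlo := i.pos_lo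
  have hhi := i.pos_hi
  have hne : D.mate u ≠ i.lo := fun e => by
    simp only [e, Node.Between] at hmate
    omega
  have hne' : u ≠ i.lo ∧ u ≠ i.hi ∧ u ≠ D.mate i.hi := by
    refine ⟨?_, ?_, ?_⟩ <;> rintro rfl <;> omega
  rw [Ne, D.mate_involutive.eq_iff] at hne
  have hcases := act_cases i D u
  grind

theorem join_act_of_height_hi (h : D.height i.hi = i.1 + 1) :
    (act i D).toMatching.join i.hi (D.mate i.hi) (i.1 + 1) ((act i D).height (D.mate i.hi)) =
      D.toMatching := by
  have hne : i.lo ≠ D.mate i.hi :=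
    fun e => mate_lo_ne_hi_of_height_hi h (D.mate_involutive.eq_iff.2 e)
  rw [height_act_mate_hi h, ← h, toMatching_act, LabelledMatching.joinMin,
    LabelledMatching.join_comm _ i.lo_ne_hi]
  exact D.toMatching.join_join_mate i.lo_ne_hi.symm hne _ _

theorem pos_mate_hi_le_of_act_eq (hD : D.height i.hi = i.1 + 1) (hE : E.height i.hi = i.1 + 1)
    (h : act i D = act i E) : (D.mate i.hi).pos ≤ (E.mate i.hi).pos := by
  by_contra! hlt
  have hpos := lt_pos_mate_of_height_eq (hE.trans i.pos_hi.symm)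
  have hact := lt_height_act_of_height_hi hD (by rwa [i.pos_hi] at hpos) hlt
  rw [h, height_act_mate_hi hE] at hact
  exact hact.not_ge (height_lo_le i E)

-- The mate of `i.hi` is the first node after `i.hi` whose label in `act i D` is at most `i`.
theorem eq_of_act_eq (hD : D.height i.hi = i.1 + 1) (hE : E.height i.hi = i.1 + 1)
    (h : act i D = act i E) : D = E := by
  have hmate : D.mate i.hi = E.mate i.hi := Node.pos_injective <|
    (pos_mate_hi_le_of_act_eq hD hE h).antisymm (pos_mate_hi_le_of_act_eq hE hD h.symm)
  apply toMatching_injective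
  rw [← join_act_of_height_hi hD, ← join_act_of_height_hi hE, h, hmate]

theorem height_act_eq_pos (h : D.height i.hi = i.1 + 1) {u : Node N} (hu : u ≠ i.hi)
    (hfull : u ≠ i.lo → D.height u = u.pos) : (act i D).height u = u.pos := by
  have hlo := i.pos_lo
  have hle := height_lo_le i D
  have hmlo := D.height_mate i.lo
  have hmhi := D.height_mate i.hi
  have hpos := lt_pos_mate_of_height_eq (h.trans i.pos_hi.symm)
  have hhi := i.pos_hi
  rcases act_cases i D u with ⟨rfl, _, he⟩ | ⟨hu', _⟩ | ⟨rfl, _, _, he⟩ | ⟨rfl, hu', _, he⟩ |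
    ⟨hu', _, _, _, _, he⟩ <;> try rw [he]
  · exact hlo.symm
  · exact absurd hu' hu
  · have := hfull (D.mate_ne i.lo)
    omega
  · have := hfull hu'
    omega
  · exact hfull hu'

/-- All the nodes up to position `k` carry the largest label possible. -/
def FullUpTo (D : ArcDiagram N) (k : ℕ) : Prop := ∀ u : Node N, u.pos ≤ k → D.height u = u.pos

variable {c d s k m : ℕ}

namespace FullUpTo

theorem id : (ArcDiagram.id N).FullUpTo N := fun u hu => by
  have := u.pos_bounds
  change u.abs = u.pos
  omega

theorem height_foldr_descWord (hk : k ≤ N) (hD : D.FullUpTo k) (hc : c ≤ s) (hs : s < k)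
    {u : Node N} (hu : u.pos ≤ k) (hu' : u.pos ≠ s + 1) :
    ((descWord c s).foldr act D).height u = u.pos := by
  induction c generalizing s u with
  | zero => exact hD u hu
  | succ c ih =>
    obtain ⟨i, rfl⟩ : ∃ i : GenIdx N, i.1 = s := ⟨⟨s, by omega⟩, rfl⟩
    have hlo := i.pos_lo
    have hhi := i.pos_hi
    have hfull {v : Node N} (hv : v.pos ≤ k) (hvi : v.pos ≠ i.1) :
        ((descWord c (i.1 - 1)).foldr act D).height v = v.pos :=
      ih (by omega) (by omega) hv (by omega)
    rw [descWord_succ, List.foldr_cons]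
    refine height_act_eq_pos ((hfull (by omega) (by omega)).trans hhi) (fun e => ?_) fun e => ?_
    · exact hu' (e ▸ hhi)
    · exact hfull hu fun e' => e (Node.pos_injective (e'.trans hlo.symm))

theorem exists_foldr_descWord_succ (hk : k ≤ N) (hD : D.FullUpTo k) (hc : c + 1 ≤ s) (hs : s < k) :
    ∃ i : GenIdx N, i.1 = s ∧ descWord (c + 1) s = i :: descWord c (s - 1) ∧
      ((descWord c (s - 1)).foldr act D).height i.hi = i.1 + 1 := by
  obtain ⟨i, rfl⟩ : ∃ i : GenIdx N, i.1 = s := ⟨⟨s, by omega⟩, rfl⟩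
  have hhi := i.pos_hi
  exact ⟨i, rfl, descWord_succ c i,
    (hD.height_foldr_descWord hk (by omega) (by omega) (by omega) (by omega)).trans hhi⟩

theorem ne_foldr_descWord_succ (hk : k ≤ N) (hD : D.FullUpTo k) (hE : E.FullUpTo k)
    (hc : c + 1 ≤ s) (hs : s < k) : D ≠ (descWord (c + 1) s).foldr act E := by
  rintro rfl
  obtain ⟨i, rfl, hw, _⟩ := hE.exists_foldr_descWord_succ hk hc hs
  have hpos := i.pos_hi
  have hhi := hD i.hi (by omega)
  rw [hw, List.foldr_cons, act_height_hi] at hhi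
  omega

theorem foldr_descWord_injective (hk : k ≤ N) (hD : D.FullUpTo k) (hE : E.FullUpTo k)
    (hc : c ≤ s) (hd : d ≤ s) (hs : s < k)
    (h : (descWord c s).foldr act D = (descWord d s).foldr act E) : c = d ∧ D = E := by
  induction c generalizing s d with
  | zero =>
    cases d with
    | zero => exact ⟨rfl, h⟩
    | succ d => exact absurd h (hD.ne_foldr_descWord_succ hk hE hd hs)
  | succ c ih =>
    cases d with
    | zero => exact absurd h.symm (hE.ne_foldr_descWord_succ hk hD hc hs)
    | succ d =>
      obtain ⟨i, rfl, hwD, hiD⟩ := hD.exists_foldr_descWord_succ hk hc hs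
      obtain ⟨j, hji, hwE, hiE⟩ := hE.exists_foldr_descWord_succ hk hd hs
      obtain rfl : j = i := Subtype.ext hji
      rw [hwD, hwE, List.foldr_cons, List.foldr_cons] at h
      obtain ⟨hcd, hDE⟩ := ih (by omega) (by omega) (by omega) (eq_of_act_eq hiD hiE h)
      exact ⟨congrArg (· + 1) hcd, hDE⟩

theorem heightSum_foldr_descWord (hk : k ≤ N) (hD : D.FullUpTo k) (hc : c ≤ s) (hs : s < k) :
    D.heightSum = ((descWord c s).foldr act D).heightSum + 2 * (descWord (N := N) c s).length := by
  induction c generalizing s with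
  | zero => rfl
  | succ c ih =>
    obtain ⟨i, rfl, hw, hi⟩ := hD.exists_foldr_descWord_succ hk hc hs
    have hact := heightSum_act_of_height_hi hi
    have hlow := ih (s := i.1 - 1) (by omega) (by omega)
    rw [hw, List.foldr_cons, List.length_cons]
    omega

end FullUpTo

section Tower

variable {a b : ℕ → ℕ}

theorem ofWord_towerWord_succ (a : ℕ → ℕ) (k m : ℕ) :
    ofWord (N := N) (towerWord a k (m + 1)) =
      (descWord (a k) k).foldr act (ofWord (towerWord a (k + 1) m)) := by
  rw [towerWord_succ, ofWord, List.foldr_append, ofWord]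

theorem fullUpTo_ofWord_towerWord (ha : ∀ n, a n ≤ n) (h : k + m = N) :
    (ofWord (N := N) (towerWord a k m)).FullUpTo k := by
  induction m generalizing k with
  | zero =>
    obtain rfl : k = N := h
    exact FullUpTo.id
  | succ m ih =>
    intro u hu
    rw [ofWord_towerWord_succ]
    exact (ih (k := k + 1) (by omega)).height_foldr_descWord (by omega) (ha k) (by omega)
      (by omega) (by omega)

theorem ofWord_towerWord_injective (ha : ∀ n, a n ≤ n) (hb : ∀ n, b n ≤ n) (h : k + m = N)
    (hab : ofWord (N := N) (towerWord a k m) = ofWord (towerWord b k m)) {n : ℕ} (hkn : k ≤ n)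
    (hn : n < N) : a n = b n := by
  induction m generalizing k with
  | zero => omega
  | succ m ih =>
    rw [ofWord_towerWord_succ, ofWord_towerWord_succ] at hab
    have hm : k + 1 + m = N := by omega
    obtain ⟨hk, htail⟩ := (fullUpTo_ofWord_towerWord ha hm).foldr_descWord_injective (by omega)
      (fullUpTo_ofWord_towerWord hb hm) (ha k) (hb k) (by omega) hab
    rcases hkn.eq_or_lt with rfl | hkn
    exacts [hk, ih hm htail hkn]

theorem isReduced_towerWord (ha : ∀ n, a n ≤ n) (h : k + m = N) :
    IsReduced (N := N) (towerWord a k m) := by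
  induction m generalizing k with
  | zero => rfl
  | succ m ih =>
    have hm : k + 1 + m = N := by omega
    have hdesc := (fullUpTo_ofWord_towerWord ha hm).heightSum_foldr_descWord (by omega) (ha k)
      (by omega)
    rw [IsReduced, ofWord_towerWord_succ, (ih hm : _ = _), towerWord_succ, List.length_append]
    omega

theorem ofWord_permWord_injective :
    Function.Injective fun σ : Equiv.Perm (Fin N) => ofWord (permWord σ) := fun σ τ h => by
  simp only [permWord_eq_towerWord] at h
  refine codeAt_injective <| funext fun i => ?_
  rw [← codeSeq_val, ← codeSeq_val]
  exact ofWord_towerWord_injective (codeSeq_le σ) (codeSeq_le τ) (Nat.zero_add N) h (Nat.zero_le _)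
    i.2

theorem isReduced_permWord (σ : Equiv.Perm (Fin N)) : IsReduced (permWord σ) := by
  rw [permWord_eq_towerWord]
  exact isReduced_towerWord (codeSeq_le σ) (Nat.zero_add N)

end Tower

end ArcDiagram

/-! ### The words of the permutations span the algebra -/

section

open ArcDiagram

theorem adjoin_le_of_mul_mem {R A : Type*} [CommSemiring R] [Semiring A] [Algebra R A] {s : Set A}
    {M : Submodule R A} (hone : 1 ∈ M) (hmul : ∀ a ∈ M, ∀ x ∈ s, a * x ∈ M) :
    Subalgebra.toSubmodule (Algebra.adjoin R s) ≤ M := by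
  rw [Algebra.adjoin_eq_span, Submodule.span_le]
  intro a ha
  induction ha using Submonoid.closure_induction_right with
  | one => exact hone
  | mul_right a _ x hx ih => exact hmul a ih x hx

section Spanning

variable {K : Type*} [Field K] {N : ℕ} {X Y : ℕ → K} {i : GenIdx N} {c d s t : ℕ}

theorem wordProd_append (v w : List (GenIdx N)) :
    wordProd X Y (v ++ w) = wordProd X Y v * wordProd X Y w := by
  rw [wordProd, List.map_append, List.prod_append, wordProd, wordProd]

theorem wordProd_descWord_zero (s : ℕ) : wordProd X Y (descWord (N := N) 0 s) = 1 :=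
  rfl

theorem wordProd_descWord_succ (c : ℕ) (i : GenIdx N) :
    wordProd X Y (descWord (c + 1) i.1) = gen X Y i * wordProd X Y (descWord c (i.1 - 1)) := by
  rw [descWord_succ, wordProd_cons]

variable (X Y) in
/-- The subalgebra generated by the `E_i` with `i < s`. -/
def lowerSubalgebra (s : ℕ) : Subalgebra K (OkadaAlgebra K N X Y) :=
  Algebra.adjoin K (gen X Y '' {i | i.1 < s})

theorem lowerSubalgebra_mono (h : s ≤ t) : lowerSubalgebra (N := N) X Y s ≤ lowerSubalgebra X Y t :=
  Algebra.adjoin_mono (Set.image_mono fun _ hi => lt_of_lt_of_le hi h)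

theorem gen_mem_lowerSubalgebra (h : i.1 < s) : gen X Y i ∈ lowerSubalgebra X Y s :=
  Algebra.subset_adjoin ⟨i, h, rfl⟩

theorem wordProd_descWord_mem_lowerSubalgebra (h : s < t) :
    wordProd X Y (descWord c s) ∈ lowerSubalgebra (N := N) X Y t := by
  induction c generalizing s with
  | zero => exact one_mem _
  | succ c ih =>
    rw [descWord]
    split_ifs
    · rw [wordProd_cons]
      exact mul_mem (gen_mem_lowerSubalgebra h) (ih (by omega))
    · exact ih (by omega)

theorem commute_gen_of_mem_lowerSubalgebra (h : s + 1 ≤ i.1) {b : OkadaAlgebra K N X Y}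
    (hb : b ∈ lowerSubalgebra X Y s) : Commute (gen X Y i) b := by
  have hle : lowerSubalgebra X Y s ≤ Subalgebra.centralizer K {gen X Y i} := by
    refine Algebra.adjoin_le ?_
    rintro _ ⟨j, hj, rfl⟩
    rw [SetLike.mem_coe, Subalgebra.mem_centralizer_iff]
    rintro _ rfl
    exact gen_comm X Y (Or.inr (by have : j.1 < s := hj; omega))
  exact Subalgebra.mem_centralizer_iff K |>.1 (hle hb) _ rfl

theorem wordProd_descWord_mul_gen_self (hs : i.1 = s + 1) (hc : c ≤ s) :
    ∃ b ∈ lowerSubalgebra X Y i.1,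
      wordProd X Y (descWord (c + 1) i.1) * gen X Y i = b * gen X Y i := by
  cases c with
  | zero =>
    refine ⟨algebraMap K _ (X i.1), Subalgebra.algebraMap_mem _ _, ?_⟩
    rw [wordProd_descWord_succ, wordProd_descWord_zero, mul_one,
      gen_mul_self, Algebra.smul_def]
  | succ c =>
    obtain ⟨j, rfl⟩ : ∃ j : GenIdx N, j.1 = s := ⟨⟨s, by have := i.2; omega⟩, rfl⟩
    have hlow : wordProd X Y (descWord (N := N) c (j.1 - 1)) ∈ lowerSubalgebra X Y j.1 :=
      wordProd_descWord_mem_lowerSubalgebra (by omega)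
    refine ⟨algebraMap K _ (Y j.1) * wordProd X Y (descWord c (j.1 - 1)),
      mul_mem (Subalgebra.algebraMap_mem _ _) (lowerSubalgebra_mono (by omega) hlow), ?_⟩
    have hcomm := commute_gen_of_mem_lowerSubalgebra hs.ge hlow
    have hpred : i.1 - 1 = j.1 := by omega
    calc wordProd X Y (descWord (c + 2) i.1) * gen X Y i
      _ = gen X Y i * gen X Y j * (wordProd X Y (descWord c (j.1 - 1)) * gen X Y i) := by
        rw [wordProd_descWord_succ, hpred, wordProd_descWord_succ, mul_assoc, mul_assoc, mul_assoc]
      _ = gen X Y i * gen X Y j * gen X Y i * wordProd X Y (descWord c (j.1 - 1)) := by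
        rw [← hcomm.eq, ← mul_assoc]
      _ = algebraMap K _ (Y j.1) * wordProd X Y (descWord c (j.1 - 1)) * gen X Y i := by
        rw [gen_braid X Y hs, smul_mul_assoc, hcomm.eq, Algebra.smul_def, mul_assoc]

theorem exists_wordProd_descWord_mul_gen (hc : c ≤ s) (hs : s < N) (hi : i.1 ≤ s) :
    ∃ b ∈ lowerSubalgebra X Y s, ∃ d ≤ s,
      wordProd X Y (descWord c s) * gen X Y i = b * wordProd X Y (descWord d s) := by
  have hone : wordProd X Y (descWord 1 i.1) = gen X Y i := by
    rw [wordProd_descWord_succ, wordProd_descWord_zero, mul_one]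
  induction s generalizing c with
  | zero => exact absurd i.2.1 (by omega)
  | succ s ih =>
    rcases c with _ | c <;> rcases hi.eq_or_lt with hi | hlt
    · exact ⟨1, one_mem _, 1, by omega, by
        rw [← hi, hone, wordProd_descWord_zero]⟩
    · exact ⟨gen X Y i, gen_mem_lowerSubalgebra hlt, 0, by omega, by
        rw [wordProd_descWord_zero, one_mul, mul_one]⟩
    · obtain ⟨b, hb, e⟩ := wordProd_descWord_mul_gen_self (X := X) (Y := Y) hi (c := c) (by omega)
      exact ⟨b, hi ▸ hb, 1, by omega, by rw [← hi, e, hone]⟩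
    · obtain ⟨j, hj⟩ : ∃ j : GenIdx N, j.1 = s + 1 := ⟨⟨s + 1, by omega⟩, rfl⟩
      obtain ⟨b, hb, d, hd, e⟩ := ih (c := c) (by omega) (by omega) (by omega)
      have hcomm := commute_gen_of_mem_lowerSubalgebra hj.ge hb
      have hpred : j.1 - 1 = s := by omega
      refine ⟨b, lowerSubalgebra_mono (by omega) hb, d + 1, by omega, ?_⟩
      rw [← hj, wordProd_descWord_succ, wordProd_descWord_succ, hpred, mul_assoc, e, ← mul_assoc,
        hcomm.eq, mul_assoc]

variable (X Y) in
/-- The span of the descending products `E_s E_{s - 1} ⋯ E_{s - c + 1}`. -/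
def descSpan (s : ℕ) : Submodule K (OkadaAlgebra K N X Y) :=
  Submodule.span K ((fun c => wordProd X Y (descWord c s)) '' Set.Iic s)

variable (X Y) in
/-- The span of the products of the words `towerWord c 0 n`. -/
def towerSpan (n : ℕ) : Submodule K (OkadaAlgebra K N X Y) :=
  Submodule.span K ((fun c => wordProd X Y (towerWord c 0 n)) '' {c | ∀ k, c k ≤ k})

theorem lowerSubalgebra_succ_le (hs : s < N) :
    Subalgebra.toSubmodule (lowerSubalgebra (N := N) X Y (s + 1)) ≤
      Subalgebra.toSubmodule (lowerSubalgebra X Y s) * descSpan X Y s := by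
  have hmem {b : OkadaAlgebra K N X Y} (hb : b ∈ lowerSubalgebra X Y s) {d : ℕ} (hd : d ≤ s) :
      b * wordProd X Y (descWord d s) ∈
        Subalgebra.toSubmodule (lowerSubalgebra X Y s) * descSpan X Y s :=
    Submodule.mul_mem_mul hb (Submodule.subset_span ⟨d, hd, rfl⟩)
  refine adjoin_le_of_mul_mem ?_ ?_
  · have hone := hmem (one_mem _) s.zero_le
    rwa [one_mul] at hone
  · rintro a ha _ ⟨i, hi, rfl⟩
    induction ha using Submodule.mul_induction_on' with
    | mem_mul_mem b hb x hx =>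
      induction hx using Submodule.span_induction with
      | mem x hx =>
        obtain ⟨c, hc, rfl⟩ := hx
        obtain ⟨b', hb', d, hd, e⟩ :=
          exists_wordProd_descWord_mul_gen (X := X) (Y := Y) hc hs (Nat.lt_succ_iff.1 hi)
        dsimp only
        rw [mul_assoc, e, ← mul_assoc]
        exact hmem (mul_mem hb hb') hd
      | zero => rw [mul_zero, zero_mul]; exact zero_mem _
      | add x y _ _ hx hy => rw [mul_add, add_mul]; exact add_mem hx hy
      | smul r x _ hx =>
        rw [mul_smul_comm, smul_mul_assoc]
        exact Submodule.smul_mem _ _ hx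
    | add x _ y _ hx hy => rw [add_mul]; exact add_mem hx hy

theorem towerSpan_mul_descSpan_le (n : ℕ) :
    towerSpan (N := N) X Y n * descSpan X Y n ≤ towerSpan X Y (n + 1) := by
  rw [towerSpan, descSpan, Submodule.span_mul_span]
  refine Submodule.span_mono ?_
  rintro _ ⟨_, ⟨c, hc, rfl⟩, _, ⟨d, hd, rfl⟩, rfl⟩
  refine ⟨Function.update c n d, fun k => ?_, ?_⟩
  · rcases eq_or_ne k n with rfl | hk
    · rwa [Function.update_self]
    · rw [Function.update_of_ne hk]
      exact hc k
  · have htail : towerWord (N := N) (Function.update c n d) 0 n = towerWord c 0 n :=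
      towerWord_congr fun k hk => Function.update_of_ne (by omega) _ _
    dsimp only
    rw [towerWord_zero_succ, Function.update_self, wordProd_append, htail]

theorem lowerSubalgebra_le_towerSpan {n : ℕ} (hn : n ≤ N) :
    Subalgebra.toSubmodule (lowerSubalgebra (N := N) X Y n) ≤ towerSpan X Y n := by
  induction n with
  | zero =>
    refine adjoin_le_of_mul_mem (Submodule.subset_span ⟨fun _ => 0, fun _ => Nat.zero_le _, rfl⟩) ?_
    rintro _ _ _ ⟨_, hi, _⟩
    exact absurd hi (Nat.not_lt_zero _)
  | succ n ih =>
    exact (lowerSubalgebra_succ_le hn).trans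
      ((mul_le_mul_left (ih (by omega)) _).trans (towerSpan_mul_descSpan_le n))

theorem span_range_permElt : Submodule.span K (Set.range (permElt (N := N) X Y)) = ⊤ := by
  have htop : lowerSubalgebra (N := N) X Y N = ⊤ := by
    rw [eq_top_iff, ← adjoin_range_gen]
    refine Algebra.adjoin_mono ?_
    rintro _ ⟨i, rfl⟩
    exact ⟨i, i.2.2, rfl⟩
  have htower := lowerSubalgebra_le_towerSpan (X := X) (Y := Y) le_rfl (N := N)
  rw [htop, Algebra.top_toSubmodule, top_le_iff] at htower
  rw [eq_top_iff, ← htower, towerSpan]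
  refine Submodule.span_mono ?_
  rintro _ ⟨c, hc, rfl⟩
  obtain ⟨σ, hσ⟩ := exists_codeAt_eq (fun i : Fin N => c i) fun i => hc i
  have hcode : towerWord (N := N) (codeSeq σ) 0 N = towerWord c 0 N :=
    towerWord_congr fun k hk => by
      have hkN : k < N := by omega
      rw [codeSeq, dif_pos hkN, hσ]
  refine ⟨σ, ?_⟩
  dsimp only
  rw [← hcode, ← permWord_eq_towerWord]
  rfl

end Spanning

/-! ### The diagram basis -/

section Basis

variable {K : Type*} [Field K] {N : ℕ} (X Y : ℕ → K)

theorem vec_permElt (σ : Equiv.Perm (Fin N)) :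
    vec X Y (permElt X Y σ) = Finsupp.single (ofWord (permWord σ)) 1 :=
  vec_wordProd_of_isReduced X Y (isReduced_permWord σ)

theorem ofWord_permWord_surjective :
    Function.Surjective fun σ : Equiv.Perm (Fin N) => ofWord (permWord σ) := fun D => by
  -- In the algebra over `ℚ` with zero parameters, the product along a reduced word of `D` is a
  -- combination of the elements `E_σ`; its image under `vec` is the basis vector of `D`.
  obtain ⟨w, hw, rfl⟩ := exists_isReduced_ofWord_eq D
  have hspan : Finsupp.single (ofWord w) 1 ∈
      (Submodule.span ℚ (Set.range (permElt (N := N) 0 0))).map (vec 0 0) := by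
    rw [span_range_permElt, ← vec_wordProd_of_isReduced 0 0 hw]
    exact Submodule.mem_map_of_mem trivial
  have hrange : vec 0 0 '' Set.range (permElt (N := N) (0 : ℕ → ℚ) 0) =
      (fun D => Finsupp.single D 1) '' Set.range fun σ => ofWord (permWord σ) := by
    rw [← Set.range_comp, ← Set.range_comp]
    exact congrArg Set.range (funext fun σ => vec_permElt 0 0 σ)
  rw [Submodule.map_span, hrange, ← Finsupp.supported_eq_span_single] at hspan
  by_contra hw'
  have hzero := (Finsupp.mem_supported' ℚ _).1 hspan _ hw'
  rw [Finsupp.single_eq_same] at hzero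
  exact one_ne_zero hzero

theorem existsUnique_isWordDiagram (D : ArcDiagram N) :
    ∃! σ : Equiv.Perm (Fin N), IsWordDiagram (permWord σ) D := by
  simp only [isWordDiagram_iff, eq_comm (a := D)]
  exact Function.Bijective.existsUnique ⟨ofWord_permWord_injective, ofWord_permWord_surjective⟩ D

theorem diagramElt_ofWord_permWord (σ : Equiv.Perm (Fin N)) :
    diagramElt X Y (ofWord (permWord σ)) = permElt X Y σ := by
  have h : ∃ τ : Equiv.Perm (Fin N), IsWordDiagram (permWord τ) (ofWord (permWord σ)) :=
    ⟨σ, isWordDiagram_iff.2 rfl⟩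
  rw [diagramElt, dif_pos h]
  exact congrArg _ ((existsUnique_isWordDiagram _).unique h.choose_spec (isWordDiagram_iff.2 rfl))

theorem vec_diagramElt (D : ArcDiagram N) : vec X Y (diagramElt X Y D) = Finsupp.single D 1 := by
  obtain ⟨σ, rfl⟩ := ofWord_permWord_surjective D
  exact (congrArg _ (diagramElt_ofWord_permWord X Y σ)).trans (vec_permElt X Y σ)

theorem span_range_diagramElt : Submodule.span K (Set.range (diagramElt (N := N) X Y)) = ⊤ := by
  rw [eq_top_iff, ← span_range_permElt]
  refine Submodule.span_mono ?_
  rintro _ ⟨σ, rfl⟩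
  exact ⟨_, diagramElt_ofWord_permWord X Y σ⟩

theorem linearIndependent_diagramElt : LinearIndependent K (diagramElt (N := N) X Y) := by
  refine LinearIndependent.of_comp (vec X Y) ?_
  rw [show vec X Y ∘ diagramElt (N := N) X Y = fun D => Finsupp.single D 1 from
    funext (vec_diagramElt X Y)]
  exact Finsupp.linearIndependent_single_one K _

theorem vec_injective : Function.Injective (vec (N := N) X Y) := by
  have hleft : Finsupp.linearCombination K (diagramElt X Y) ∘ₗ vec (N := N) X Y = LinearMap.id :=
    LinearMap.ext_on_range (span_range_diagramElt X Y) fun D => by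
      rw [LinearMap.comp_apply, vec_diagramElt, Finsupp.linearCombination_single, one_smul,
        LinearMap.id_apply]
  exact Function.LeftInverse.injective (g := Finsupp.linearCombination K (diagramElt X Y))
    fun a => LinearMap.congr_fun hleft a

theorem gen_mul_diagramElt (i : GenIdx N) (D : ArcDiagram N) :
    gen X Y i * diagramElt X Y D = weight X Y i D • diagramElt X Y (act i D) := by
  apply vec_injective
  rw [vec_gen_mul, map_smul, vec_diagramElt, vec_diagramElt, genOp_single, Finsupp.smul_single,
    smul_eq_mul, mul_one, one_mul]

theorem wordProd_of_isReduced {w : List (GenIdx N)} (h : IsReduced w) :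
    wordProd X Y w = diagramElt X Y (ofWord w) := by
  apply vec_injective
  rw [vec_wordProd_of_isReduced X Y h, vec_diagramElt]

/-! ### The mirror anti-involution -/

/-- The mirror anti-involution as a homomorphism to the opposite algebra; it fixes the
generators. -/
noncomputable def mirrorHom : OkadaAlgebra K N X Y →ₐ[K] (OkadaAlgebra K N X Y)ᵐᵒᵖ :=
  okadaLift X Y (fun i => MulOpposite.op (gen X Y i))
    (fun i => by rw [← MulOpposite.op_mul, gen_mul_self, MulOpposite.op_smul])
    (fun i j h => by rw [← MulOpposite.op_mul, ← MulOpposite.op_mul, gen_comm X Y h])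
    (fun i j h => by
      rw [← MulOpposite.op_mul, ← MulOpposite.op_mul, ← mul_assoc, gen_braid X Y h,
        MulOpposite.op_smul])

/-- The mirror anti-involution as a linear endomorphism. -/
noncomputable def mirrorMap : OkadaAlgebra K N X Y →ₗ[K] OkadaAlgebra K N X Y :=
  (MulOpposite.opLinearEquiv K).symm.toLinearMap ∘ₗ (mirrorHom X Y).toLinearMap

theorem mirrorMap_apply (a : OkadaAlgebra K N X Y) :
    mirrorMap X Y a = (mirrorHom X Y a).unop := rfl

theorem mirrorMap_mul (a b : OkadaAlgebra K N X Y) :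
    mirrorMap X Y (a * b) = mirrorMap X Y b * mirrorMap X Y a := by
  simp only [mirrorMap_apply, map_mul, MulOpposite.unop_mul]

theorem mirrorMap_gen (i : GenIdx N) : mirrorMap X Y (gen X Y i) = gen X Y i := by
  rw [mirrorMap_apply, mirrorHom, okadaLift_gen, MulOpposite.unop_op]

theorem mirrorMap_wordProd (w : List (GenIdx N)) :
    mirrorMap X Y (wordProd X Y w) = wordProd X Y w.reverse := by
  induction w with
  | nil => simp only [mirrorMap_apply, wordProd, List.reverse_nil, List.map_nil, List.prod_nil,
      map_one, MulOpposite.unop_one]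
  | cons i w ih =>
    rw [wordProd_cons, mirrorMap_mul, ih, mirrorMap_gen, List.reverse_cons, wordProd_append,
      wordProd_cons, wordProd, wordProd, List.map_nil, List.prod_nil, mul_one]

theorem mirrorMap_diagramElt (D : ArcDiagram N) :
    mirrorMap X Y (diagramElt X Y D) = diagramElt X Y D.mirror := by
  obtain ⟨w, hw, rfl⟩ := exists_isReduced_ofWord_eq D
  rw [← wordProd_of_isReduced X Y hw, mirrorMap_wordProd, wordProd_of_isReduced X Y hw.reverse,
    ofWord_reverse]

theorem mirrorMap_mirrorMap (a : OkadaAlgebra K N X Y) : mirrorMap X Y (mirrorMap X Y a) = a := by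
  have h : mirrorMap (N := N) X Y ∘ₗ mirrorMap X Y = LinearMap.id :=
    LinearMap.ext_on_range (span_range_diagramElt X Y) fun D => by
      rw [LinearMap.comp_apply, mirrorMap_diagramElt, mirrorMap_diagramElt, mirror_mirror,
        LinearMap.id_apply]
  exact LinearMap.congr_fun h a

end Basis

end

/-! ### The halves of a diagram -/

section Halves

variable {N : ℕ} {L R : HalfDiagram N}

theorem mirror_glue (h : L.propLab = R.propLab) : (glue L R h).mirror = glue R L h.symm := by
  apply ArcDiagram.ext <;> funext u <;> rcases u with a | a
  · simp only [ArcDiagram.mirror, glue, glueMate, Sum.swap_inl]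
    split_ifs <;> rfl
  · simp only [ArcDiagram.mirror, glue, glueMate, Sum.swap_inr]
    split_ifs <;> rfl
  · rfl
  · rfl

namespace ArcDiagram

open LabelledMatching

variable {D E : ArcDiagram N} {a b : Fin N}

/-- The matching of the left half of a diagram: a left node on a propagating arc is matched with
itself. -/
def leftMate (D : ArcDiagram N) (a : Fin N) : Fin N :=
  Sum.elim (fun b => b) (fun _ => a) (D.mate (Sum.inl a))

theorem mate_inl_cases (D : ArcDiagram N) (a : Fin N) :
    (D.mate (Sum.inl a) = Sum.inl (D.leftMate a) ∧ D.leftMate a ≠ a) ∨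
      ((∃ b, D.mate (Sum.inl a) = Sum.inr b) ∧ D.leftMate a = a) := by
  rw [leftMate]
  rcases e : D.mate (Sum.inl a) with b | b
  · exact Or.inl ⟨rfl, fun h => D.mate_ne _ (e.trans (congrArg Sum.inl h))⟩
  · exact Or.inr ⟨⟨b, rfl⟩, rfl⟩

theorem leftMate_eq_self_iff : D.leftMate a = a ↔ ∃ b, D.mate (Sum.inl a) = Sum.inr b := by
  rcases D.mate_inl_cases a with ⟨h, hne⟩ | ⟨h, heq⟩
  · simp only [h, hne, reduceCtorEq, exists_false]
  · exact iff_of_true heq h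

theorem mate_inl_eq_inl_iff : D.mate (Sum.inl a) = Sum.inl b ↔ D.leftMate a = b ∧ b ≠ a := by
  rcases D.mate_inl_cases a with ⟨h, hne⟩ | ⟨⟨c, h⟩, heq⟩
  · rw [h, Sum.inl.injEq]
    exact ⟨fun e => ⟨e, e ▸ hne⟩, And.left⟩
  · rw [h, heq]
    exact iff_of_false Sum.inr_ne_inl fun e => e.2 e.1.symm

theorem pos_mate_inl_cases (D : ArcDiagram N) (a : Fin N) :
    (D.mate (Sum.inl a)).pos = (D.leftMate a).val + 1 ∧ (D.leftMate a).val ≠ a.val ∨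
      N < (D.mate (Sum.inl a)).pos ∧ (D.leftMate a).val = a.val := by
  rcases D.mate_inl_cases a with ⟨h, hne⟩ | ⟨⟨b, h⟩, heq⟩ <;> rw [h]
  · exact Or.inl ⟨rfl, Fin.val_ne_of_ne hne⟩
  · refine Or.inr ⟨?_, congrArg Fin.val heq⟩
    rw [Node.pos]
    omega

theorem leftMate_leftMate (D : ArcDiagram N) (a : Fin N) : D.leftMate (D.leftMate a) = a := by
  rcases D.mate_inl_cases a with ⟨h, _⟩ | ⟨_, heq⟩
  · exact (mate_inl_eq_inl_iff.1 (D.mate_involutive.eq_iff.1 h).symm).1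
  · rw [heq, heq]

theorem height_leftMate (D : ArcDiagram N) (a : Fin N) :
    D.height (Sum.inl (D.leftMate a)) = D.height (Sum.inl a) := by
  rcases D.mate_inl_cases a with ⟨h, _⟩ | ⟨_, heq⟩
  · rw [← h, D.height_mate]
  · rw [heq]

/-- The left half of a diagram. -/
def leftHalf (D : ArcDiagram N) : HalfDiagram N where
  mate := D.leftMate
  height a := D.height (Sum.inl a)
  mate_mate := D.leftMate_leftMate
  noncrossing a b h := by
    have := D.noncrossing (Sum.inl a) (Sum.inl b)
    have := D.pos_mate_inl_cases a
    have := D.pos_mate_inl_cases b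
    simp only [Fin.lt_def, Node.pos] at *
    omega
  noncrossing_half a c hc h := by
    have := D.noncrossing (Sum.inl a) (Sum.inl c)
    have := D.pos_mate_inl_cases a
    have := D.pos_mate_inl_cases c
    simp only [Fin.ext_iff, Fin.lt_def, Node.pos] at *
    omega
  height_mate := D.height_leftMate
  one_le_height a := D.one_le_height _
  height_le a := by
    have h : D.height (Sum.inl a) ≤ a.val + 1 := D.isOkada_toMatching.height_le_pos _
    have h' : D.height (Sum.inl (D.leftMate a)) ≤ (D.leftMate a).val + 1 :=
      D.isOkada_toMatching.height_le_pos _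
    rw [D.height_leftMate] at h'
    omega
  height_parity a := by
    have h : D.height (Sum.inl a) % 2 = min (a.val + 1) (D.mate (Sum.inl a)).pos % 2 :=
      D.isOkada_toMatching.height_parity _
    have := D.pos_mate_inl_cases a
    omega
  height_nested a c h1 h2 h3 := by
    have := D.height_nested (Sum.inl a) (Sum.inl c)
    have := D.pos_mate_inl_cases a
    have := D.pos_mate_inl_cases c
    simp only [Fin.lt_def, Node.pos] at *
    omega
  height_nested_half a c hc h := by
    have hpos := D.pos_mate_inl_cases c
    refine D.isOkada_toMatching.height_lt (Sum.inl c) (Sum.inl a) ?_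
    simp only [Covers, Node.Between, toMatching, Fin.ext_iff, Fin.lt_def, Node.pos] at *
    omega

/-- The right half of a diagram, read through the mirror. -/
def rightHalf (D : ArcDiagram N) : HalfDiagram N := D.mirror.leftHalf

theorem leftHalf_mate_eq_self_iff :
    D.leftHalf.mate a = a ↔ ∃ b, D.mate (Sum.inl a) = Sum.inr b :=
  leftMate_eq_self_iff

theorem rightHalf_mate_eq_self_iff :
    D.rightHalf.mate a = a ↔ ∃ b, D.mate (Sum.inr a) = Sum.inl b := by
  rw [rightHalf, leftHalf_mate_eq_self_iff]
  rcases h : D.mate (Sum.inr a) with b | b <;>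
    simp only [mirror, Sum.swap_inl, h, Sum.swap_inr, reduceCtorEq, Sum.inl.injEq, Sum.inr.injEq,
      exists_eq', exists_false]

theorem leftHalf_eq_iff : D.leftHalf = E.leftHalf ↔
    ∀ a, D.height (Sum.inl a) = E.height (Sum.inl a) ∧
      ∀ b, D.mate (Sum.inl a) = Sum.inl b ↔ E.mate (Sum.inl a) = Sum.inl b := by
  refine ⟨fun h a => ?_, fun h => HalfDiagram.ext (funext fun a => ?_) (funext fun a => (h a).1)⟩
  · have hmate : D.leftMate a = E.leftMate a := congrFun (congrArg HalfDiagram.mate h) a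
    refine ⟨congrFun (congrArg HalfDiagram.height h) a, fun b => ?_⟩
    rw [mate_inl_eq_inl_iff, mate_inl_eq_inl_iff, hmate]
  · have hD := (h a).2 (D.leftMate a)
    have hE := (h a).2 (E.leftMate a)
    rw [mate_inl_eq_inl_iff, mate_inl_eq_inl_iff] at hD hE
    change D.leftMate a = E.leftMate a
    by_cases h1 : D.leftMate a = a
    · by_contra h2
      exact h2 (hE.2 ⟨rfl, fun h3 => h2 (h1.trans h3.symm)⟩).1
    · exact (hD.1 ⟨rfl, h1⟩).1.symm

theorem propLab_leftHalf_subset (D : ArcDiagram N) :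
    D.leftHalf.propLab ⊆ D.rightHalf.propLab := fun x hx => by
  obtain ⟨a, ha, rfl⟩ := Finset.mem_image.1 hx
  obtain ⟨b, hb⟩ := leftHalf_mate_eq_self_iff.1 (Finset.mem_filter.1 ha).2
  refine Finset.mem_image.2 ⟨b, Finset.mem_filter.2 ⟨Finset.mem_univ _, ?_⟩, ?_⟩
  · exact rightHalf_mate_eq_self_iff.2 ⟨a, by rw [← hb, D.mate_mate]⟩
  · change D.height (Sum.inr b) = D.height (Sum.inl a)
    rw [← hb, D.height_mate]

theorem propLab_rightHalf (D : ArcDiagram N) : D.rightHalf.propLab = D.leftHalf.propLab := by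
  refine Finset.Subset.antisymm ?_ D.propLab_leftHalf_subset
  have hmirror := D.mirror.propLab_leftHalf_subset
  rwa [rightHalf, mirror_mirror] at hmirror

theorem rightHalf_mirror (D : ArcDiagram N) : D.mirror.rightHalf = D.leftHalf := by
  rw [rightHalf, mirror_mirror]

theorem glue_mate_inl (h : L.propLab = R.propLab) (hL : D.leftHalf = L) (hR : D.rightHalf = R)
    (a : Fin N) : (glue L R h).mate (Sum.inl a) = D.mate (Sum.inl a) := by
  subst hL hR
  rcases D.mate_inl_cases a with ⟨hfull, hne⟩ | ⟨⟨b, hb⟩, heq⟩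
  · exact (glueMate_inl_full (L := D.leftHalf) _ hne).trans hfull.symm
  · obtain ⟨hmate, hheight⟩ := HalfDiagram.partner_spec (L := D.leftHalf) h heq
    have hb' : D.mate (Sum.inr b) = Sum.inl a := by rw [← hb, D.mate_mate]
    have hlabel : D.height (Sum.inl a) = D.height (Sum.inr b) := by rw [← hb, D.height_mate]
    refine (glueMate_inl_half (L := D.leftHalf) _ heq).trans ?_
    rw [hb, D.rightHalf.half_unique hmate (rightHalf_mate_eq_self_iff.2 ⟨a, hb'⟩)
      (hheight.trans hlabel)]

theorem glue_leftHalf_rightHalf (D : ArcDiagram N) :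
    glue D.leftHalf D.rightHalf D.propLab_rightHalf.symm = D := by
  apply ArcDiagram.ext <;> funext u <;> rcases u with a | a
  · exact glue_mate_inl _ rfl rfl a
  · have hmirror := glue_mate_inl D.propLab_rightHalf rfl D.rightHalf_mirror a
    rw [← mirror_glue D.propLab_rightHalf.symm] at hmirror
    exact Sum.swap_leftInverse.injective hmirror
  · rfl
  · rfl

end ArcDiagram

theorem leftHalf_glue (h : L.propLab = R.propLab) : (glue L R h).leftHalf = L := by
  refine HalfDiagram.ext (funext fun a => ?_) rfl
  by_cases ha : L.mate a = a
  · rw [ha]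
    exact ArcDiagram.leftMate_eq_self_iff.2 ⟨_, glueMate_inl_half R ha⟩
  · exact (ArcDiagram.mate_inl_eq_inl_iff.1 (glueMate_inl_full R ha)).1

theorem rightHalf_glue (h : L.propLab = R.propLab) : (glue L R h).rightHalf = R := by
  rw [ArcDiagram.rightHalf, mirror_glue, leftHalf_glue]

end Halves

/-! ### Propagating label sets -/

theorem card_filter_lt_orderEmbOfFin {α : Type*} [LinearOrder α] (S : Finset α) (i : Fin S.card) :
    (S.filter (· < S.orderEmbOfFin rfl i)).card = i.val := by
  have himage : S.filter (· < S.orderEmbOfFin rfl i) =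
      (Finset.Iio i).map (S.orderEmbOfFin rfl).toEmbedding := by
    ext x
    simp only [Finset.mem_filter, Finset.mem_map, Finset.mem_Iio, RelEmbedding.coe_toEmbedding]
    constructor
    · rintro ⟨hx, hlt⟩
      rw [← Finset.mem_coe, ← Finset.range_orderEmbOfFin S rfl] at hx
      obtain ⟨j, rfl⟩ := hx
      exact ⟨j, (S.orderEmbOfFin rfl).lt_iff_lt.1 hlt, rfl⟩
    · rintro ⟨j, hj, rfl⟩
      exact ⟨Finset.orderEmbOfFin_mem S rfl j, (S.orderEmbOfFin rfl).lt_iff_lt.2 hj⟩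
  rw [himage, Finset.card_map, Fin.card_Iio]

theorem card_filter_le_orderEmbOfFin {α : Type*} [LinearOrder α] (S : Finset α) (i : Fin S.card) :
    (S.filter (S.orderEmbOfFin rfl i ≤ ·)).card + i.val = S.card := by
  have hcard := S.card_filter_add_card_filter_not (p := (S.orderEmbOfFin rfl i ≤ ·))
  simp only [not_le] at hcard
  rwa [card_filter_lt_orderEmbOfFin] at hcard

theorem dominated_of_card_filter_le {S T : Finset ℕ}
    (h : ∀ m, (S.filter (m ≤ ·)).card ≤ (T.filter (m ≤ ·)).card) : Dominated S T := by
  have hcard : S.card ≤ T.card := by simpa only [Nat.zero_le, Finset.filter_true] using h 0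
  refine ⟨hcard, fun i => le_of_not_gt fun hlt => ?_⟩
  have hS := card_filter_le_orderEmbOfFin S (Fin.rev i)
  have hT := card_filter_le_orderEmbOfFin T (Fin.rev (Fin.castLE hcard i))
  have hST := h (S.orderEmbOfFin rfl (Fin.rev i))
  have hssub : T.filter (S.orderEmbOfFin rfl (Fin.rev i) ≤ ·) ⊂
      T.filter (T.orderEmbOfFin rfl (Fin.rev (Fin.castLE hcard i)) ≤ ·) := by
    rw [Finset.ssubset_iff_of_subset
      (Finset.monotone_filter_right _ fun x _ hx => hlt.le.trans hx)]
    exact ⟨_, Finset.mem_filter.2 ⟨Finset.orderEmbOfFin_mem T rfl _, le_rfl⟩,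
      fun hm => (Finset.mem_filter.1 hm).2.not_gt hlt⟩
  have hlt_card := Finset.card_lt_card hssub
  simp only [Fin.val_rev, Fin.val_castLE] at hS hT
  have := i.2
  omega

namespace HalfDiagram

variable {N : ℕ} {G H : HalfDiagram N} {a b : Fin N}

/-- The nodes of the propagating arcs. -/
def halves (H : HalfDiagram N) : Finset (Fin N) := Finset.univ.filter fun a => H.mate a = a

theorem mem_halves : a ∈ H.halves ↔ H.mate a = a := by
  rw [halves, Finset.mem_filter, and_iff_right (Finset.mem_univ a)]

theorem height_injOn_halves (H : HalfDiagram N) : Set.InjOn H.height H.halves :=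
  fun _ ha _ hb h => H.half_unique (mem_halves.1 ha) (mem_halves.1 hb) h

theorem propLab_eq_image (H : HalfDiagram N) : H.propLab = H.halves.image H.height := rfl

theorem card_filter_propLab (H : HalfDiagram N) (p : ℕ → Prop) [DecidablePred p] :
    (H.propLab.filter p).card = (H.halves.filter fun a => p (H.height a)).card := by
  rw [propLab_eq_image, Finset.filter_image, Finset.card_image_of_injOn]
  exact H.height_injOn_halves.mono (Finset.coe_subset.2 (Finset.filter_subset _ _))

theorem card_propLab (H : HalfDiagram N) : H.propLab.card = H.halves.card :=
  Finset.card_image_of_injOn H.height_injOn_halves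

theorem sum_propLab (H : HalfDiagram N) : ∑ x ∈ H.propLab, x = ∑ a ∈ H.halves, H.height a := by
  rw [propLab_eq_image, Finset.sum_image H.height_injOn_halves]

theorem card_filter_halves_mod_two (H : HalfDiagram N) {n : ℕ} (hn : n ≤ N)
    (hclosed : ∀ b : Fin N, b.val < n → (H.mate b).val < n) :
    (H.halves.filter fun b => b.val < n).card % 2 = n % 2 := by
  have hfull : Even ((Finset.univ.filter fun b : Fin N => b.val < n ∧ H.mate b ≠ b).card) := by
    refine even_card_of_fixedPointFree_involution _ H.mate (fun b hb => ?_)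
      (fun b _ => H.mate_mate b) (fun b hb => (Finset.mem_filter.1 hb).2.2)
    rw [Finset.mem_filter] at hb ⊢
    exact ⟨Finset.mem_univ _, hclosed b hb.2.1, by rw [H.mate_mate]; exact hb.2.2.symm⟩
  have hbelow : (Finset.univ.filter fun b : Fin N => b.val < n).card = n := by
    rw [Fin.card_filter_val_lt, min_eq_right hn]
  have hsplit := (Finset.univ.filter fun b : Fin N => b.val < n).card_filter_add_card_filter_not
    (p := fun b => H.mate b = b)
  rw [Finset.filter_filter, Finset.filter_filter, hbelow] at hsplit
  have hhalves : H.halves.filter (fun b => b.val < n) =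
      Finset.univ.filter fun b : Fin N => b.val < n ∧ H.mate b = b := by
    rw [halves, Finset.filter_filter]
    simp only [and_comm]
  rw [hhalves]
  have := Nat.even_iff.1 hfull
  simp only [ne_eq] at this
  omega

theorem height_lt_height_iff (ha : H.mate a = a) (hb : H.mate b = b) :
    H.height a < H.height b ↔ a < b := by
  refine ⟨fun h => lt_of_not_ge fun hba => ?_, H.height_nested_half b a ha⟩
  rcases hba.eq_or_lt with rfl | hba
  · exact h.false
  · exact h.not_gt (H.height_nested_half a b hb hba)

theorem mate_lt_of_lt_half (ha : H.mate a = a) (hb : b < a) : H.mate b < a := by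
  refine lt_of_le_of_ne (le_of_not_gt fun h => H.noncrossing_half b a ha ⟨hb, h⟩) fun e => ?_
  rw [← H.mate_mate b, e, ha] at hb
  exact hb.false

theorem isFibonacciSet_propLab (H : HalfDiagram N) : IsFibonacciSet N H.propLab := by
  refine ⟨fun x hx => ?_, ?_, fun i => ?_⟩
  · obtain ⟨a, _, rfl⟩ := Finset.mem_image.1 hx
    have := H.height_le a
    exact Finset.mem_Icc.2 ⟨H.one_le_height a, by omega⟩
  · have h := H.card_filter_halves_mod_two le_rfl fun b _ => (H.mate b).2
    rwa [Finset.filter_true_of_mem fun b _ => b.2, ← card_propLab] at h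
  · obtain ⟨a, ha, hai⟩ := Finset.mem_image.1 (Finset.orderEmbOfFin_mem H.propLab rfl i)
    have ha' : H.mate a = a := (Finset.mem_filter.1 ha).2
    have hcard := card_filter_lt_orderEmbOfFin H.propLab i
    rw [← hai, card_filter_propLab, Finset.filter_congr fun b hb =>
      (height_lt_height_iff (mem_halves.1 hb) ha').trans Fin.lt_def] at hcard
    have hbelow := H.card_filter_halves_mod_two a.2.le fun b hb => mate_lt_of_lt_half ha' hb
    have hparity := H.height_parity a
    rw [ha', min_self] at hparity
    rw [← hai]
    omega

theorem dominated_propLab (h : ∀ a, G.mate a = a → H.mate a = a ∧ G.height a ≤ H.height a) :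
    Dominated G.propLab H.propLab := by
  refine dominated_of_card_filter_le fun m => ?_
  rw [card_filter_propLab, card_filter_propLab]
  refine Finset.card_le_card fun a ha => ?_
  rw [Finset.mem_filter, mem_halves] at ha ⊢
  exact ⟨(h a ha.1).1, ha.2.trans (h a ha.1).2⟩

theorem mate_eq_self_and_height_eq_of_propLab_eq
    (h : ∀ a, G.mate a = a → H.mate a = a ∧ G.height a ≤ H.height a)
    (hlab : G.propLab = H.propLab) (ha : H.mate a = a) :
    G.mate a = a ∧ G.height a = H.height a := by
  have hhalves : G.halves = H.halves :=
    Finset.eq_of_subset_of_card_le (fun b hb => mem_halves.2 (h b (mem_halves.1 hb)).1)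
      (by rw [← card_propLab, ← card_propLab, hlab])
  have hsum : ∑ b ∈ H.halves, G.height b = ∑ b ∈ H.halves, H.height b := by
    rw [← sum_propLab, ← hhalves, ← sum_propLab, hlab]
  rw [Finset.sum_eq_sum_iff_of_le fun b hb => (h b (mem_halves.1 (hhalves ▸ hb))).2] at hsum
  rw [← mem_halves] at ha
  exact ⟨mem_halves.1 (hhalves ▸ ha), hsum a ha⟩

end HalfDiagram

/-! ### The generators on half diagrams -/

section

open ArcDiagram

namespace ArcDiagram

variable {N : ℕ} {D E : ArcDiagram N}

theorem leftHalf_act_congr (i : GenIdx N) (h : D.leftHalf = E.leftHalf) :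
    (act i D).leftHalf = (act i E).leftHalf := by
  rw [leftHalf_eq_iff] at h ⊢
  obtain ⟨p, hp⟩ : ∃ p, i.lo = Sum.inl p := ⟨_, rfl⟩
  obtain ⟨q, hq⟩ : ∃ q, i.hi = Sum.inl q := ⟨_, rfl⟩
  intro a
  have hD := act_cases i D (Sum.inl a)
  have hE := act_cases i E (Sum.inl a)
  rw [hp, hq] at hD hE
  have hDp := D.mate_ne (Sum.inl p)
  have hDq := D.mate_ne (Sum.inl q)
  have hp' := h p
  have hq' := h q
  have ha' := h a
  have hpa := hp'.2 a
  have hqa := hq'.2 a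
  refine ⟨by grind, fun b => ?_⟩
  have hpb := hp'.2 b
  have hqb := hq'.2 b
  have hab := ha'.2 b
  grind

theorem weight_congr {K : Type*} [CommMonoid K] (X Y : ℕ → K) (i : GenIdx N)
    (h : D.leftHalf = E.leftHalf) : weight X Y i D = weight X Y i E := by
  rw [leftHalf_eq_iff] at h
  have hlo : D.height i.lo = E.height i.lo := (h _).1
  have hhi : D.height i.hi = E.height i.hi := (h _).1
  have hmate : D.mate i.lo = i.hi ↔ E.mate i.lo = i.hi := (h _).2 _
  by_cases hD : D.mate i.lo = i.hi
  · rw [weight_of_mate hD, weight_of_mate (hmate.1 hD), hlo]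
  · rw [weight_of_not_mate hD, weight_of_not_mate (hD ∘ hmate.2), hlo, hhi]

theorem rightHalf_act_cases (i : GenIdx N) (D : ArcDiagram N) (a : Fin N) :
    (D.rightHalf.mate a = a ∧ (act i D).rightHalf.height a ≤ D.rightHalf.height a) ∨
      ((act i D).rightHalf.mate a = D.rightHalf.mate a ∧
        (act i D).rightHalf.height a = D.rightHalf.height a) := by
  rcases act_cases i D (Sum.inr a) with ⟨h, _⟩ | ⟨h, _⟩ | ⟨h, _, _, hh⟩ | ⟨h, _, _, hh⟩ |
    ⟨_, _, _, _, hm, hh⟩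
  · exact (Sum.inr_ne_inl h).elim
  · exact (Sum.inr_ne_inl h).elim
  · refine Or.inl ⟨rightHalf_mate_eq_self_iff.2 ⟨_, (congrArg D.mate h).trans (D.mate_mate _)⟩, ?_⟩
    have : D.height (Sum.inr a) = D.height i.lo := by rw [h, D.height_mate]
    exact (hh.trans_le (min_le_left _ _)).trans this.ge
  · refine Or.inl ⟨rightHalf_mate_eq_self_iff.2 ⟨_, (congrArg D.mate h).trans (D.mate_mate _)⟩, ?_⟩
    have : D.height (Sum.inr a) = D.height i.hi := by rw [h, D.height_mate]
    exact (hh.trans_le (min_le_right _ _)).trans this.ge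
  · exact Or.inr ⟨by simp only [rightHalf, leftHalf, leftMate, mirror, Sum.swap_inl, hm], hh⟩

theorem rightHalf_act_le (i : GenIdx N) (D : ArcDiagram N) (a : Fin N)
    (ha : (act i D).rightHalf.mate a = a) :
    D.rightHalf.mate a = a ∧ (act i D).rightHalf.height a ≤ D.rightHalf.height a := by
  rcases rightHalf_act_cases i D a with h | ⟨hm, hh⟩
  · exact h
  · exact ⟨hm.symm.trans ha, hh.le⟩

theorem rightHalf_act_eq_of_propLab_eq (i : GenIdx N) (D : ArcDiagram N)
    (h : (act i D).rightHalf.propLab = D.rightHalf.propLab) :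
    (act i D).rightHalf = D.rightHalf := by
  have hcases (a : Fin N) : (act i D).rightHalf.mate a = D.rightHalf.mate a ∧
      (act i D).rightHalf.height a = D.rightHalf.height a := by
    rcases rightHalf_act_cases i D a with ⟨ha, _⟩ | h'
    · have := HalfDiagram.mate_eq_self_and_height_eq_of_propLab_eq (rightHalf_act_le i D) h ha
      exact ⟨this.1.trans ha.symm, this.2⟩
    · exact h'
  exact HalfDiagram.ext (funext fun a => (hcases a).1) (funext fun a => (hcases a).2)

end ArcDiagram

/-! ### Cellularity -/

section Cellular

variable {K : Type*} [Field K] {N : ℕ} {S : FibSet N}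

instance : Finite (ArcDiagram N) :=
  Finite.of_surjective _ ofWord_permWord_surjective

instance : Finite (HalfDiagram N) :=
  Finite.of_surjective leftHalf fun L => ⟨glue L L rfl, leftHalf_glue rfl⟩

instance : Finite (HalfDiagramWith S) := Subtype.finite

/-- The diagram `L ⋈ R`, for half diagrams with propagating label set `S`. -/
noncomputable def join (L R : HalfDiagramWith S) : ArcDiagram N :=
  glue L.1 R.1 (L.2.trans R.2.symm)

theorem leftHalf_join (L R : HalfDiagramWith S) : (join L R).leftHalf = L.1 :=
  leftHalf_glue _

theorem rightHalf_join (L R : HalfDiagramWith S) : (join L R).rightHalf = R.1 :=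
  rightHalf_glue _

theorem join_halves (D : ArcDiagram N) (hL : D.leftHalf.propLab = S.1)
    (hR : D.rightHalf.propLab = S.1) :
    join (S := S) ⟨D.leftHalf, hL⟩ ⟨D.rightHalf, hR⟩ = D :=
  glue_leftHalf_rightHalf D

/-- The labels of the propagating arcs of a diagram, as an element of the cell poset. -/
def fibSet (D : ArcDiagram N) : FibSet N :=
  ⟨D.rightHalf.propLab, D.rightHalf.isFibonacciSet_propLab⟩

theorem fibSet_join (L R : HalfDiagramWith S) : fibSet (join L R) = S :=
  Subtype.ext ((congrArg HalfDiagram.propLab (rightHalf_join L R)).trans R.2)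

theorem join_injective : Function.Injective
    fun p : (Σ S : FibSet N, HalfDiagramWith S × HalfDiagramWith S) => join p.2.1 p.2.2 := by
  rintro ⟨S, L, R⟩ ⟨T, L', R'⟩ h
  obtain rfl : S = T := (fibSet_join L R).symm.trans ((congrArg fibSet h).trans (fibSet_join L' R'))
  have hL : L = L' :=
    Subtype.ext ((leftHalf_join L R).symm.trans ((congrArg leftHalf h).trans (leftHalf_join L' R')))
  have hR : R = R' := Subtype.ext
    ((rightHalf_join L R).symm.trans ((congrArg rightHalf h).trans (rightHalf_join L' R')))
  rw [hL, hR]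

theorem join_surjective : Function.Surjective
    fun p : (Σ S : FibSet N, HalfDiagramWith S × HalfDiagramWith S) => join p.2.1 p.2.2 :=
  fun D => ⟨⟨fibSet D, ⟨D.leftHalf, D.propLab_rightHalf.symm⟩, ⟨D.rightHalf, rfl⟩⟩,
    join_halves D _ _⟩

theorem fibSet_act_le (i : GenIdx N) (D : ArcDiagram N) : fibSet (act i D) ≤ fibSet D :=
  HalfDiagram.dominated_propLab (rightHalf_act_le i D)

theorem act_join_eq_join (i : GenIdx N) {L R : HalfDiagramWith S}
    (h : fibSet (act i (join L R)) = S) :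
    ∃ L' : HalfDiagramWith S, L'.1 = (act i (join L R)).leftHalf ∧
      act i (join L R) = join L' R := by
  have hright : (act i (join L R)).rightHalf = R.1 := by
    rw [← rightHalf_join L R]
    exact rightHalf_act_eq_of_propLab_eq i _
      (congrArg Subtype.val (h.trans (fibSet_join L R).symm))
  have hS : (act i (join L R)).rightHalf.propLab = S.1 := congrArg Subtype.val h
  have hR : (⟨_, hS⟩ : HalfDiagramWith S) = R := Subtype.ext hright
  refine ⟨⟨_, (propLab_rightHalf _).symm.trans hS⟩, rfl, ?_⟩
  exact ((congrArg (join _) hR).symm.trans (join_halves _ _ hS)).symm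

variable (X Y : ℕ → K)

/-- The span of the diagrams `P ⋈ Q` with a propagating label set smaller than `S`, modulo which
the cells are modules. -/
def lowerSpan (S : FibSet N) : Submodule K (OkadaAlgebra K N X Y) :=
  Submodule.span K {c | ∃ T : FibSet N, T < S ∧ ∃ P Q : HalfDiagramWith T,
    c = diagramElt X Y (join P Q)}

variable {X Y}

theorem diagramElt_mem_lowerSpan {D : ArcDiagram N} (h : fibSet D < S) :
    diagramElt X Y D ∈ lowerSpan X Y S :=
  Submodule.subset_span ⟨fibSet D, h, ⟨D.leftHalf, D.propLab_rightHalf.symm⟩,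
    ⟨D.rightHalf, rfl⟩, (congrArg (diagramElt X Y) (join_halves D _ _)).symm⟩

theorem gen_mul_mem_lowerSpan (i : GenIdx N) {b : OkadaAlgebra K N X Y}
    (hb : b ∈ lowerSpan X Y S) : gen X Y i * b ∈ lowerSpan X Y S := by
  induction hb using Submodule.span_induction with
  | mem b hb =>
    obtain ⟨T, hT, P, Q, rfl⟩ := hb
    rw [gen_mul_diagramElt]
    refine Submodule.smul_mem _ _ (diagramElt_mem_lowerSpan ((fibSet_act_le i _).trans_lt ?_))
    rwa [fibSet_join]
  | zero => rw [mul_zero]; exact zero_mem _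
  | add x y _ _ hx hy => rw [mul_add]; exact add_mem hx hy
  | smul r x _ hx => rw [mul_smul_comm]; exact Submodule.smul_mem _ _ hx

theorem mem_adjoin_range_gen (a : OkadaAlgebra K N X Y) :
    a ∈ Algebra.adjoin K (Set.range (gen (N := N) X Y)) := by
  rw [adjoin_range_gen]
  exact Algebra.mem_top

theorem mul_mem_lowerSpan (a : OkadaAlgebra K N X Y) {b : OkadaAlgebra K N X Y}
    (hb : b ∈ lowerSpan X Y S) : a * b ∈ lowerSpan X Y S := by
  induction mem_adjoin_range_gen a using Algebra.adjoin_induction generalizing b with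
  | mem a ha => obtain ⟨i, rfl⟩ := ha; exact gen_mul_mem_lowerSpan i hb
  | algebraMap r => rw [← Algebra.smul_def]; exact Submodule.smul_mem _ _ hb
  | add x y _ _ hx hy => rw [add_mul]; exact add_mem (hx hb) (hy hb)
  | mul x y _ _ hx hy => rw [mul_assoc]; exact hx (hy hb)

/-- Modulo smaller cells, left multiplication by `a` acts on the cell of `S` through the matrix `r`
on left halves, whatever the right half: condition 3 of a cellular algebra. -/
def IsCellMatrix (S : FibSet N) (a : OkadaAlgebra K N X Y)
    (r : HalfDiagramWith S → HalfDiagramWith S → K) : Prop :=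
  ∀ L R : HalfDiagramWith S,
    a * diagramElt X Y (join L R) - ∑ᶠ L', r L' L • diagramElt X Y (join L' R) ∈ lowerSpan X Y S

namespace IsCellMatrix

variable {a b : OkadaAlgebra K N X Y} {r s : HalfDiagramWith S → HalfDiagramWith S → K}

open Classical in
theorem algebraMap (k : K) : IsCellMatrix S (algebraMap K (OkadaAlgebra K N X Y) k)
    fun L' L => if L' = L then k else 0 := fun L R => by
  simp only [ite_smul, zero_smul]
  rw [finsum_eq_single _ L fun L' h => if_neg h, if_pos rfl, ← Algebra.smul_def, sub_self]
  exact zero_mem _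

theorem add (ha : IsCellMatrix S a r) (hb : IsCellMatrix S b s) :
    IsCellMatrix S (a + b) (r + s) := fun L R => by
  have := Fintype.ofFinite (HalfDiagramWith S)
  have h := add_mem (ha L R) (hb L R)
  simp only [finsum_eq_sum_of_fintype, Pi.add_apply, add_smul, Finset.sum_add_distrib] at h ⊢
  rwa [add_mul, add_sub_add_comm]

theorem mul [Fintype (HalfDiagramWith S)] (ha : IsCellMatrix S a r) (hb : IsCellMatrix S b s) :
    IsCellMatrix S (a * b) fun L' L => ∑ M, s M L * r L' M := fun L R => by
  have hb' := mul_mem_lowerSpan a (hb L R)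
  have ha' := Submodule.sum_mem (lowerSpan X Y S) (t := Finset.univ)
    fun M _ => Submodule.smul_mem _ (s M L) (ha M R)
  have hab := add_mem hb' ha'
  simp only [finsum_eq_sum_of_fintype] at hab ⊢
  convert hab using 1
  simp only [mul_sub, smul_sub, Finset.sum_sub_distrib, Finset.mul_sum, mul_smul_comm,
    Finset.smul_sum, Finset.sum_smul, mul_smul, mul_assoc]
  rw [Finset.sum_comm]
  abel

open Classical in
theorem gen (i : GenIdx N) : IsCellMatrix S (gen X Y i) fun L' L =>
    if L'.1 = (act i (join L L)).leftHalf then weight X Y i (join L L) else 0 := fun L R => by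
  have hhalf : (join L L).leftHalf = (join L R).leftHalf := by rw [leftHalf_join, leftHalf_join]
  simp only [leftHalf_act_congr i hhalf, weight_congr X Y i hhalf, gen_mul_diagramElt, ite_smul,
    zero_smul]
  by_cases hS : fibSet (act i (join L R)) = S
  · obtain ⟨M, hM, hact⟩ := act_join_eq_join i hS
    rw [finsum_eq_single _ M fun L' h => if_neg fun e => h (Subtype.ext (e.trans hM.symm)),
      if_pos hM, ← hact, sub_self]
    exact zero_mem _
  · have hlt : fibSet (act i (join L R)) < S :=
      lt_of_le_of_ne ((fibSet_act_le i _).trans_eq (fibSet_join L R)) hS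
    have hne (L' : HalfDiagramWith S) : L'.1 ≠ (act i (join L R)).leftHalf := fun e =>
      hS (Subtype.ext ((propLab_rightHalf _).trans ((congrArg _ e.symm).trans L'.2)))
    simp only [if_neg (hne _), finsum_zero, sub_zero]
    exact Submodule.smul_mem _ _ (diagramElt_mem_lowerSpan hlt)

end IsCellMatrix

theorem exists_isCellMatrix (S : FibSet N) (a : OkadaAlgebra K N X Y) :
    ∃ r, IsCellMatrix S a r := by
  have := Fintype.ofFinite (HalfDiagramWith S)
  induction mem_adjoin_range_gen a using Algebra.adjoin_induction with
  | mem a ha => obtain ⟨i, rfl⟩ := ha; exact ⟨_, IsCellMatrix.gen i⟩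
  | algebraMap k => exact ⟨_, IsCellMatrix.algebraMap k⟩
  | add a b _ _ ha hb => exact ⟨_, ha.choose_spec.add hb.choose_spec⟩
  | mul a b _ _ ha hb => exact ⟨_, ha.choose_spec.mul hb.choose_spec⟩

theorem isCellDatum_diagramElt (X Y : ℕ → K) :
    IsCellDatum (Λ := FibSet N) (fun S => HalfDiagramWith S)
      (fun _ L R => diagramElt X Y (join L R)) (mirrorMap X Y) where
  finite_dimensional := ⟨by
    rw [← span_range_diagramElt X Y]
    exact Submodule.fg_span (Set.finite_range _)⟩
  finite_index _ := inferInstance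
  injective := (linearIndependent_diagramElt X Y).injective.comp join_injective
  linearIndependent := (linearIndependent_diagramElt X Y).comp _ join_injective
  span_eq_top := by
    rw [← span_range_diagramElt, ← join_surjective.range_comp (diagramElt X Y)]
    rfl
  star_mul := mirrorMap_mul X Y
  star_star := mirrorMap_mirrorMap X Y
  star_basis S L R := by
    rw [mirrorMap_diagramElt, join, mirror_glue]
    rfl
  mul_basis := exists_isCellMatrix

end Cellular

end

end Okada

theorem mainTheorem5 {K : Type*} [Field K] (N : ℕ) (X Y : ℕ → K) :
    (∀ D : Okada.ArcDiagram N,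
      ∃! σ : Equiv.Perm (Fin N), Okada.IsWordDiagram (Okada.permWord σ) D) ∧
    ∃ star : Okada.OkadaAlgebra K N X Y →ₗ[K] Okada.OkadaAlgebra K N X Y,
      (∀ D : Okada.ArcDiagram N,
        star (Okada.diagramElt X Y D) = Okada.diagramElt X Y D.mirror) ∧
      Okada.IsCellDatum (Λ := Okada.FibSet N)
        (fun S => Okada.HalfDiagramWith S)
        (fun S L R => Okada.diagramElt X Y (Okada.glue L.1 R.1 (L.2.trans R.2.symm)))
        star :=
  ⟨Okada.existsUnique_isWordDiagram, Okada.mirrorMap X Y, Okada.mirrorMap_diagramElt X Y,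
    Okada.isCellDatum_diagramElt X Y⟩
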